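/- **Setting.** Let $K,n\ge 1$ be integers, $\Delta>0$, $\mathrm{CUBE}=[-\frac{\Delta}{2},\frac{\Delta}{2})^K$, and for $\mathbf x\in\mathbb R^K$ let $\mathbf x^*\in\mathrm{CUBE}$ be the vector obtained by reducing each coordinate modulo $\Delta$ to $[-\frac\Delta2,\frac\Delta2)$. Let $\mathbf\Sigma\in\mathbb R^{K\times K}$ be positive definite, $\mathbf X\sim N(\mathbf 0,\mathbf\Sigma)$, and let $0<\epsilon<1$, $\tau_{\min}>0$, $0<P<1$ be such that - (A1) $\min\{\Pr(\mathbf A\mathbf X\notin\mathrm{CUBE}) : \mathbf A\in\mathbb Z^{K\times K},\ \det\mathbf A=\pm1\}\le\epsilon$; - (A2) all eigenvalues of $\mathbf\Sigma$ are at least $\tau_{\min}^2$; - (A3) $\Pr(\mathbf X\notin\mathrm{CUBE})\le P$. Let $Q(t)=\frac1{\sqrt{2\pi}}\int_t^\infty e^{-s^2/2}ds$, $f(a)=a^2-1-\ln a^2$, $\kappa_\epsilon=Q^{-1}(\epsilon/2)/\sqrt K$, and $$\alpha(P;K)=\max\left[F_{\chi^2(K+2)}\left(\left(Q^{-1}(P/2)\right)^2\right),\,1-\sqrt{3P}\right],$$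 where $F_{\chi^2(m)}$ is the CDF of the $\chi^2$ distribution with $m$ degrees of freedom. Put $\mathbf\Sigma_{\rm tr}=\mathbb E[\mathbf X\mathbf X^T\mid\mathbf X\in\mathrm{CUBE}]$. **Procedure.** Given points $\mathbf v_1,\dots,\mathbf v_n$ and $d>0$, put $\mathbf v_0=\mathbf 0$, join $\mathbf v_i,\mathbf v_j$ by an edge iff $\|\mathbf v_i-\mathbf v_j\|<d$, and let $\mathcal T$ be the connected component of $\mathbf v_0$ (with $\mathbf v_0$). If $|\mathcal T|<K+1$, replace $d$ by $1.1\,d$ and repeat; otherwise output $\overset{\vee}{\mathbf\Sigma}=\frac1{|\mathcal T|}\sum_{\mathbf t\in\mathcal T}\mathbf t\mathbf t^T$. **Theorem.** There is an absolute constant $C>0$ such that the following holds whenever $\kappa_\epsilon>1$, $\eta\in(0,1-1/\kappa_\epsilon)$, $\beta>0$ and $$n\ge C\cdot\frac{K\log K}{2\alpha(P;K)}\cdot\left(\frac{\Delta}{\tau_{\min}}\right)^2\cdot\frac1{\beta^2}.$$ Let $\mathbf X_1,\dots,\mathbf X_n$ be independent with law $N(\mathbf 0,\mathbf\Sigma)$,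 run the procedure on $\mathbf X_1^*,\dots,\mathbf X_n^*$ with initial distance $d=2\eta\sqrt K\,\tau_{\min}\kappa_\epsilon$, and let $$\overline\beta=\beta+\frac{2K(\Delta/\tau_{\min})^2}{\alpha(P;K)\sqrt n}.$$ Let $\mathcal G$ be the event that the procedure terminates and $(1-\overline\beta)\mathbf\Sigma_{\rm tr}\preceq\overset{\vee}{\mathbf\Sigma}\preceq(1+\overline\beta)\mathbf\Sigma_{\rm tr}$. Put $\overline r^2=K+\log n+\sqrt{2K\log n}$ and $\mathcal P=\{\mathbf x:\mathbf x^T\mathbf\Sigma^{-1}\mathbf x\le\overline r^2\}$, and define the events - $\mathcal E_{\text{false-positive}}$: for the initial distance $d$, some $\mathbf X_i^*$ with $\mathbf X_i\notin\mathrm{CUBE}$ is in the component of $\mathbf 0$; - $\mathcal E_{\text{many-escapees}}$: more than $2\sqrt n$ of the $\mathbf X_i$ lie outside $\mathcal P$; - $\mathcal E_{\text{sample-est}}$: with $\mathcal S_0=\{i:\mathbf X_i\in\mathrm{CUBE}\}$, either $|\mathcal S_0|<(1-P)n/2$, or $\big\|\frac1{|\mathcal S_0|}\sum_{i\in\mathcal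 S_0}\mathbf Y_i\mathbf Y_i^T-\mathbf I\big\|>\beta$ in operator norm, where $\mathbf Y_i=\mathbf\Sigma_{\rm tr}^{-1/2}\mathbf X_i$; - $\mathcal E_{\text{miss-cover}}$: some open ball $B(\mathbf c,d/4)$, $\mathbf c\in\mathcal C$, contains no $\mathbf X_i^*$; here $\mathcal C$ is any fixed cover of $\mathcal P\cap\mathrm{CUBE}$ by closed balls of radius $d/4$ with centers in $\mathcal P\cap\mathrm{CUBE}$, of minimal cardinality. Then $$\Pr(\mathcal E_{\text{false-positive}})\le n e^{-\frac K2f((1-\eta)\kappa_\epsilon)},\qquad \Pr(\mathcal E_{\text{many-escapees}})\le e^{-\frac3{14}\sqrt n},$$ $$\Pr(\mathcal E_{\text{sample-est}})\le\exp\left[-\beta^2\frac{\alpha(P;K)}{C\cdot\frac K2\left(\frac{\Delta}{\tau_{\min}}\right)^2}n\right]+e^{-\frac12(1-P)^2n},$$ $$\Pr(\mathcal E_{\text{miss-cover}})\le\exp\left[-\left(\frac{\frac{\tau_{\min}}{|\mathbf\Sigma|^{1/2K}}\kappa_\epsilon\eta}{\sqrt{\frac\pi2}\left(\frac{2\Delta}{\tau_{\min}}+4\right)}\right)^Ke^{\frac12\log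 n-\sqrt{\frac12K\log n}-\frac12K}+K\log\left(\sqrt K+\frac{2\Delta/\tau_{\min}}{\kappa_\epsilon\eta}\right)\right],$$ and $\Pr(\mathcal G)\ge1-p$, where $p$ is the sum of these four upper bounds. If moreover $\beta<1$, then $\Pr(\mathcal G)\ge1-p_{\text{est-err}}$ with $$p_{\text{est-err}}=\Pr(\mathcal E_{\text{false-positive}})+\Pr(\mathcal E_{\text{sample-est}})+\Pr(\mathcal E_{\text{many-escapees}})+\Pr(\mathcal E_{\text{miss-cover}}).$$ -/

import Mathlib

open MeasureTheory ProbabilityTheory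

noncomputable section

namespace BlindUnwrap

/-- Euclidean space of dimension `K`. -/
abbrev Vec (K : ℕ) : Type := EuclideanSpace ℝ (Fin K)

/-- Real square matrices of size `K`. -/
abbrev Mat (K : ℕ) : Type := Matrix (Fin K) (Fin K) ℝ

/-! ### Scalar functions -/

/-- The Gaussian tail function `Q(t) = (2π)^{-1/2} ∫_t^∞ e^{-s²/2} ds`. -/
def Q (t : ℝ) : ℝ :=
  (Real.sqrt (2 * Real.pi))⁻¹ * ∫ s in Set.Ioi t, Real.exp (-s ^ 2 / 2)

/-- The inverse of `Q`, meaningful on the range `(0, 1)` of the injective function `Q`. -/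
def Qinv : ℝ → ℝ := Function.invFun Q

/-- The distribution function of the sum of squares of `m` i.i.d. standard Gaussians. -/
def chiSqCDF (m : ℕ) (x : ℝ) : ℝ :=
  (Measure.pi fun _ : Fin m => gaussianReal 0 1).real {z | ∑ i, z i ^ 2 ≤ x}

/-- `f(a) = a² - 1 - ln a²`. -/
def rate (a : ℝ) : ℝ := a ^ 2 - 1 - Real.log (a ^ 2)

/-- `κ_ε = Q⁻¹(ε/2) / √K`. -/
def kappa (K : ℕ) (ε : ℝ) : ℝ := Qinv (ε / 2) / Real.sqrt K

/-- `α(P;K) = max (F_{χ²(K+2)}(Q⁻¹(P/2)²), 1 - √(3P))`. -/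
def alpha (P : ℝ) (K : ℕ) : ℝ :=
  max (chiSqCDF (K + 2) (Qinv (P / 2) ^ 2)) (1 - Real.sqrt (3 * P))

/-! ### Modulo reduction, the cube, the truncated covariance -/

/-- Coordinatewise modulo reduction `x - Δ ⌈x/Δ⌋`, with values in `[-Δ/2, Δ/2)`. -/
def wrap {K : ℕ} (Δ : ℝ) (x : Vec K) : Vec K :=
  WithLp.toLp 2 fun k => x k - Δ * (round (x k / Δ) : ℝ)

/-- The cube `[-Δ/2, Δ/2)^K`. -/
def cube (K : ℕ) (Δ : ℝ) : Set (Vec K) := {x | ∀ k, x k ∈ Set.Ico (-(Δ / 2)) (Δ / 2)}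

/-- `Pr(A X ∉ CUBE)` for `X ∼ N(0, S)`. -/
def missProb {K : ℕ} (S : Mat K) (Δ : ℝ) (A : Matrix (Fin K) (Fin K) ℤ) : ℝ :=
  (multivariateGaussian 0 S).real
    {x | Matrix.toEuclideanCLM (𝕜 := ℝ) (A.map (fun a : ℤ => (a : ℝ))) x ∉ cube K Δ}

/-- The matrix `E[X Xᵀ | X ∈ CUBE]` for `X ∼ N(0, S)`. -/
def truncCov {K : ℕ} (S : Mat K) (Δ : ℝ) : Mat K :=
  Matrix.of fun i j => ∫ x, x i * x j ∂(cond (multivariateGaussian 0 S) (cube K Δ))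

/-! ### The assumptions on the covariance matrix -/

/-- Some unimodular `A` has `Pr(A X ∉ CUBE) ≤ ε`,
i.e. the minimum of this probability over the unimodular matrices is at most `ε`. -/
def A1 {K : ℕ} (S : Mat K) (Δ ε : ℝ) : Prop :=
  ∃ A : Matrix (Fin K) (Fin K) ℤ, (A.det = 1 ∨ A.det = -1) ∧ missProb S Δ A ≤ ε

/-- All eigenvalues of `S` are at least `τ²`. -/
def A2 {K : ℕ} (S : Mat K) (τ : ℝ) : Prop :=
  ∃ hS : S.IsHermitian, ∀ k, τ ^ 2 ≤ hS.eigenvalues k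

/-- `Pr(X ∉ CUBE) ≤ P`. -/
def A3 {K : ℕ} (S : Mat K) (Δ P : ℝ) : Prop :=
  (multivariateGaussian 0 S).real {x | x ∉ cube K Δ} ≤ P

/-! ### The estimation procedure -/

section Procedure

variable {K n : ℕ}

/-- The `n + 1` points `0, v₁, …, vₙ`. -/
def points (v : Fin n → Vec K) : Fin (n + 1) → Vec K := Fin.cons (α := fun _ => Vec K) 0 v

/-- The graph on the indices `0, …, n` that joins two distinct indices
iff the corresponding points are at distance less than `d`. -/
def distGraph (v : Fin n → Vec K) (d : ℝ) : SimpleGraph (Fin (n + 1)) where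
  Adj i j := i ≠ j ∧ ‖points v i - points v j‖ < d
  symm := ⟨fun _ _ h => ⟨h.1.symm, by rw [norm_sub_rev]; exact h.2⟩⟩
  loopless := ⟨fun _ h => h.1 rfl⟩

open scoped Classical in
/-- The connected component `T` of the point `0` (vertex `0` included). -/
def component (v : Fin n → Vec K) (d : ℝ) : Finset (Fin (n + 1)) :=
  Finset.univ.filter fun i => (distGraph v d).Reachable 0 i

/-- `|T|⁻¹ ∑_{t ∈ T} t tᵀ` for the component `T` at distance `d`. -/
def componentCov (v : Fin n → Vec K) (d : ℝ) : Mat K :=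
  ((component v d).card : ℝ)⁻¹ •
    ∑ i ∈ component v d, Matrix.vecMulVec (points v i) (points v i)

open scoped Classical in
/-- The output of `EstimateTruncatedCovariance`: start with the distance `d`, replace `d` by
`1.1 d` as long as the component has fewer than `K + 1` vertices, and output the empirical
second-moment matrix of the component. The value `none` means that the loop never ends. -/
def estimateTruncCov (v : Fin n → Vec K) (d : ℝ) : Option (Mat K) :=
  if h : ∃ j : ℕ, K + 1 ≤ (component v ((1.1 : ℝ) ^ j * d)).card then
    some (componentCov v ((1.1 : ℝ) ^ (Nat.find h) * d))
  else none

end Procedure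

/-! ### The target event and the four bad events

Each is a set of sample configurations `x = (x₁, …, xₙ)` (before wrapping). -/

section Events

variable {K n : ℕ}

/-- The procedure, run on the wrapped samples, ends with an estimate between
`(1 - b) E[X Xᵀ | X ∈ CUBE]` and `(1 + b) E[X Xᵀ | X ∈ CUBE]` in the semidefinite order. -/
def accurate (S : Mat K) (Δ d b : ℝ) : Set (Fin n → Vec K) :=
  {x | ∃ V : Mat K, estimateTruncCov (fun i => wrap Δ (x i)) d = some V ∧
    (V - (1 - b) • truncCov S Δ).PosSemidef ∧ ((1 + b) • truncCov S Δ - V).PosSemidef}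

/-- Some wrapped sample point is connected to `0` although it was changed by the wrapping. -/
def falsePositive (Δ d : ℝ) : Set (Fin n → Vec K) :=
  {x | ∃ i, x i ∉ cube K Δ ∧ i.succ ∈ component (fun i => wrap Δ (x i)) d}

/-- The square of the radius `r̄`: `r̄² = K + log n + √(2 K log n)`. -/
def rbarSq (K n : ℕ) : ℝ :=
  K + Real.log n + Real.sqrt (2 * K * Real.log n)

/-- The ellipsoid `{x | xᵀ S⁻¹ x ≤ r̄²}`. -/
def ellipsoid (S : Mat K) (n : ℕ) : Set (Vec K) :=
  {x | dotProduct x (S⁻¹.mulVec x) ≤ rbarSq K n}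

/-- More than `2√n` sample points lie outside the ellipsoid. -/
def manyEscapees (S : Mat K) : Set (Fin n → Vec K) :=
  {x | 2 * Real.sqrt n < ({i | x i ∉ ellipsoid S n} : Set (Fin n)).ncard}

open scoped Classical in
/-- The indices of the sample points that lie in the cube. -/
def unwrapped (Δ : ℝ) (x : Fin n → Vec K) : Finset (Fin n) :=
  Finset.univ.filter fun i => x i ∈ cube K Δ

/-- `E[X Xᵀ | X ∈ CUBE]^{-1/2}`, by the spectral decomposition. -/
def whitening (S : Mat K) (Δ : ℝ) : Mat K :=
  cfc (fun t : ℝ => (Real.sqrt t)⁻¹) (truncCov S Δ)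

/-- The empirical second-moment matrix of the whitened points `E[X Xᵀ | X ∈ CUBE]^{-1/2} xᵢ`,
over the sample points in the cube. -/
def whitenedCov (S : Mat K) (Δ : ℝ) (x : Fin n → Vec K) : Mat K :=
  ((unwrapped Δ x).card : ℝ)⁻¹ •
    ∑ i ∈ unwrapped Δ x,
      Matrix.vecMulVec ((whitening S Δ).mulVec (x i)) ((whitening S Δ).mulVec (x i))

/-- Fewer than `(1 - P) n / 2` sample points lie in the cube, or the empirical second-moment
matrix of the whitened ones differs from the identity by more than `β` in operator norm. -/
def sampleEst (S : Mat K) (Δ P β : ℝ) : Set (Fin n → Vec K) :=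
  {x | ((unwrapped Δ x).card : ℝ) < (1 - P) * n / 2 ∨
    β < ‖Matrix.toEuclideanCLM (n := Fin K) (𝕜 := ℝ) (whitenedCov S Δ x - 1)‖}

/-- `C` is a finite `r`-cover of `U` with centers in `U`. -/
def IsCover (r : ℝ) (U : Set (Vec K)) (C : Finset (Vec K)) : Prop :=
  (C : Set (Vec K)) ⊆ U ∧ ∀ x ∈ U, ∃ c ∈ C, ‖x - c‖ ≤ r

/-- An `r`-cover of minimal cardinality. -/
def IsMinCover (r : ℝ) (U : Set (Vec K)) (C : Finset (Vec K)) : Prop :=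
  IsCover r U C ∧ ∀ C' : Finset (Vec K), IsCover r U C' → C.card ≤ C'.card

/-- Some ball of radius `d/4` centered in the cover `C` contains no wrapped sample point. -/
def missCover (Δ d : ℝ) (C : Finset (Vec K)) : Set (Fin n → Vec K) :=
  {x | ∃ c ∈ C, ∀ i, wrap Δ (x i) ∉ Metric.ball c (d / 4)}

end Events

/-! ### The bounds on the four probabilities -/

/-- Bound for the false positives. -/
def boundFalsePositive (K n : ℕ) (ε η : ℝ) : ℝ :=
  n * Real.exp (-(K / 2) * rate ((1 - η) * kappa K ε))

/-- Bound for the escapees. -/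
def boundManyEscapees (n : ℕ) : ℝ := Real.exp (-(3 / 14) * Real.sqrt n)

/-- Bound for the sample estimation. -/
def boundSampleEst (C : ℝ) (K n : ℕ) (Δ τ P β : ℝ) : ℝ :=
  Real.exp (-(β ^ 2 * (alpha P K / (C * (K / 2) * (Δ / τ) ^ 2)) * n)) +
    Real.exp (-(1 / 2) * (1 - P) ^ 2 * n)

/-- Bound for the missed cover. -/
def boundMissCover {K : ℕ} (S : Mat K) (n : ℕ) (Δ τ ε η : ℝ) : ℝ :=
  Real.exp
    (-(((τ / S.det ^ (1 / (2 * K) : ℝ)) * kappa K ε * η /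
            (Real.sqrt (Real.pi / 2) * (2 * Δ / τ + 4))) ^ K *
        Real.exp (1 / 2 * Real.log n - Real.sqrt (1 / 2 * K * Real.log n) - 1 / 2 * K)) +
      K * Real.log (Real.sqrt K + (2 * Δ / τ) / (kappa K ε * η)))

end BlindUnwrap

end

/-!
Only the joint law of the samples matters, so every event is studied under the product measure
`sampleLaw`. Vectors are compared in two metrics: `rootInv S`, that is `Σ^{-1/2}`, makes the
samples standard Gaussian, and `whiten`, that is `Σ_tr^{-1/2}`, makes the truncated law isotropic.

*False positives.* By (A1) there are integer vectors, the rows of a unimodular matrix, whose inner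
products with `X` have standard deviation at most `Δ / (2 √K κ)`. A nonzero lattice vector has a
nonzero integer inner product with one of them, so in the metric of `Σ⁻¹` the lattice `Δ ℤ^K` has
packing radius at least `√K κ` (`two_mul_sqrt_mul_kappa_le`). On a path of short steps from the
origin to a wrapped point, the first edge that leaves the set of unwrapped points has an end whose
sample lies at distance at least `√K (1 - η) κ` from the origin (`exists_large_of_falsePositive`),
and a chi-square tail bound finishes the argument.

*Escapees and missed balls.* The Laurent–Massart bound gives `Pr(X ∉ 𝒫) ≤ 1 / √n`, and Markov's
inequality for a factor `2` per escapee gives `manyEscapees_le`. Every ball of the cover contains a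
small cube inside `𝒫 ∩ CUBE` (`box_subset`), whose probability is bounded below through the
density on `𝒫`; a grid bounds the number of balls (`missCover_le`).

*The role of `α`.* The truncated second moment in any direction is at least `α / (1 - P)` times
the untruncated one (`alpha_mul_norm_root_sq_le`). For the first member of the maximum, the
intersection of the strips that bound the cube contains a suitable ellipsoid, and the ratio of the
distribution functions of `χ²(K+2)` and `χ²(1)` is monotone; for the second one, Cauchy–Schwarz
with the fourth moment suffices. Hence whitened points of the cube have squared norm at most
`M = K (Δ/τ)² (1 - P) / (4 α)` (`norm_whiten_sq_le`).

*Sample estimation.* Hoeffding's inequality controls the number of points in the cube. The whitened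
second-moment matrix has entries with exponential moments that depend only on the probability of
the cube (`integral_exp_entry_le`), and the packing bound makes `M` large enough to dominate their
scale. A Chernoff bound for each entry and a union bound treat `β` up to the order of `K`; the
condition on `n` absorbs the prefactor `2 K²` if `K ≥ 2`. Larger `β` are treated through the sum of
the squared norms; if moreover the cube is very unlikely, part of the bound comes from slack in
Hoeffding's inequality. For `K = 1` the condition on `n` is void and there is nothing to absorb a
prefactor. If the exponent is small, one shows instead that the complementary event has a
probability at least as large as the exponent. This is an anticoncentration statement for the sum
of the recentered squares, and it follows from integration by parts against the Gaussian density,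
where the boundary terms have a favorable sign (`integral_mul_comp_le`,
`le_measureReal_abs_sum_le`).

*The guarantee.* Outside of the four events, all points of `𝒫 ∩ CUBE` are connected to the origin:
a segment to the origin stays in this convex set and is covered by balls that contain sample points
(`mem_componentSample_of_mem`). The component consists of points of the cube and misses at most
`2 √n` of them, so its average differs little from the average over the cube (`mem_accurate`). This
needs `n ≥ K²`, which follows from the condition on `n` if `β < 1`; and if `n < K²` the explicit
bound on the probability of a missed ball is at least `1` (`one_le_boundMissCover`).
-/

noncomputable section

namespace BlindUnwrap

/-! ### The standard Gaussian measure on Euclidean space -/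

/-- The density of the standard Gaussian measure on `Vec K` with respect to Lebesgue measure. -/
def stdDensity (K : ℕ) (z : Vec K) : ℝ :=
  (Real.sqrt (2 * Real.pi))⁻¹ ^ K * Real.exp (-‖z‖ ^ 2 / 2)

lemma stdDensity_pos (K : ℕ) (z : Vec K) : 0 < stdDensity K z := by
  unfold stdDensity; positivity

lemma continuous_stdDensity (K : ℕ) : Continuous (stdDensity K) := by
  unfold stdDensity; fun_prop

lemma pi_gaussianReal_eq_withDensity (K : ℕ) :
    Measure.pi (fun _ : Fin K => gaussianReal 0 1) =
      (volume : Measure (Fin K → ℝ)).withDensity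
        (fun x => ENNReal.ofReal (∏ i, gaussianPDFReal 0 1 (x i))) := by
  refine Measure.pi_eq fun s hs => ?_
  rw [withDensity_apply _ (MeasurableSet.univ_pi hs), volume_pi, Measure.restrict_pi_pi,
    ← ofReal_integral_eq_lintegral_ofReal,
    integral_fintype_prod_eq_prod (f := fun _ y => gaussianPDFReal 0 1 y),
    ENNReal.ofReal_prod_of_nonneg]
  · refine Finset.prod_congr rfl fun i _ => ?_
    rw [gaussianReal_apply_eq_integral _ one_ne_zero]
  · exact fun i _ => integral_nonneg fun y => gaussianPDFReal_nonneg _ _ _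
  · exact Integrable.fintype_prod (f := fun _ y => gaussianPDFReal 0 1 y) fun i =>
      (integrable_gaussianPDFReal 0 1).integrableOn
  · exact ae_of_all _ fun x => Finset.prod_nonneg fun i _ => gaussianPDFReal_nonneg _ _ _

lemma prod_gaussianPDFReal (K : ℕ) (x : Fin K → ℝ) :
    ∏ i, gaussianPDFReal 0 1 (x i) = stdDensity K (WithLp.toLp 2 x) := by
  simp only [gaussianPDFReal, stdDensity, Finset.prod_mul_distrib, Finset.prod_const,
    Finset.card_univ, Fintype.card_fin, ← Real.exp_sum, EuclideanSpace.real_norm_sq_eq]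
  simp [Finset.sum_div, neg_div]

lemma stdGaussian_eq_withDensity (K : ℕ) :
    stdGaussian (Vec K) = volume.withDensity (fun z => ENNReal.ofReal (stdDensity K z)) := by
  rw [← map_pi_eq_stdGaussian, pi_gaussianReal_eq_withDensity]
  ext s hs
  rw [Measure.map_apply (by fun_prop) hs, withDensity_apply _ (by measurability),
    withDensity_apply _ hs,
    ← (PiLp.volume_preserving_toLp (Fin K)).setLIntegral_comp_preimage hs
      (by have := continuous_stdDensity K; fun_prop)]
  simp_rw [prod_gaussianPDFReal]

lemma integral_stdGaussian (K : ℕ) (f : Vec K → ℝ) :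
    ∫ z, f z ∂(stdGaussian (Vec K)) = ∫ z, stdDensity K z * f z := by
  rw [stdGaussian_eq_withDensity, integral_withDensity_eq_integral_toReal_smul]
  · simp [ENNReal.toReal_ofReal (stdDensity_pos K _).le]
  · have := continuous_stdDensity K; fun_prop
  · simp

/-! ### Exponential moments and the chi-square tail -/

lemma integral_exp_mul_sq_gaussianReal {l : ℝ} (hl : l < 1 / 2) :
    ∫ x, Real.exp (l * x ^ 2) ∂(gaussianReal 0 1) = (Real.sqrt (1 - 2 * l))⁻¹ := by
  have h0 : (0:ℝ) < 1 - 2 * l := by linarith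
  rw [integral_gaussianReal_eq_integral_smul one_ne_zero]
  have : ∀ x : ℝ, gaussianPDFReal 0 1 x • Real.exp (l * x ^ 2) =
      (Real.sqrt (2 * Real.pi))⁻¹ * Real.exp (-(1 / 2 - l) * x ^ 2) := by
    intro x
    simp only [gaussianPDFReal, smul_eq_mul, mul_assoc, ← Real.exp_add, NNReal.coe_one, mul_one]
    ring_nf
  simp_rw [this]
  rw [integral_const_mul, integral_gaussian, show Real.pi / (1 / 2 - l) =
    (2 * Real.pi) * (1 - 2 * l)⁻¹ by field_simp,
      Real.sqrt_mul (by positivity) (1 - 2 * l)⁻¹, Real.sqrt_inv (1 - 2 * l),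
    ← mul_assoc, inv_mul_cancel₀ (by positivity), one_mul]

lemma integrable_exp_mul_sq_gaussianReal {l : ℝ} (hl : l < 1 / 2) :
    Integrable (fun x => Real.exp (l * x ^ 2)) (gaussianReal 0 1) := by
  refine Integrable.of_integral_ne_zero ?_
  rw [integral_exp_mul_sq_gaussianReal hl]
  have h0 : (0:ℝ) < 1 - 2 * l := by linarith
  positivity

lemma measurePreserving_toLp_stdGaussian (K : ℕ) :
    MeasurePreserving (MeasurableEquiv.toLp 2 (Fin K → ℝ))
      (Measure.pi fun _ : Fin K => gaussianReal 0 1) (stdGaussian (Vec K)) :=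
  ⟨by fun_prop, map_pi_eq_stdGaussian⟩

lemma exp_mul_norm_sq_toLp {K : ℕ} (l : ℝ) (x : Fin K → ℝ) :
    Real.exp (l * ‖(WithLp.toLp 2 x : Vec K)‖ ^ 2) = ∏ i, Real.exp (l * x i ^ 2) := by
  rw [← Real.exp_sum, EuclideanSpace.real_norm_sq_eq, Finset.mul_sum]

lemma integral_exp_mul_norm_sq {K : ℕ} {l : ℝ} (hl : l < 1 / 2) :
    ∫ z, Real.exp (l * ‖z‖ ^ 2) ∂(stdGaussian (Vec K)) = (Real.sqrt (1 - 2 * l))⁻¹ ^ K := by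
  rw [← (measurePreserving_toLp_stdGaussian K).integral_comp']
  simp_rw [MeasurableEquiv.coe_toLp, exp_mul_norm_sq_toLp]
  rw [integral_fintype_prod_eq_prod (f := fun _ y => Real.exp (l * y ^ 2))]
  simp [integral_exp_mul_sq_gaussianReal hl]

lemma integrable_exp_mul_norm_sq {K : ℕ} {l : ℝ} (hl : l < 1 / 2) :
    Integrable (fun z => Real.exp (l * ‖z‖ ^ 2)) (stdGaussian (Vec K)) := by
  refine Integrable.of_integral_ne_zero ?_
  rw [integral_exp_mul_norm_sq hl]
  have h0 : (0:ℝ) < 1 - 2 * l := by linarith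
  positivity

/-- Chernoff's bound for the chi-square distribution, with its exact exponent. -/
lemma measureReal_norm_sq_ge_le {K : ℕ} {a : ℝ} (ha : 1 ≤ a) :
    (stdGaussian (Vec K)).real {z | K * a ^ 2 ≤ ‖z‖ ^ 2} ≤ Real.exp (-(K / 2) * rate a) := by
  have ha2 : 1 ≤ a ^ 2 := one_le_pow₀ ha
  -- the optimal exponent in Markov's inequality
  set l : ℝ := (1 - 1 / a ^ 2) / 2 with hl
  have hinv : 0 < 1 / a ^ 2 := by positivity
  have hinv1 : 1 / a ^ 2 ≤ 1 := by rw [div_le_one (by positivity)]; exact ha2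
  have h1 : l < 1 / 2 := by linarith
  have h0 : 0 ≤ l := by linarith
  have hsub : {z : Vec K | K * a ^ 2 ≤ ‖z‖ ^ 2} ⊆
      {z | Real.exp (l * (K * a ^ 2)) ≤ Real.exp (l * ‖z‖ ^ 2)} := fun z hz => by
    simp only [Set.mem_ofPred_eq, Real.exp_le_exp] at hz ⊢
    exact mul_le_mul_of_nonneg_left hz h0
  have hm := mul_meas_ge_le_integral_of_nonneg (μ := stdGaussian (Vec K))
    (ae_of_all _ fun z => (Real.exp_pos (l * ‖z‖ ^ 2)).le)
    (integrable_exp_mul_norm_sq h1) (Real.exp (l * (K * a ^ 2)))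
  rw [integral_exp_mul_norm_sq h1] at hm
  have h2 : Real.sqrt (1 - 2 * l) = a⁻¹ := by
    rw [hl, show 1 - 2 * ((1 - 1 / a ^ 2) / 2) = (a⁻¹) ^ 2 by field_simp; ring]
    exact Real.sqrt_sq (by positivity)
  rw [h2, inv_inv] at hm
  have h3 : a ^ K = Real.exp (K * Real.log a) := by
    rw [mul_comm, Real.exp_mul, Real.exp_log (by positivity), Real.rpow_natCast]
  have h4 := mul_le_mul_of_nonneg_left ((mul_le_mul_of_nonneg_left (measureReal_mono hsub)
    (Real.exp_pos _).le).trans hm) (Real.exp_pos (-(l * (K * a ^ 2)))).le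
  rw [← mul_assoc, ← Real.exp_add, neg_add_cancel, Real.exp_zero, one_mul, h3,
    ← Real.exp_add] at h4
  refine h4.trans_eq ?_
  rw [rate, Real.log_pow, hl]
  congr 1
  field_simp
  push_cast
  ring

/-! ### Radial integrals against the standard Gaussian measure -/

/-- Polar coordinates. Only the independence of `A` from `g` matters: wherever this is used, the
constant cancels or is determined by the total mass. -/
lemma exists_radial_const (m : ℕ) (hm : 0 < m) : ∃ A : ℝ, ∀ g : ℝ → ℝ,
    ∫ z, g ‖z‖ ∂(stdGaussian (Vec m)) =
      A * ∫ y in Set.Ioi (0 : ℝ), y ^ (m - 1) * (Real.exp (-y ^ 2 / 2) * g y) := by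
  have : NeZero m := ⟨hm.ne'⟩
  refine ⟨m * (volume : Measure (Vec m)).real (Metric.ball 0 1) *
    (Real.sqrt (2 * Real.pi))⁻¹ ^ m, fun g => ?_⟩
  rw [integral_stdGaussian]
  have h := integral_fun_norm_addHaar (volume : Measure (Vec m))
    (fun y => (Real.sqrt (2 * Real.pi))⁻¹ ^ m * Real.exp (-y ^ 2 / 2) * g y)
  simp only [stdDensity]
  rw [h, ← integral_const_mul, finrank_euclideanSpace_fin]
  simp only [nsmul_eq_mul, smul_eq_mul, ← integral_const_mul]
  refine integral_congr_ae (ae_of_all _ fun y => ?_)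
  simp only; ring

lemma integral_sq_gaussianReal : ∫ x, x ^ 2 ∂(gaussianReal 0 1) = 1 := by
  have h := variance_id_gaussianReal (μ := 0) (v := 1)
  rw [variance_eq_integral aemeasurable_id] at h
  simpa using h

lemma integral_norm_sq_stdGaussian (K : ℕ) : ∫ z, ‖z‖ ^ 2 ∂(stdGaussian (Vec K)) = K := by
  rw [← (measurePreserving_toLp_stdGaussian K).integral_comp']
  simp_rw [MeasurableEquiv.coe_toLp, EuclideanSpace.real_norm_sq_eq]
  have hi : Integrable (fun x : ℝ => x ^ 2) (gaussianReal 0 1) :=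
    (memLp_id_gaussianReal 2).integrable_sq
  rw [integral_finsetSum _ fun i _ => integrable_comp_eval (i := i)
    (μ := fun _ : Fin K => gaussianReal 0 1) (f := fun y : ℝ => y ^ 2) hi]
  simp_rw [integral_comp_eval (μ := fun _ : Fin K => gaussianReal 0 1) (f := fun y : ℝ => y ^ 2)
    hi.aestronglyMeasurable, integral_sq_gaussianReal]
  simp

/-- Weighting the law of `‖z‖` by `‖z‖²` raises the dimension by two. -/
lemma integral_norm_sq_mul {K : ℕ} (hK : 0 < K) (h : ℝ → ℝ) :
    ∫ z, ‖z‖ ^ 2 * h ‖z‖ ∂(stdGaussian (Vec K)) =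
      K * ∫ z, h ‖z‖ ∂(stdGaussian (Vec (K + 2))) := by
  obtain ⟨A, hA⟩ := exists_radial_const K hK
  obtain ⟨B, hB⟩ := exists_radial_const (K + 2) (by omega)
  have key : ∀ g : ℝ → ℝ, ∫ y in Set.Ioi (0 : ℝ), y ^ (K - 1) * (Real.exp (-y ^ 2 / 2) *
      (y ^ 2 * g y)) = ∫ y in Set.Ioi (0 : ℝ), y ^ (K + 2 - 1) * (Real.exp (-y ^ 2 / 2) * g y) := by
    intro g
    congr 1; ext y
    rw [show K + 2 - 1 = (K - 1) + 2 by omega, pow_add]; ring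
  -- both constants are determined by the choice `h = 1`
  have h1 := hA fun y => y ^ 2 * 1
  have h2 := hB fun _ => 1
  rw [key fun _ => 1] at h1
  simp only [mul_one, integral_norm_sq_stdGaussian] at h1
  simp only [integral_const, probReal_univ, smul_eq_mul, mul_one] at h2
  rw [hA fun y => y ^ 2 * h y, hB h, key h]
  have hJ : (∫ y in Set.Ioi (0 : ℝ), y ^ (K + 2 - 1) * Real.exp (-y ^ 2 / 2)) ≠ 0 := by
    intro h0; rw [h0] at h2; simp at h2
  have hAB : A = K * B := by
    apply mul_right_cancel₀ hJ
    rw [← h1, mul_assoc, ← h2, mul_one]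
  rw [hAB, mul_assoc]

lemma integral_pow_four_gaussianReal : ∫ x, x ^ 4 ∂(gaussianReal 0 1) = 3 := by
  have h := integral_norm_sq_mul one_pos fun y => y ^ 2
  rw [integral_norm_sq_stdGaussian, ← (measurePreserving_toLp_stdGaussian 1).integral_comp'] at h
  simp_rw [MeasurableEquiv.coe_toLp, EuclideanSpace.real_norm_sq_eq] at h
  have hi : Integrable (fun x : ℝ => x ^ 4) (gaussianReal 0 1) := by
    have := (memLp_id_gaussianReal (μ := 0) (v := 1) 4).integrable_norm_pow (by norm_num)
    refine this.congr (ae_of_all _ fun x => ?_)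
    simp [Even.pow_abs (by decide : Even 4)]
  have h2 := integral_comp_eval (μ := fun _ : Fin 1 => gaussianReal 0 1) (i := 0)
    (f := fun y : ℝ => y ^ 4) hi.aestronglyMeasurable
  rw [← h2]
  simp only [Finset.univ_unique, Finset.sum_singleton, Fin.default_eq_zero] at h
  push_cast at h
  norm_num at h
  rw [← h]
  congr 1; ext x; ring

/-- The Gaussian second moment in a direction `u`, weighted by a function of the norm. -/
lemma integral_inner_sq_mul {K : ℕ} (hK : 0 < K) (h : ℝ → ℝ) (hm : Measurable h)
    (hb : ∃ b, ∀ y, |h y| ≤ b) (u : Vec K) :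
    ∫ z, inner ℝ z u ^ 2 * h ‖z‖ ∂(stdGaussian (Vec K)) =
      ‖u‖ ^ 2 * ∫ z, h ‖z‖ ∂(stdGaussian (Vec (K + 2))) := by
  obtain ⟨b, hb⟩ := hb
  have hb0 : 0 ≤ b := (abs_nonneg _).trans (hb 0)
  have hn : Integrable (fun z : Vec K => ‖z‖ ^ 2) (stdGaussian (Vec K)) := by
    refine Integrable.of_integral_ne_zero ?_
    rw [integral_norm_sq_stdGaussian]; exact_mod_cast hK.ne'
  have hint : ∀ u : Vec K, Integrable (fun z => inner ℝ z u ^ 2 * h ‖z‖)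
      (stdGaussian (Vec K)) := by
    intro u
    refine (hn.mul_const (‖u‖ ^ 2 * b)).mono'
      (by fun_prop) (ae_of_all _ fun z => ?_)
    rw [norm_mul, norm_pow, Real.norm_eq_abs, Real.norm_eq_abs, ← mul_assoc, ← mul_pow]
    gcongr
    · exact abs_real_inner_le_norm z u
    · exact hb _
  -- invariance under the reflection that exchanges two vectors of the same norm
  have hrot : ∀ u v : Vec K, ‖u‖ = ‖v‖ → ∫ z, inner ℝ z u ^ 2 * h ‖z‖ ∂(stdGaussian (Vec K)) =
      ∫ z, inner ℝ z v ^ 2 * h ‖z‖ ∂(stdGaussian (Vec K)) := by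
    intro u v huv
    set f : Vec K ≃ₗᵢ[ℝ] Vec K := (ℝ ∙ (u - v))ᗮ.reflection with hf
    have hfu : f u = v := Submodule.reflection_sub huv
    have h1 : ∫ z, inner ℝ z v ^ 2 * h ‖z‖ ∂((stdGaussian (Vec K)).map f) =
        ∫ z, inner ℝ z u ^ 2 * h ‖z‖ ∂(stdGaussian (Vec K)) := by
      rw [integral_map f.continuous.aemeasurable (by fun_prop), ← hfu]
      simp only [LinearIsometryEquiv.inner_map_map, LinearIsometryEquiv.norm_map]
    rw [← h1, stdGaussian_map f]
  have hbasis : ∀ i, ∫ z, inner ℝ z (‖u‖ • EuclideanSpace.single i (1:ℝ)) ^ 2 * h ‖z‖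
      ∂(stdGaussian (Vec K)) = ∫ z, inner ℝ z u ^ 2 * h ‖z‖ ∂(stdGaussian (Vec K)) := by
    intro i
    apply hrot; simp [norm_smul]
  have hsum : ∑ i : Fin K, ∫ z, inner ℝ z (‖u‖ • EuclideanSpace.single i (1:ℝ)) ^ 2 * h ‖z‖
      ∂(stdGaussian (Vec K)) =
      ‖u‖ ^ 2 * ∫ z, ‖z‖ ^ 2 * h ‖z‖ ∂(stdGaussian (Vec K)) := by
    rw [← integral_finsetSum _ fun i _ => hint _, ← integral_const_mul]
    congr 1; ext z
    rw [EuclideanSpace.real_norm_sq_eq z, Finset.sum_mul, Finset.mul_sum]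
    refine Finset.sum_congr rfl fun i _ => ?_
    rw [inner_smul_right, EuclideanSpace.inner_single_right]
    simp; ring
  simp_rw [hbasis] at hsum
  rw [integral_norm_sq_mul hK, Finset.sum_const, Finset.card_univ, Fintype.card_fin,
    nsmul_eq_mul] at hsum
  have : (K:ℝ) ≠ 0 := by exact_mod_cast hK.ne'
  apply mul_left_cancel₀ this
  rw [hsum]; ring

/-! ### The chi-square distribution function -/

lemma chiSqCDF_sq (m : ℕ) {t : ℝ} (ht : 0 ≤ t) :
    chiSqCDF m (t ^ 2) = (stdGaussian (Vec m)).real {z | ‖z‖ ≤ t} := by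
  rw [chiSqCDF, ← map_pi_eq_stdGaussian, map_measureReal_apply (by fun_prop)
    (measurableSet_le (by fun_prop) (by fun_prop))]
  congr 1; ext x
  simp only [Set.mem_ofPred_eq, Set.preimage_ofPred_eq]
  rw [← abs_of_nonneg (norm_nonneg (WithLp.toLp 2 x : Vec m)), ← sq_le_sq₀ (abs_nonneg _) ht,
    sq_abs, EuclideanSpace.real_norm_sq_eq]

lemma chiSqCDF_sq_eq_integral (m : ℕ) {t : ℝ} (ht : 0 ≤ t) :
    chiSqCDF m (t ^ 2) =
      ∫ z, (Set.Iic t).indicator (fun _ => (1:ℝ)) ‖z‖ ∂(stdGaussian (Vec m)) := by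
  rw [chiSqCDF_sq m ht, ← integral_indicator_one (measurableSet_le (by fun_prop) (by fun_prop))]
  rfl

lemma chiSqCDF_nonneg (m : ℕ) (x : ℝ) : 0 ≤ chiSqCDF m x := measureReal_nonneg

lemma chiSqCDF_one (t : ℝ) :
    chiSqCDF 1 (t ^ 2) = (gaussianReal 0 1).real {x | |x| ≤ |t|} := by
  have h := measurePreserving_eval (fun _ : Fin 1 => gaussianReal 0 1) 0
  rw [chiSqCDF, ← h.measureReal_preimage
    (measurableSet_le (by fun_prop) (by fun_prop)).nullMeasurableSet]
  congr 1; ext x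
  simp [sq_le_sq]

/-- The centered ball of radius `|t|` lies in the cube of half-side `|t|`. -/
lemma chiSqCDF_le_pow (m : ℕ) (t : ℝ) :
    chiSqCDF m (t ^ 2) ≤ chiSqCDF 1 (t ^ 2) ^ m := by
  rw [chiSqCDF_one, chiSqCDF]
  have hsub : {z : Fin m → ℝ | ∑ i, z i ^ 2 ≤ t ^ 2} ⊆
      Set.univ.pi fun _ => {x | |x| ≤ |t|} := by
    intro z hz i _
    have : z i ^ 2 ≤ t ^ 2 :=
      (Finset.single_le_sum (f := fun i => z i ^ 2) (fun i _ => sq_nonneg _)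
        (Finset.mem_univ i)).trans hz
    exact sq_le_sq.mp this
  refine (measureReal_mono hsub).trans_eq ?_
  rw [measureReal_def, Measure.pi_pi]
  simp [ENNReal.toReal_pow, measureReal_def]

/-- The ratio of the distribution functions of `χ²(m)` and `χ²(1)` is nondecreasing. -/
lemma chiSqCDF_ratio_mono {m : ℕ} (hm : 0 < m) {t t₀ : ℝ} (ht : 0 ≤ t) (h : t ≤ t₀) :
    chiSqCDF m (t ^ 2) * chiSqCDF 1 (t₀ ^ 2) ≤ chiSqCDF m (t₀ ^ 2) * chiSqCDF 1 (t ^ 2) := by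
  have ht₀ := ht.trans h
  obtain ⟨A, hA⟩ := exists_radial_const m hm
  obtain ⟨B, hB⟩ := exists_radial_const 1 one_pos
  have hset : ∀ s : ℝ, ∀ g : ℝ → ℝ, ∫ y in Set.Ioi (0:ℝ), g y * (Real.exp (-y ^ 2 / 2) *
      (Set.Iic s).indicator (fun _ => (1:ℝ)) y) =
      ∫ y in Set.Ioc 0 s, g y * Real.exp (-y ^ 2 / 2) := by
    intro s g
    rw [← Set.Ioi_inter_Iic, ← setIntegral_indicator measurableSet_Iic]
    congr 1; ext y
    by_cases hy : y ∈ Set.Iic s <;> simp [hy]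
  have hc : Continuous fun y : ℝ => Real.exp (-y ^ 2 / 2) := by fun_prop
  have hint : ∀ a b : ℝ, ∀ j : ℕ, IntegrableOn (fun y => y ^ j * Real.exp (-y ^ 2 / 2))
      (Set.Ioc a b) := fun a b j =>
    ((by fun_prop : Continuous fun y : ℝ =>
        y ^ j * Real.exp (-y ^ 2 / 2)).integrableOn_Icc).mono_set
      Set.Ioc_subset_Icc_self
  have hsplit : ∀ j : ℕ, ∫ y in Set.Ioc 0 t₀, y ^ j * Real.exp (-y ^ 2 / 2) =
      (∫ y in Set.Ioc 0 t, y ^ j * Real.exp (-y ^ 2 / 2)) +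
        ∫ y in Set.Ioc t t₀, y ^ j * Real.exp (-y ^ 2 / 2) := by
    intro j
    rw [← setIntegral_union (Set.Ioc_disjoint_Ioc_of_le le_rfl) measurableSet_Ioc
      (hint _ _ _) (hint _ _ _), Set.Ioc_union_Ioc_eq_Ioc ht h]
  -- relative to `χ²(1)`, the radial density carries the additional factor `y ^ (m - 1)`, which is
  -- at most `t ^ (m - 1)` below `t` and at least `t ^ (m - 1)` above `t`
  have hu : ∫ y in Set.Ioc 0 t, y ^ (m - 1) * Real.exp (-y ^ 2 / 2) ≤
      t ^ (m - 1) * ∫ y in Set.Ioc 0 t, y ^ 0 * Real.exp (-y ^ 2 / 2) := by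
    rw [← integral_const_mul]
    refine setIntegral_mono_on (hint _ _ _) ((hint _ _ _).const_mul _) measurableSet_Ioc
      fun y hy => ?_
    have := pow_le_pow_left₀ hy.1.le hy.2 (m - 1)
    simp only [pow_zero, one_mul]; gcongr
  have hl : t ^ (m - 1) * ∫ y in Set.Ioc t t₀, y ^ 0 * Real.exp (-y ^ 2 / 2) ≤
      ∫ y in Set.Ioc t t₀, y ^ (m - 1) * Real.exp (-y ^ 2 / 2) := by
    rw [← integral_const_mul]
    refine setIntegral_mono_on ((hint _ _ _).const_mul _) (hint _ _ _) measurableSet_Ioc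
      fun y hy => ?_
    have := pow_le_pow_left₀ ht hy.1.le (m - 1)
    simp only [pow_zero, one_mul]; gcongr
  have hnn : ∀ a b : ℝ, 0 ≤ ∫ y in Set.Ioc a b, y ^ 0 * Real.exp (-y ^ 2 / 2) := fun a b =>
    setIntegral_nonneg measurableSet_Ioc fun y _ => by positivity
  have hAB : 0 ≤ A ∧ 0 ≤ B := by
    have aux : ∀ (j : ℕ) (D : ℝ), 1 =
            D * (∫ y in Set.Ioi (0:ℝ), y ^ j * (Real.exp (-y ^ 2 / 2) * 1))
        → 0 ≤ D := by
      intro j D hD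
      by_contra hneg
      have : 0 ≤ ∫ y in Set.Ioi (0:ℝ), y ^ j * (Real.exp (-y ^ 2 / 2) * 1) :=
        setIntegral_nonneg measurableSet_Ioi fun y (hy : 0 < y) => by positivity
      nlinarith
    constructor
    · refine aux (m - 1) A ?_
      have := hA fun _ => 1
      simpa using this
    · refine aux (1 - 1) B ?_
      have := hB fun _ => 1
      simpa using this
  rw [chiSqCDF_sq_eq_integral m ht, chiSqCDF_sq_eq_integral 1 ht₀, chiSqCDF_sq_eq_integral m ht₀,
    chiSqCDF_sq_eq_integral 1 ht, hA, hA, hB, hB, hset, hset, hset, hset]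
  rw [show (1 - 1 : ℕ) = 0 from rfl, hsplit (m - 1), hsplit 0]
  set I1 := ∫ y in Set.Ioc 0 t, y ^ (m - 1) * Real.exp (-y ^ 2 / 2)
  set I2 := ∫ y in Set.Ioc t t₀, y ^ (m - 1) * Real.exp (-y ^ 2 / 2)
  set E1 := ∫ y in Set.Ioc 0 t, y ^ 0 * Real.exp (-y ^ 2 / 2)
  set E2 := ∫ y in Set.Ioc t t₀, y ^ 0 * Real.exp (-y ^ 2 / 2)
  have hE1 : 0 ≤ E1 := hnn _ _
  have hE2 : 0 ≤ E2 := hnn _ _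
  have h5 : I1 * E2 ≤ I2 * E1 := by
    calc I1 * E2 ≤ t ^ (m - 1) * E1 * E2 := by gcongr
      _ = t ^ (m - 1) * E2 * E1 := by ring
      _ ≤ I2 * E1 := by gcongr
  have h6 : A * I1 * (B * (E1 + E2)) = A * B * (I1 * E1 + I1 * E2) := by ring
  have h7 : A * (I1 + I2) * (B * E1) = A * B * (I1 * E1 + I2 * E1) := by ring
  rw [h6, h7]
  have := mul_nonneg hAB.1 hAB.2
  gcongr

/-! ### The Gaussian tail function -/

lemma Q_eq (t : ℝ) : Q t = (gaussianReal 0 1).real (Set.Ioi t) := by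
  rw [measureReal_def, gaussianReal_apply_eq_integral _ one_ne_zero, ENNReal.toReal_ofReal
    (integral_nonneg fun y => gaussianPDFReal_nonneg _ _ _), Q, ← integral_const_mul]
  simp [gaussianPDFReal]

lemma Q_strictAnti : StrictAnti Q := by
  intro a b hab
  have hpos : 0 < (gaussianReal 0 1).real (Set.Ioc a b) := by
    rw [measureReal_def, ENNReal.toReal_pos_iff]
    refine ⟨pos_iff_ne_zero.mpr fun h0 => ?_, measure_lt_top _ _⟩
    have := gaussianReal_absolutelyContinuous' 0 (one_ne_zero : (1 : NNReal) ≠ 0) h0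
    rw [Real.volume_Ioc, ENNReal.ofReal_eq_zero] at this
    linarith
  rw [Q_eq, Q_eq, ← Set.Ioc_union_Ioi_eq_Ioi hab.le,
    measureReal_union (Set.Ioc_disjoint_Ioi le_rfl) measurableSet_Ioi]
  linarith

lemma Q_eq_one_sub_cdf (t : ℝ) : Q t = 1 - cdf (gaussianReal 0 1) t := by
  rw [Q_eq, cdf_eq_real, ← Set.compl_Iic, probReal_compl_eq_one_sub measurableSet_Iic]

lemma continuous_Q : Continuous Q := by
  have : Q = fun t => Q 0 - ∫ s in (0:ℝ)..t, gaussianPDFReal 0 1 s := by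
    ext t
    have hi := (integrable_gaussianPDFReal 0 1)
    have hQ : ∀ t, Q t = ∫ s in Set.Ioi t, gaussianPDFReal 0 1 s := fun t => by
      rw [Q_eq, measureReal_def, gaussianReal_apply_eq_integral _ one_ne_zero,
        ENNReal.toReal_ofReal (integral_nonneg fun y => gaussianPDFReal_nonneg _ _ _)]
    rw [hQ, hQ, ← intervalIntegral.integral_Ioi_sub_Ioi' hi.integrableOn hi.integrableOn]
    ring
  rw [this]
  exact continuous_const.sub
    (intervalIntegral.continuous_primitive (fun a b =>
      (integrable_gaussianPDFReal 0 1).intervalIntegrable) 0)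

lemma Q_Qinv {y : ℝ} (h0 : 0 < y) (h1 : y < 1) : Q (Qinv y) = y := by
  refine Function.invFun_eq ?_
  have htop : Filter.Tendsto Q Filter.atTop (nhds 0) := by
    have h := (tendsto_cdf_atTop (gaussianReal 0 1)).const_sub 1
    simp only [sub_self] at h
    exact h.congr fun t => (Q_eq_one_sub_cdf t).symm
  have hbot : Filter.Tendsto Q Filter.atBot (nhds 1) := by
    have h := (tendsto_cdf_atBot (gaussianReal 0 1)).const_sub 1
    simp only [sub_zero] at h
    exact h.congr fun t => (Q_eq_one_sub_cdf t).symm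
  exact mem_range_of_exists_le_of_exists_ge continuous_Q
    ((htop.eventually (ge_mem_nhds h0)).exists) ((hbot.eventually (le_mem_nhds h1)).exists)

lemma gaussianReal_real_Iio_neg (t : ℝ) : (gaussianReal 0 1).real (Set.Iio (-t)) = Q t := by
  have h : (gaussianReal 0 1).map (fun x => -x) = gaussianReal 0 1 := by
    rw [gaussianReal_map_neg, neg_zero]
  rw [Q_eq, ← h, map_measureReal_apply measurable_neg measurableSet_Ioi]
  rw [h]
  congr 1; ext x; simp

lemma measureReal_lt_abs {t : ℝ} (ht : 0 ≤ t) :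
    (gaussianReal 0 1).real {x | t < |x|} = 2 * Q t := by
  have : {x : ℝ | t < |x|} = Set.Iio (-t) ∪ Set.Ioi t := by
    ext x; simp [lt_abs, lt_neg, or_comm]
  rw [this, measureReal_union _ measurableSet_Ioi, gaussianReal_real_Iio_neg, ← Q_eq]
  · ring
  · exact Set.disjoint_left.mpr fun x hx hx' => by
      simp only [Set.mem_Iio, Set.mem_Ioi] at hx hx'; linarith

lemma measureReal_abs_le {t : ℝ} (ht : 0 ≤ t) :
    (gaussianReal 0 1).real {x | |x| ≤ t} = 1 - 2 * Q t := by
  rw [← measureReal_lt_abs ht, ← probReal_compl_eq_one_sub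
    (measurableSet_lt (by fun_prop) (by fun_prop))]
  congr 1; ext x; simp

lemma Q_zero : Q 0 = 1 / 2 := by
  have h := measureReal_abs_le le_rfl
  have h0 : {x : ℝ | |x| ≤ 0} = {0} := by ext x; simp
  rw [h0] at h
  have := nullSingletonClass_gaussianReal (μ := 0) (one_ne_zero : (1 : NNReal) ≠ 0)
  simp [measureReal_def] at h
  linarith

lemma Qinv_half_pos {P : ℝ} (h0 : 0 < P) (h1 : P < 1) : 0 < Qinv (P / 2) := by
  refine Q_strictAnti.lt_iff_gt.mp ?_
  rw [Q_zero, Q_Qinv (by linarith) (by linarith)]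
  linarith

lemma chiSqCDF_one_Qinv {P : ℝ} (h0 : 0 < P) (h1 : P < 1) :
    chiSqCDF 1 (Qinv (P / 2) ^ 2) = 1 - P := by
  have h := Qinv_half_pos h0 h1
  rw [chiSqCDF_one, abs_of_pos h, measureReal_abs_le h.le, Q_Qinv (by linarith) (by linarith)]
  ring

/-! ### Bounds on `α(P; K)` -/

/-- The first member of the maximum in `α` is at most `(1 - P) ^ (K + 2)`, and the second one is
negative or zero unless `P < 1/3`. The constant `8` takes care of that last range, because
`8 (2/3)⁵ > 1`. -/
lemma alpha_le_pow {P : ℝ} (h0 : 0 < P) (h1 : P < 1) {K j : ℕ} (hj : j ≤ K + 2) (hj5 : j ≤ 5) :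
    alpha P K ≤ 8 * (1 - P) ^ j := by
  have hp : 0 < 1 - P := by linarith
  refine max_le ?_ ?_
  · calc chiSqCDF (K + 2) (Qinv (P / 2) ^ 2) ≤ (1 - P) ^ (K + 2) := by
          rw [← chiSqCDF_one_Qinv h0 h1]; exact chiSqCDF_le_pow _ _
      _ ≤ (1 - P) ^ j := pow_le_pow_of_le_one hp.le (by linarith) hj
      _ ≤ 8 * (1 - P) ^ j := by have := pow_pos hp j; linarith
  · by_cases hP : 1 / 3 ≤ P
    · have : 1 ≤ Real.sqrt (3 * P) := Real.one_le_sqrt.mpr (by linarith)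
      have := pow_pos hp j; linarith
    · have h2 : (2 / 3 : ℝ) ^ 5 ≤ (1 - P) ^ j :=
        (pow_le_pow_of_le_one (by norm_num) (by norm_num) hj5).trans
          (pow_le_pow_left₀ (by norm_num) (by linarith) j)
      have := Real.sqrt_nonneg (3 * P)
      norm_num at h2; linarith

lemma alpha_le {P : ℝ} (h0 : 0 < P) (h1 : P < 1) (K : ℕ) : alpha P K ≤ 1 - P := by
  have hp : 0 < 1 - P := by linarith
  refine max_le ?_ ?_
  · calc chiSqCDF (K + 2) (Qinv (P / 2) ^ 2) ≤ (1 - P) ^ (K + 2) := by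
          rw [← chiSqCDF_one_Qinv h0 h1]; exact chiSqCDF_le_pow _ _
      _ ≤ (1 - P) ^ 1 := pow_le_pow_of_le_one hp.le (by linarith) (by omega)
      _ = 1 - P := pow_one _
  · have : P ≤ Real.sqrt (3 * P) := Real.le_sqrt_of_sq_le (by nlinarith)
    linarith

/-! ### The square root of the covariance matrix -/

section Root

open Matrix
open scoped MatrixOrder

variable {K : ℕ} {S : Mat K}

/-- The symmetric square root of the covariance matrix, as a map of Euclidean space. -/
def root (S : Mat K) : Vec K →L[ℝ] Vec K := toEuclideanCLM (𝕜 := ℝ) (CFC.sqrt S)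

/-- The inverse of the square root of the covariance matrix. -/
def rootInv (S : Mat K) : Vec K →L[ℝ] Vec K := toEuclideanCLM (𝕜 := ℝ) (CFC.sqrt S)⁻¹

lemma multivariateGaussian_eq_map : multivariateGaussian 0 S =
    (stdGaussian (Vec K)).map (root S) := by
  rw [multivariateGaussian]; congr 1; ext x; simp [root]

lemma inner_root_left (x y : Vec K) : inner ℝ (root S x) y = inner ℝ x (root S y) := by
  have h : IsSelfAdjoint (root S) := (CFC.sqrt_nonneg S).isSelfAdjoint.map _
  rw [← ContinuousLinearMap.adjoint_inner_right, h.adjoint_eq]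

lemma root_root (hS : S.PosSemidef) (x : Vec K) :
    root S (root S x) = toEuclideanCLM (𝕜 := ℝ) S x := by
  rw [root, ← ContinuousLinearMap.comp_apply, ← ContinuousLinearMap.mul_def, ← map_mul,
    CFC.sqrt_mul_sqrt_self _ hS.nonneg]

lemma norm_root_sq (hS : S.PosSemidef) (v : Vec K) : ‖root S v‖ ^ 2 = v ⬝ᵥ S *ᵥ v := by
  rw [← real_inner_self_eq_norm_sq, inner_root_left, root_root hS, inner_toEuclideanCLM]

lemma det_sqrt_sq (hS : S.PosSemidef) : (CFC.sqrt S).det ^ 2 = S.det := by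
  rw [sq, ← det_mul, CFC.sqrt_mul_sqrt_self _ hS.nonneg]

lemma isUnit_det_sqrt (hS : S.PosDef) : IsUnit (CFC.sqrt S).det := by
  have h := det_sqrt_sq hS.posSemidef
  refine isUnit_iff_ne_zero.mpr fun h0 => ?_
  rw [h0] at h
  exact hS.det_pos.ne' (by rw [← h]; simp)

lemma root_rootInv (hS : S.PosDef) (x : Vec K) : root S (rootInv S x) = x := by
  rw [root, rootInv, ← ContinuousLinearMap.comp_apply, ← ContinuousLinearMap.mul_def, ← map_mul,
    mul_nonsing_inv _ (isUnit_det_sqrt hS), map_one]; rfl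

lemma rootInv_root (hS : S.PosDef) (x : Vec K) : rootInv S (root S x) = x := by
  rw [root, rootInv, ← ContinuousLinearMap.comp_apply, ← ContinuousLinearMap.mul_def, ← map_mul,
    nonsing_inv_mul _ (isUnit_det_sqrt hS), map_one]; rfl

lemma inner_eq_inner_rootInv_root (hS : S.PosDef) (x v : Vec K) :
    inner ℝ x v = inner ℝ (rootInv S x) (root S v) := by
  rw [← inner_root_left, root_rootInv hS]

lemma norm_rootInv_sq (hS : S.PosDef) (x : Vec K) : ‖rootInv S x‖ ^ 2 = x ⬝ᵥ S⁻¹ *ᵥ x := by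
  have h : toEuclideanCLM (𝕜 := ℝ) S⁻¹ x = rootInv S (rootInv S x) := by
    rw [rootInv, ← ContinuousLinearMap.comp_apply, ← ContinuousLinearMap.mul_def, ← map_mul,
      ← Matrix.mul_inv_rev, CFC.sqrt_mul_sqrt_self _ hS.posSemidef.nonneg]
  rw [← inner_toEuclideanCLM, h, inner_eq_inner_rootInv_root hS x, root_rootInv hS,
    real_inner_self_eq_norm_sq]

lemma mem_ellipsoid_iff (hS : S.PosDef) {n : ℕ} {x : Vec K} :
    x ∈ ellipsoid S n ↔ ‖rootInv S x‖ ^ 2 ≤ rbarSq K n := by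
  rw [norm_rootInv_sq hS]; rfl

/-- The linear functionals of a standard Gaussian vector are Gaussian. -/
lemma map_inner_stdGaussian (w : Vec K) :
    (stdGaussian (Vec K)).map (fun z => inner ℝ z w) =
      (gaussianReal 0 1).map (fun x => ‖w‖ * x) := by
  have h := IsGaussian.map_eq_gaussianReal (μ := stdGaussian (Vec K)) (innerSL ℝ w)
  rw [variance_dual_stdGaussian, integral_strongDual_stdGaussian, innerSL_apply_norm] at h
  rw [gaussianReal_map_const_mul]
  have e : (fun z : Vec K => inner ℝ z w) = innerSL ℝ w := by
    ext z; simp [real_inner_comm]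
  rw [e, h]
  congr 1
  · simp
  · ext; simp

/-- The linear functionals of a Gaussian vector are Gaussian. -/
lemma map_inner_multivariateGaussian (v : Vec K) :
    (multivariateGaussian 0 S).map (fun x => inner ℝ x v) =
      (gaussianReal 0 1).map (fun x => ‖root S v‖ * x) := by
  rw [multivariateGaussian_eq_map, Measure.map_map (by fun_prop) (by fun_prop),
    ← map_inner_stdGaussian]
  congr 1; ext z
  simp [inner_root_left]

lemma le_norm_root_sq {τ : ℝ} (h : A2 S τ) (hS : S.PosDef) (v : Vec K) :
    τ ^ 2 * ‖v‖ ^ 2 ≤ ‖root S v‖ ^ 2 := by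
  obtain ⟨hH, he⟩ := h
  set b := hH.eigenvectorBasis
  have h1 : ∀ i, inner ℝ (b i) (toEuclideanCLM (𝕜 := ℝ) S v) =
      hH.eigenvalues i * inner ℝ (b i) v := by
    intro i
    have h3 : toEuclideanCLM (𝕜 := ℝ) S (b i) = hH.eigenvalues i • b i := by
      ext k; exact congrFun (hH.mulVec_eigenvectorBasis i) k
    have h2 : inner ℝ (b i) (toEuclideanCLM (𝕜 := ℝ) S v) =
        inner ℝ (toEuclideanCLM (𝕜 := ℝ) S (b i)) v := by
      rw [← root_root hS.posSemidef, ← root_root hS.posSemidef, inner_root_left, inner_root_left]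
    rw [h2, h3, inner_smul_left]; simp
  rw [← real_inner_self_eq_norm_sq (root S v), inner_root_left, root_root hS.posSemidef,
    ← b.sum_inner_mul_inner, ← real_inner_self_eq_norm_sq v, ← b.sum_inner_mul_inner,
    Finset.mul_sum]
  refine Finset.sum_le_sum fun i _ => ?_
  rw [h1, real_inner_comm]
  nlinarith [he i, sq_nonneg (inner ℝ (b i) v)]

lemma norm_rootInv_le {τ : ℝ} (h : A2 S τ) (hS : S.PosDef) (x : Vec K) :
    τ * ‖rootInv S x‖ ≤ ‖x‖ := by
  have := le_norm_root_sq h hS (rootInv S x)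
  rw [root_rootInv hS, ← mul_pow] at this
  exact le_of_sq_le_sq this (norm_nonneg _)

lemma pow_le_det {τ : ℝ} (h : A2 S τ) : (τ ^ 2) ^ K ≤ S.det := by
  obtain ⟨hH, he⟩ := h
  rw [hH.det_eq_prod_eigenvalues]
  calc (τ ^ 2) ^ K = ∏ _i : Fin K, τ ^ 2 := by simp
    _ ≤ _ := Finset.prod_le_prod (fun i _ => sq_nonneg _) fun i _ => by simpa using he i

end Root

/-! ### Reduction to the product measure -/

section Reduction

variable {K n : ℕ} {S : Mat K}

/-- The joint law of `n` independent Gaussian vectors with covariance matrix `S`. -/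
abbrev sampleLaw (n : ℕ) (S : Mat K) : Measure (Fin n → Vec K) :=
  Measure.pi fun _ => multivariateGaussian 0 S

/-- No measurability of the event is needed for this inequality. -/
lemma measureReal_le_sampleLaw {Ω : Type*} [MeasurableSpace Ω] {μ : Measure Ω}
    [IsProbabilityMeasure μ] {X : Fin n → Ω → Vec K} (hX : iIndepFun X μ)
    (hlaw : ∀ i, HasLaw (X i) (multivariateGaussian 0 S) μ) (E : Set (Fin n → Vec K)) :
    μ.real {ω | (fun i => X i ω) ∈ E} ≤ (sampleLaw n S).real E := by
  have hm : ∀ i, AEMeasurable (X i) μ := fun i => (hlaw i).aemeasurable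
  have h : μ.map (fun ω i => X i ω) = sampleLaw n S := by
    rw [(iIndepFun_iff_map_fun_eq_pi_map hm).mp hX]
    congr 1; ext1 i; exact (hlaw i).map_eq
  rw [← h, measureReal_def, measureReal_def]
  have : IsProbabilityMeasure (μ.map (fun ω i => X i ω)) := by rw [h]; infer_instance
  exact ENNReal.toReal_mono (measure_ne_top _ _) (Measure.le_map_apply (by fun_prop) E)

lemma sampleLaw_real_eval (i : Fin n) {A : Set (Vec K)} (hA : MeasurableSet A) :
    (sampleLaw n S).real {x | x i ∈ A} = (multivariateGaussian 0 S).real A :=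
  (measurePreserving_eval (fun _ : Fin n => multivariateGaussian 0 S) i).measureReal_preimage
    hA.nullMeasurableSet

lemma multivariateGaussian_real_eq {A : Set (Vec K)} (hA : MeasurableSet A) :
    (multivariateGaussian 0 S).real A = (stdGaussian (Vec K)).real (root S ⁻¹' A) := by
  rw [multivariateGaussian_eq_map, map_measureReal_apply (by fun_prop) hA]

end Reduction

/-! ### The cube and the wrapping -/

section Cube

variable {K : ℕ} {Δ : ℝ}

lemma measurableSet_cube : MeasurableSet (cube K Δ) := by
  have : cube K Δ = ⋂ k, (fun x : Vec K => x k) ⁻¹' Set.Ico (-(Δ / 2)) (Δ / 2) := by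
    ext x; simp [cube]
  rw [this]
  exact MeasurableSet.iInter fun k => measurableSet_Ico.preimage (by fun_prop)

lemma round_eq_zero_iff_mem {Δ : ℝ} (hΔ : 0 < Δ) (y : ℝ) :
    round (y / Δ) = 0 ↔ y ∈ Set.Ico (-(Δ / 2)) (Δ / 2) := by
  rw [round_eq_zero_iff, Set.mem_Ico, Set.mem_Ico, le_div_iff₀ hΔ, div_lt_iff₀ hΔ]
  constructor <;> rintro ⟨h1, h2⟩ <;> constructor <;> linarith

lemma wrap_of_mem (hΔ : 0 < Δ) {x : Vec K} (hx : x ∈ cube K Δ) : wrap Δ x = x := by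
  ext k
  simp [wrap, (round_eq_zero_iff_mem hΔ (x k)).mpr (hx k)]

lemma wrap_mem_cube (hΔ : 0 < Δ) (x : Vec K) : wrap Δ x ∈ cube K Δ := by
  intro k
  rw [← round_eq_zero_iff_mem hΔ]
  have : wrap Δ x k / Δ = x k / Δ - (round (x k / Δ) : ℤ) := by
    simp only [wrap]; field_simp
  rw [this, round_sub_intCast, sub_self]

lemma exists_eq_wrap_add (x : Vec K) (hΔ : 0 < Δ) : ∃ b : Fin K → ℤ,
    x = wrap Δ x + Δ • (WithLp.toLp 2 fun k => (b k : ℝ)) ∧ (x ∉ cube K Δ → b ≠ 0) := by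
  refine ⟨fun k => round (x k / Δ), ?_, fun hx hb => hx fun k => ?_⟩
  · ext k; simp [wrap]
  · rw [← round_eq_zero_iff_mem hΔ]; exact congrFun hb k

lemma norm_sq_le_of_mem_cube {x : Vec K} (hx : x ∈ cube K Δ) :
    ‖x‖ ^ 2 ≤ K * (Δ / 2) ^ 2 := by
  rw [EuclideanSpace.real_norm_sq_eq]
  calc ∑ i, x i ^ 2 ≤ ∑ _i : Fin K, (Δ / 2) ^ 2 :=
        Finset.sum_le_sum fun k _ => sq_le_sq' (hx k).1 (hx k).2.le
    _ = _ := by simp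

lemma zero_mem_cube (hΔ : 0 < Δ) : (0 : Vec K) ∈ cube K Δ := fun k => by
  simp only [PiLp.zero_apply, Set.mem_Ico]; constructor <;> linarith

end Cube

/-! ### The packing radius of the whitened lattice -/

section Packing

variable {K : ℕ} {S : Mat K} {Δ ε τ : ℝ}

lemma measureReal_inner_gt (v : Vec K) (c : ℝ) (hv : 0 < ‖root S v‖) (hc : 0 ≤ c) :
    (multivariateGaussian 0 S).real {x | c < |inner ℝ x v|} = 2 * Q (c / ‖root S v‖) := by
  rw [← measureReal_lt_abs (by positivity)]
  have h1 : MeasurableSet {y : ℝ | c < |y|} := measurableSet_lt (by fun_prop) (by fun_prop)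
  have h2 := map_measureReal_apply (μ := multivariateGaussian 0 S)
    (f := fun x => inner ℝ x v) (by fun_prop) h1
  rw [map_inner_multivariateGaussian, map_measureReal_apply (by fun_prop) h1] at h2
  rw [Set.preimage_ofPred_eq, Set.preimage_ofPred_eq] at h2
  rw [← h2]
  congr 1; ext y
  simp only [Set.mem_ofPred_eq, abs_mul, abs_norm]
  rw [div_lt_iff₀ hv, mul_comm]

/-- A functional that is rarely larger than `Δ/2` has a small standard deviation. -/
lemma two_mul_norm_root_mul_Qinv_le (hΔ : 0 < Δ) (hε : 0 < ε) (hε1 : ε < 1) (v : Vec K)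
    (h : (multivariateGaussian 0 S).real {x | Δ / 2 < |inner ℝ x v|} ≤ ε) :
    2 * ‖root S v‖ * Qinv (ε / 2) ≤ Δ := by
  rcases (norm_nonneg (root S v)).eq_or_lt with h0 | h0
  · rw [← h0]; simpa using hΔ.le
  · rw [measureReal_inner_gt v _ h0 (by positivity)] at h
    have h3 : Q (Δ / 2 / ‖root S v‖) ≤ Q (Qinv (ε / 2)) := by
      rw [Q_Qinv (by linarith) (by linarith)]; linarith
    have h4 := Q_strictAnti.le_iff_ge.mp h3
    rw [le_div_iff₀ h0] at h4
    linarith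

lemma sqrt_mul_kappa (hK : 0 < K) : Real.sqrt K * kappa K ε = Qinv (ε / 2) := by
  have : (0:ℝ) < Real.sqrt K := Real.sqrt_pos.mpr (by exact_mod_cast hK)
  rw [kappa]; field_simp

/-- Some unimodular matrix has rows whose inner products with the Gaussian vector
have standard deviation at most `Δ / (2 √K κ)`. -/
lemma exists_unimodular_rows (hK : 0 < K) (hΔ : 0 < Δ) (hε : 0 < ε) (hε1 : ε < 1)
    (h1 : A1 S Δ ε) : ∃ A : Matrix (Fin K) (Fin K) ℤ, (A.det = 1 ∨ A.det = -1) ∧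
      ∀ i, 2 * ‖root S (WithLp.toLp 2 fun k => (A i k : ℝ))‖ * (Real.sqrt K * kappa K ε) ≤ Δ := by
  obtain ⟨A, hdet, hA⟩ := h1
  refine ⟨A, hdet, fun i => ?_⟩
  rw [sqrt_mul_kappa hK]
  refine two_mul_norm_root_mul_Qinv_le hΔ hε hε1 _ ((measureReal_mono ?_).trans hA)
  intro x hx hc
  have h2 := hc i
  have h3 : (Matrix.toEuclideanCLM (𝕜 := ℝ) (A.map (fun a : ℤ => (a : ℝ))) x) i =
      inner ℝ x (WithLp.toLp 2 fun k => (A i k : ℝ)) := by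
    simp [Matrix.ofLp_toEuclideanCLM, Matrix.mulVec, dotProduct, PiLp.inner_apply]
  rw [h3] at h2
  have h4 : Δ / 2 < |inner ℝ x (WithLp.toLp 2 fun k => (A i k : ℝ))| := hx
  exact absurd (abs_le.mpr ⟨h2.1, h2.2.le⟩) (not_le.mpr h4)

/-- In the metric of the inverse covariance, nonzero vectors of the lattice `Δ ℤ^K` have length
at least `2 √K κ`. -/
lemma two_mul_sqrt_mul_kappa_le (hK : 0 < K) (hΔ : 0 < Δ) (hε : 0 < ε) (hε1 : ε < 1)
    (hS : S.PosDef) (h1 : A1 S Δ ε) (hκ : 0 ≤ kappa K ε) {b : Fin K → ℤ} (hb : b ≠ 0) :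
    2 * (Real.sqrt K * kappa K ε) ≤ Δ * ‖rootInv S (WithLp.toLp 2 fun k => (b k : ℝ))‖ := by
  obtain ⟨A, hdet, hA⟩ := exists_unimodular_rows hK hΔ hε hε1 h1
  have hne : A.mulVec b ≠ 0 := by
    intro h0
    refine hb (Matrix.eq_zero_of_mulVec_eq_zero ?_ h0)
    rcases hdet with h | h <;> simp [h]
  obtain ⟨i, hi⟩ := Function.ne_iff.mp hne
  have hi1 : (1:ℝ) ≤ |((A.mulVec b i : ℤ) : ℝ)| := by
    exact_mod_cast Int.one_le_abs hi
  set a : Vec K := WithLp.toLp 2 fun k => (A i k : ℝ) with ha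
  set β : Vec K := WithLp.toLp 2 fun k => (b k : ℝ) with hβ
  have h3 : ((A.mulVec b i : ℤ) : ℝ) = inner ℝ β a := by
    simp [ha, hβ, Matrix.mulVec, dotProduct, PiLp.inner_apply]
  rw [h3, inner_eq_inner_rootInv_root hS] at hi1
  have h4 := hi1.trans (abs_real_inner_le_norm _ _)
  have h5 := hA i
  have h6 : 0 ≤ Real.sqrt K * kappa K ε := by positivity
  calc 2 * (Real.sqrt K * kappa K ε) ≤
      2 * (Real.sqrt K * kappa K ε) * (‖rootInv S β‖ * ‖root S a‖) :=
        le_mul_of_one_le_right (by positivity) h4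
    _ = (2 * ‖root S a‖ * (Real.sqrt K * kappa K ε)) * ‖rootInv S β‖ := by ring
    _ ≤ Δ * ‖rootInv S β‖ := by gcongr

/-- The packing bound for a unit vector of `ℤ^K`, in Euclidean terms. It implies in particular that
`Δ / τ` is at least `2 √K` if `κ ≥ 1`. -/
lemma two_mul_sqrt_mul_kappa_mul_le (hK : 0 < K) (hΔ : 0 < Δ) (hε : 0 < ε) (hε1 : ε < 1)
    (hS : S.PosDef) (h1 : A1 S Δ ε) (hτ : 0 < τ) (h2 : A2 S τ) (hκ : 0 ≤ kappa K ε) :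
    2 * (Real.sqrt K * kappa K ε) * τ ≤ Δ := by
  have hne : (Pi.single (⟨0, hK⟩ : Fin K) (1:ℤ) : Fin K → ℤ) ≠ 0 := by
    rw [Ne, Pi.single_eq_zero_iff]; norm_num
  have h := two_mul_sqrt_mul_kappa_le hK hΔ hε hε1 hS h1 hκ hne
  set e : Vec K := WithLp.toLp 2 fun k => ((Pi.single (⟨0, hK⟩ : Fin K) (1:ℤ) : Fin K → ℤ) k : ℝ)
    with he
  have hn : ‖e‖ = 1 := by
    have : e = EuclideanSpace.single (⟨0, hK⟩ : Fin K) (1:ℝ) := by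
      ext k; by_cases hk : k = ⟨0, hK⟩ <;> simp [he, hk]
    rw [this]; simp
  have h3 := norm_rootInv_le h2 hS e
  rw [hn] at h3
  calc 2 * (Real.sqrt K * kappa K ε) * τ ≤ Δ * ‖rootInv S e‖ * τ := by gcongr
    _ = Δ * (τ * ‖rootInv S e‖) := by ring
    _ ≤ Δ * 1 := by gcongr
    _ = Δ := mul_one _

end Packing

/-! ### False positives -/

section FalsePositive

variable {K n : ℕ} {S : Mat K} {Δ ε τ η d : ℝ}

lemma mem_component {v : Fin n → Vec K} {d : ℝ} {i : Fin (n + 1)} :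
    i ∈ component v d ↔ (distGraph v d).Reachable 0 i := by
  classical
  simp [component]

/-- A false positive forces a sample point far from the origin in the whitened metric: the first
edge of a path that leaves the true points joins two points of different cells of the lattice. -/
lemma exists_large_of_falsePositive (hK : 0 < K) (hΔ : 0 < Δ) (hε : 0 < ε) (hε1 : ε < 1)
    (hS : S.PosDef) (h1 : A1 S Δ ε) (hτ : 0 < τ) (h2 : A2 S τ) (hκ : 0 ≤ kappa K ε)
    (hη : η ≤ 1) (hd : d = 2 * η * Real.sqrt K * τ * kappa K ε) {x : Fin n → Vec K}
    (hx : x ∈ falsePositive Δ d) :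
    ∃ i, Real.sqrt K * ((1 - η) * kappa K ε) ≤ ‖rootInv S (x i)‖ := by
  obtain ⟨i, hi, hcomp⟩ := hx
  obtain ⟨w⟩ := mem_component.mp hcomp
  -- the vertices at which wrapping changes nothing
  set T : Set (Fin (n + 1)) := {v | points x v ∈ cube K Δ} with hT
  obtain ⟨e, -, he1, he2⟩ := w.exists_boundary_dart T (zero_mem_cube hΔ) hi
  have hwr : ∀ v, points (fun i => wrap Δ (x i)) v = wrap Δ (points x v) := by
    intro v
    refine Fin.cases ?_ (fun j => ?_) v
    · exact (wrap_of_mem hΔ (zero_mem_cube hΔ)).symm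
    · rfl
  have hadj := e.adj.2
  rw [hwr, hwr, wrap_of_mem hΔ he1] at hadj
  obtain ⟨b, hb, hb0⟩ := exists_eq_wrap_add (points x e.snd) hΔ
  have hpack := two_mul_sqrt_mul_kappa_le hK hΔ hε hε1 hS h1 hκ (hb0 he2)
  set β : Vec K := WithLp.toLp 2 fun k => (b k : ℝ)
  have hdiff : points x e.snd - points x e.fst =
      Δ • β - (points x e.fst - wrap Δ (points x e.snd)) := by
    conv_lhs => rw [hb]
    abel
  have h3 : Δ * ‖rootInv S β‖ ≤ ‖rootInv S (points x e.snd)‖ + ‖rootInv S (points x e.fst)‖ +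
      ‖rootInv S (points x e.fst - wrap Δ (points x e.snd))‖ := by
    have h4 : Δ • rootInv S β = rootInv S (points x e.snd) - rootInv S (points x e.fst) +
        rootInv S (points x e.fst - wrap Δ (points x e.snd)) := by
      rw [← map_sub, hdiff, ← map_add, sub_add_cancel, map_smul]
    have h5 : Δ * ‖rootInv S β‖ = ‖Δ • rootInv S β‖ := by
      rw [norm_smul, Real.norm_of_nonneg hΔ.le]
    rw [h5, h4]
    exact (norm_add_le _ _).trans (by gcongr; exact norm_sub_le _ _)
  have h6 : ‖rootInv S (points x e.fst - wrap Δ (points x e.snd))‖ ≤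
      2 * η * Real.sqrt K * kappa K ε := by
    have h7 := (norm_rootInv_le h2 hS _).trans hadj.le
    refine le_of_mul_le_mul_left (h7.trans_eq ?_) hτ
    linarith
  have h8 : 0 ≤ Real.sqrt K * ((1 - η) * kappa K ε) :=
    mul_nonneg (Real.sqrt_nonneg _) (mul_nonneg (by linarith) hκ)
  have h9 : Real.sqrt K * ((1 - η) * kappa K ε) ≤ ‖rootInv S (points x e.snd)‖ ∨
      Real.sqrt K * ((1 - η) * kappa K ε) ≤ ‖rootInv S (points x e.fst)‖ := by
    by_contra! hcon
    nlinarith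
  have hpt : ∀ v, Real.sqrt K * ((1 - η) * kappa K ε) ≤ ‖rootInv S (points x v)‖ →
      ∃ i, Real.sqrt K * ((1 - η) * kappa K ε) ≤ ‖rootInv S (x i)‖ := by
    intro v
    refine Fin.cases (fun h0 => ?_) (fun j hj => ⟨j, hj⟩) v
    exact ⟨i, h0.trans (by simp [points])⟩
  exact h9.elim (hpt _) (hpt _)

lemma measurableSet_norm_rootInv {A : Set ℝ} (hA : MeasurableSet A) :
    MeasurableSet {x : Vec K | ‖rootInv S x‖ ^ 2 ∈ A} :=
  hA.preimage (f := fun x : Vec K => ‖rootInv S x‖ ^ 2) (by fun_prop)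

lemma measureReal_norm_rootInv (hS : S.PosDef) (A : Set ℝ) (hA : MeasurableSet A) :
    (multivariateGaussian 0 S).real {x | ‖rootInv S x‖ ^ 2 ∈ A} =
      (stdGaussian (Vec K)).real {z | ‖z‖ ^ 2 ∈ A} := by
  rw [multivariateGaussian_real_eq (measurableSet_norm_rootInv hA)]
  congr 1; ext z
  simp only [Set.mem_preimage, Set.mem_ofPred_eq, rootInv_root hS]

/-- A union bound over the `n` points and the chi-square tail, for the event in
`exists_large_of_falsePositive`. -/
lemma falsePositive_le (hK : 0 < K) (hΔ : 0 < Δ) (hε : 0 < ε) (hε1 : ε < 1)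
    (hS : S.PosDef) (h1 : A1 S Δ ε) (hτ : 0 < τ) (h2 : A2 S τ) (hκ : 1 < kappa K ε)
    (hη : η < 1 - 1 / kappa K ε) (hd : d = 2 * η * Real.sqrt K * τ * kappa K ε) :
    (sampleLaw n S).real (falsePositive Δ d) ≤ boundFalsePositive K n ε η := by
  have hκ0 : 0 < kappa K ε := by linarith
  have ha : 1 ≤ (1 - η) * kappa K ε := by
    have := mul_lt_mul_of_pos_right hη hκ0
    have e : (1 - 1 / kappa K ε) * kappa K ε = kappa K ε - 1 := by field_simp
    rw [e] at this; linarith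
  have hη1 : η ≤ 1 := by have : 0 < 1 / kappa K ε := by positivity
                         linarith
  have hsub : (falsePositive Δ d : Set (Fin n → Vec K)) ⊆ ⋃ i : Fin n,
      {x | x i ∈ {y | ‖rootInv S y‖ ^ 2 ∈ Set.Ici (K * ((1 - η) * kappa K ε) ^ 2)}} := by
    intro x hx
    obtain ⟨i, hi⟩ := exists_large_of_falsePositive hK hΔ hε hε1 hS h1 hτ h2 hκ0.le hη1 hd hx
    refine Set.mem_iUnion.mpr ⟨i, ?_⟩
    have := pow_le_pow_left₀ (by positivity) hi 2
    rwa [mul_pow, Real.sq_sqrt (Nat.cast_nonneg K)] at this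
  refine (measureReal_mono hsub).trans ((measureReal_iUnion_fintype_le _).trans ?_)
  rw [boundFalsePositive]
  have : ∀ i : Fin n, (sampleLaw n S).real
      {x | x i ∈ {y | ‖rootInv S y‖ ^ 2 ∈ Set.Ici (K * ((1 - η) * kappa K ε) ^ 2)}} ≤
      Real.exp (-(K / 2) * rate ((1 - η) * kappa K ε)) := by
    intro i
    rw [sampleLaw_real_eval i (measurableSet_norm_rootInv measurableSet_Ici),
      measureReal_norm_rootInv hS _ measurableSet_Ici]
    exact measureReal_norm_sq_ge_le ha
  exact (Finset.sum_le_sum fun i _ => this i).trans_eq (by simp)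

end FalsePositive

/-! ### Escapees -/

section Escapees

variable {K n : ℕ} {S : Mat K}

lemma measurableSet_ellipsoid : MeasurableSet (ellipsoid S n) := by
  refine measurableSet_le ?_ measurable_const
  simp only [dotProduct, Matrix.mulVec]
  fun_prop

/-- The Laurent–Massart bound at level `(log n) / 2`. -/
lemma measureReal_compl_ellipsoid_le (hK : 0 < K) (hn : 0 < n) (hS : S.PosDef) :
    (multivariateGaussian 0 S).real (ellipsoid S n)ᶜ ≤ (Real.sqrt n)⁻¹ := by
  have hlog : 0 ≤ Real.log n := Real.log_natCast_nonneg n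
  have hK0 : (0:ℝ) < K := by exact_mod_cast hK
  have hn0 : (0:ℝ) < n := by exact_mod_cast hn
  set s : ℝ := Real.sqrt (Real.log n / (2 * K)) with hs
  have hs2 : s ^ 2 = Real.log n / (2 * K) := Real.sq_sqrt (by positivity)
  have hs0 : 0 ≤ s := Real.sqrt_nonneg _
  set a : ℝ := Real.sqrt (1 + 2 * s + 2 * s ^ 2) with ha
  have ha2 : a ^ 2 = 1 + 2 * s + 2 * s ^ 2 := Real.sq_sqrt (by positivity)
  have ha1 : 1 ≤ a := Real.one_le_sqrt.mpr (by nlinarith)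
  have hr : rbarSq K n = K * a ^ 2 := by
    have h1 : Real.sqrt (2 * K * Real.log n) = 2 * K * s := by
      rw [← Real.sqrt_sq (by positivity : 0 ≤ 2 * K * s), mul_pow, hs2]
      congr 1; field_simp
    rw [rbarSq, h1, ha2, hs2]; field_simp; ring
  have hsub : (ellipsoid S n)ᶜ ⊆ {x | ‖rootInv S x‖ ^ 2 ∈ Set.Ici (K * a ^ 2)} := by
    intro x hx
    rw [Set.mem_compl_iff, mem_ellipsoid_iff hS, hr, not_le] at hx
    exact hx.le
  refine (measureReal_mono hsub).trans ?_
  rw [measureReal_norm_rootInv hS _ measurableSet_Ici]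
  refine (measureReal_norm_sq_ge_le ha1).trans ?_
  have hrate : 2 * s ^ 2 ≤ rate a := by
    have h2 : Real.log (1 + 2 * s + 2 * s ^ 2) ≤ 2 * s := by
      rw [Real.log_le_iff_le_exp (by positivity)]
      have := Real.quadratic_le_exp_of_nonneg (by positivity : 0 ≤ 2 * s)
      nlinarith
    rw [rate, ha2]; linarith
  have h3 : (Real.sqrt n)⁻¹ = Real.exp (-(1 / 2 * Real.log n)) := by
    rw [Real.exp_neg, mul_comm, Real.exp_mul, Real.exp_log hn0, Real.sqrt_eq_rpow]
  rw [h3, Real.exp_le_exp]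
  have h4 : (K:ℝ) / 2 * (2 * s ^ 2) = 1 / 2 * Real.log n := by rw [hs2]; field_simp
  have h5 := mul_le_mul_of_nonneg_left hrate (by positivity : (0:ℝ) ≤ K / 2)
  linarith

/-- Markov's inequality for the product of a factor `2` for each escapee. The expected number of
escapees is at most `√n`, hence the exponent `(1 - 2 log 2) √n`, and `2 log 2 - 1 > 3/14`. -/
lemma manyEscapees_le (hK : 0 < K) (hn : 0 < n) (hS : S.PosDef) :
    (sampleLaw n S).real (manyEscapees S) ≤ boundManyEscapees n := by
  classical
  have hn0 : (0:ℝ) < n := by exact_mod_cast hn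
  set q := (multivariateGaussian 0 S).real (ellipsoid S n)ᶜ with hq
  set g : Vec K → ℝ := fun y => 1 + (ellipsoid S n)ᶜ.indicator 1 y with hg
  have hgm : Integrable g (multivariateGaussian 0 S) :=
    (integrable_const 1).add ((integrable_const (1:ℝ)).indicator measurableSet_ellipsoid.compl)
  have hgi : ∫ y, g y ∂(multivariateGaussian 0 S) = 1 + q := by
    have hi : Integrable ((ellipsoid S n)ᶜ.indicator (1 : Vec K → ℝ))
        (multivariateGaussian 0 S) :=
      (integrable_const (1:ℝ)).indicator measurableSet_ellipsoid.compl
    rw [hg, integral_add (integrable_const 1) hi,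
      integral_indicator_one measurableSet_ellipsoid.compl]
    simp [hq]
  have hg0 : ∀ y, 0 ≤ g y := fun y => by
    have : (0:ℝ) ≤ (ellipsoid S n)ᶜ.indicator (1 : Vec K → ℝ) y :=
      Set.indicator_nonneg (fun _ _ => zero_le_one) y
    simp only [hg]; linarith
  have hprod : ∀ x : Fin n → Vec K, ∏ i, g (x i) =
      2 ^ ({i | x i ∉ ellipsoid S n} : Set (Fin n)).ncard := by
    intro x
    have : ∀ i, g (x i) = if x i ∉ ellipsoid S n then 2 else 1 := by
      intro i
      by_cases h : x i ∈ ellipsoid S n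
      · simp [hg, h]
      · simp [hg, h]; norm_num
    simp_rw [this]
    rw [Finset.prod_ite, Finset.prod_const, Finset.prod_const_one, mul_one, ← Set.ncard_coe_finset]
    congr 2; ext i; simp
  have hsub : manyEscapees S ⊆ {x : Fin n → Vec K |
      Real.exp (2 * Real.sqrt n * Real.log 2) ≤ ∏ i, g (x i)} := by
    intro x hx
    have hx' : 2 * Real.sqrt n < (({i | x i ∉ ellipsoid S n} : Set (Fin n)).ncard : ℝ) := hx
    simp only [Set.mem_ofPred_eq]
    rw [hprod, ← Real.rpow_natCast, Real.rpow_def_of_pos two_pos, Real.exp_le_exp]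
    have := Real.log_pos (by norm_num : (1:ℝ) < 2)
    nlinarith
  have hm := mul_meas_ge_le_integral_of_nonneg (μ := sampleLaw n S)
    (ae_of_all _ fun x => Finset.prod_nonneg fun i _ => hg0 (x i))
    (Integrable.fintype_prod (f := fun _ => g) fun _ => hgm)
    (Real.exp (2 * Real.sqrt n * Real.log 2))
  rw [integral_fintype_prod_eq_pow, hgi, Fintype.card_fin] at hm
  have h1 := (mul_le_mul_of_nonneg_left (measureReal_mono hsub) (Real.exp_pos _).le).trans hm
  have h2 : (1 + q) ^ n ≤ Real.exp (Real.sqrt n) := by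
    have h3 : q * n ≤ Real.sqrt n := by
      calc q * n ≤ (Real.sqrt n)⁻¹ * n := by
            gcongr; exact measureReal_compl_ellipsoid_le hK hn hS
        _ = Real.sqrt n := by
            rw [inv_mul_eq_div, Real.div_sqrt]
    calc (1 + q) ^ n ≤ Real.exp q ^ n := by
          have : 0 ≤ q := measureReal_nonneg
          gcongr; linarith [Real.add_one_le_exp q]
      _ = Real.exp (q * n) := by rw [mul_comm, Real.exp_nat_mul]
      _ ≤ _ := Real.exp_le_exp.mpr h3
  have h4 := mul_le_mul_of_nonneg_left (h1.trans h2)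
    (Real.exp_pos (-(2 * Real.sqrt n * Real.log 2))).le
  rw [← mul_assoc, ← Real.exp_add, neg_add_cancel, Real.exp_zero, one_mul, ← Real.exp_add] at h4
  refine h4.trans ?_
  rw [boundManyEscapees, Real.exp_le_exp]
  have := Real.log_two_gt_d9
  have := Real.sqrt_nonneg n
  nlinarith

end Escapees

/-! ### Covering the ellipsoid -/

section Covering

variable {K n : ℕ} {S : Mat K} {Δ ε τ η d : ℝ}

/-- Cubes of side `l` have diameter `√K l`, and at most `(1 + Δ / l) ^ K` cells of a grid of mesh
`l` meet the cube. -/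
lemma exists_isCover (hΔ : 0 < Δ) {l r : ℝ} (hl : 0 < l) (hlr : Real.sqrt K * l ≤ r)
    {U : Set (Vec K)} (hU : U ⊆ cube K Δ) :
    ∃ C : Finset (Vec K), IsCover r U C ∧ (C.card : ℝ) ≤ (1 + Δ / l) ^ K := by
  classical
  -- one point of `U` from each cell of a grid of mesh `l`
  set cell : Vec K → Fin K → ℕ := fun x k => ⌊(x k + Δ / 2) / l⌋₊ with hcell
  set m : ℕ := ⌈Δ / l⌉₊ with hm
  set cells : Finset (Fin K → ℕ) :=
    (Fintype.piFinset fun _ => Finset.range m).filter fun c => ∃ x ∈ U, cell x = c with hcells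
  set rep : (Fin K → ℕ) → Vec K := fun c =>
    if h : ∃ x ∈ U, cell x = c then h.choose else 0 with hrep
  have hrepU : ∀ c, (∃ x ∈ U, cell x = c) → rep c ∈ U ∧ cell (rep c) = c := by
    intro c h
    simp only [hrep, dif_pos h]
    exact h.choose_spec
  have hnn : ∀ x ∈ U, ∀ k, 0 ≤ (x k + Δ / 2) / l := fun x hx k =>
    div_nonneg (by linarith [(hU hx k).1]) hl.le
  refine ⟨cells.image rep, ⟨?_, fun x hx => ⟨rep (cell x), ?_, ?_⟩⟩, ?_⟩
  · intro y hy
    obtain ⟨c, hc, rfl⟩ := Finset.mem_image.mp (Finset.mem_coe.mp hy)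
    exact (hrepU c (Finset.mem_filter.mp hc).2).1
  · refine Finset.mem_image_of_mem _ (Finset.mem_filter.mpr ⟨?_, x, hx, rfl⟩)
    rw [Fintype.mem_piFinset]
    intro k
    rw [Finset.mem_range, Nat.floor_lt (hnn x hx k)]
    refine lt_of_lt_of_le ?_ (Nat.le_ceil _)
    gcongr
    linarith [(hU hx k).2]
  · obtain ⟨h1, h2⟩ := hrepU (cell x) ⟨x, hx, rfl⟩
    refine le_trans ?_ hlr
    rw [← Real.sqrt_sq hl.le, ← Real.sqrt_mul (Nat.cast_nonneg K)]
    refine Real.le_sqrt_of_sq_le ?_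
    rw [EuclideanSpace.real_norm_sq_eq]
    calc ∑ k, (x - rep (cell x)) k ^ 2 ≤ ∑ _k : Fin K, l ^ 2 := by
          refine Finset.sum_le_sum fun k _ => ?_
          have e := congrFun h2 k
          have a1 := Nat.floor_le (hnn x hx k)
          have a2 := Nat.lt_floor_add_one ((x k + Δ / 2) / l)
          have b1 := Nat.floor_le (hnn _ h1 k)
          have b2 := Nat.lt_floor_add_one ((rep (cell x) k + Δ / 2) / l)
          have e' : (⌊(rep (cell x) k + Δ / 2) / l⌋₊ : ℝ) = ⌊(x k + Δ / 2) / l⌋₊ := by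
            exact_mod_cast e
          rw [e'] at b1 b2
          rw [le_div_iff₀ hl] at a1 b1
          rw [div_lt_iff₀ hl] at a2 b2
          refine sq_le_sq' ?_ ?_ <;> simp only [PiLp.sub_apply] <;> nlinarith
      _ = K * l ^ 2 := by simp
  · have h1 : (cells.image rep).card ≤ m ^ K :=
      Finset.card_image_le.trans ((Finset.card_filter_le _ _).trans_eq (by simp))
    calc ((cells.image rep).card : ℝ) ≤ (m : ℝ) ^ K := by exact_mod_cast h1
      _ ≤ (1 + Δ / l) ^ K := by
        gcongr
        have := (Nat.ceil_lt_add_one (div_nonneg hΔ.le hl.le)).le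
        linarith

lemma exists_isMinCover {r : ℝ} {U : Set (Vec K)} {C : Finset (Vec K)} (hC : IsCover r U C) :
    ∃ N : Finset (Vec K), IsMinCover r U N := by
  classical
  have h : ∃ m, ∃ C : Finset (Vec K), IsCover r U C ∧ C.card = m := ⟨_, C, hC, rfl⟩
  obtain ⟨N, hN, hc⟩ := Nat.find_spec h
  exact ⟨N, hN, fun C' hC' => hc ▸ Nat.find_min' h ⟨C', hC', rfl⟩⟩

/-! ### Gaussian probability of a small cube -/

/-- The closed cube of half-side `w` around `m`. -/
def box (m : Vec K) (w : ℝ) : Set (Vec K) := {x | ∀ k, |x k - m k| ≤ w}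

lemma box_eq_preimage (m : Vec K) (w : ℝ) :
    box m w = WithLp.ofLp ⁻¹' Set.Icc (fun k => m k - w) (fun k => m k + w) := by
  ext x
  simp only [box, Set.mem_ofPred_eq, Set.mem_preimage, Set.mem_Icc, Pi.le_def, abs_le]
  refine ⟨fun h => ⟨fun k => ?_, fun k => ?_⟩, fun h k => ⟨?_, ?_⟩⟩
  · linarith [(h k).1]
  · linarith [(h k).2]
  · linarith [h.1 k]
  · linarith [h.2 k]

lemma measurableSet_box (m : Vec K) (w : ℝ) : MeasurableSet (box m w) := by
  rw [box_eq_preimage]; exact measurableSet_Icc.preimage (by fun_prop)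

lemma volume_box (m : Vec K) {w : ℝ} (hw : 0 ≤ w) :
    (volume : Measure (Vec K)).real (box m w) = (2 * w) ^ K := by
  rw [box_eq_preimage, measureReal_def,
    (PiLp.volume_preserving_ofLp (Fin K)).measure_preimage measurableSet_Icc.nullMeasurableSet,
    Real.volume_Icc_pi_toReal (fun k => by simp only; linarith)]
  simp only [add_sub_sub_cancel, Finset.prod_const, Finset.card_univ, Fintype.card_fin]
  rw [two_mul]

open scoped MatrixOrder in
lemma det_root (hS : S.PosSemidef) :
    |LinearMap.det (root S : Vec K →ₗ[ℝ] Vec K)| = Real.sqrt S.det := by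
  have h : LinearMap.det (root S : Vec K →ₗ[ℝ] Vec K) = (CFC.sqrt S).det := by
    rw [root, Matrix.coe_toEuclideanCLM_eq_toEuclideanLin]
    exact LinearMap.det_toLpLin _ _
  rw [h, ← det_sqrt_sq hS, Real.sqrt_sq_eq_abs]

/-- On a region where `xᵀ S⁻¹ x ≤ R`, the Gaussian density is bounded below. -/
lemma le_measureReal_box (hS : S.PosDef) (m : Vec K) {w R : ℝ} (hw : 0 ≤ w)
    (h : ∀ x ∈ box m w, ‖rootInv S x‖ ^ 2 ≤ R) :
    (Real.sqrt (2 * Real.pi))⁻¹ ^ K * Real.exp (-R / 2) * ((Real.sqrt S.det)⁻¹ * (2 * w) ^ K) ≤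
      (multivariateGaussian 0 S).real (box m w) := by
  have hdet : LinearMap.det (root S : Vec K →ₗ[ℝ] Vec K) ≠ 0 := by
    rw [← abs_pos, det_root hS.posSemidef]; exact Real.sqrt_pos.mpr hS.det_pos
  have hvol : (volume : Measure (Vec K)).real (root S ⁻¹' box m w) =
      (Real.sqrt S.det)⁻¹ * (2 * w) ^ K := by
    rw [measureReal_def, Measure.addHaar_preimage_continuousLinearMap _ hdet, ENNReal.toReal_mul,
      ENNReal.toReal_ofReal (abs_nonneg _), abs_inv, det_root hS.posSemidef, ← measureReal_def,
      volume_box m hw]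
  have hfin : volume (root S ⁻¹' box m w) ≠ ⊤ := by
    rw [Measure.addHaar_preimage_continuousLinearMap _ hdet, box_eq_preimage,
      (PiLp.volume_preserving_ofLp (Fin K)).measure_preimage measurableSet_Icc.nullMeasurableSet]
    exact ENNReal.mul_ne_top ENNReal.ofReal_ne_top isCompact_Icc.measure_lt_top.ne
  have hms : MeasurableSet (root S ⁻¹' box m w) := (measurableSet_box m w).preimage (by fun_prop)
  rw [multivariateGaussian_real_eq (measurableSet_box m w), ← hvol, stdGaussian_eq_withDensity]
  set c := (Real.sqrt (2 * Real.pi))⁻¹ ^ K * Real.exp (-R / 2) with hc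
  have hc0 : 0 ≤ c := by positivity
  have hle : ENNReal.ofReal c * volume (root S ⁻¹' box m w) ≤
      (volume.withDensity fun z => ENNReal.ofReal (stdDensity K z)) (root S ⁻¹' box m w) := by
    rw [withDensity_apply _ hms, ← setLIntegral_const]
    refine setLIntegral_mono' hms fun z hz => ENNReal.ofReal_le_ofReal ?_
    have := h _ hz
    rw [rootInv_root hS] at this
    rw [hc, stdDensity]
    gcongr
  have := ENNReal.toReal_mono (by rw [← stdGaussian_eq_withDensity]; exact measure_ne_top _ _) hle
  rwa [ENNReal.toReal_mul, ENNReal.toReal_ofReal hc0] at this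

/-! ### Missed balls of the cover -/

lemma norm_le_of_forall_abs_le {y : Vec K} {w : ℝ} (hw : 0 ≤ w) (h : ∀ k, |y k| ≤ w) :
    ‖y‖ ≤ Real.sqrt K * w := by
  rw [← Real.sqrt_sq hw, ← Real.sqrt_mul (Nat.cast_nonneg K)]
  refine Real.le_sqrt_of_sq_le ?_
  rw [EuclideanSpace.real_norm_sq_eq]
  calc ∑ k, y k ^ 2 ≤ ∑ _k : Fin K, w ^ 2 := Finset.sum_le_sum fun k _ => by
        rw [← sq_abs]; exact pow_le_pow_left₀ (abs_nonneg _) (h k) 2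
    _ = K * w ^ 2 := by simp

/-- Shrinking a point of the ellipsoid and the cube slightly towards the origin leaves room for a
small cube that stays in the ellipsoid, in the cube and near the point. -/
lemma box_subset (hK : 0 < K) (hΔ : 0 < Δ) (hS : S.PosDef) (hτ : 0 < τ) (h2 : A2 S τ)
    (hη : 0 < η) (hη1 : η < 1) (hκ : 1 < kappa K ε)
    (hpack : 2 * (Real.sqrt K * kappa K ε) * τ ≤ Δ)
    (hd : d = 2 * η * Real.sqrt K * τ * kappa K ε) {c : Vec K}
    (hc : c ∈ ellipsoid S n ∩ cube K Δ) {δ : ℝ} (hδ : δ = η * kappa K ε / (Δ / τ + 2)) :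
    box ((1 - δ) • c) (δ * τ / 2) ⊆ Metric.ball c (d / 4) ∩ cube K Δ ∩ ellipsoid S n := by
  have hK1 : (1:ℝ) ≤ Real.sqrt K := Real.one_le_sqrt.mpr (by exact_mod_cast hK)
  have hK0 : 0 < Real.sqrt K := by linarith
  have hκ0 : 0 < kappa K ε := by linarith
  have hδ0 : 0 < δ := by rw [hδ]; positivity
  have hδeq : δ * (Δ + 2 * τ) = η * kappa K ε * τ := by rw [hδ]; field_simp
  have h3 : 2 * (kappa K ε * τ) ≤ Δ := by
    have : 1 * (kappa K ε * τ) ≤ Real.sqrt K * (kappa K ε * τ) := by gcongr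
    nlinarith
  have h5 : 1 * τ < kappa K ε * τ := by gcongr
  have hδ1 : δ < 1 := by
    by_contra! h
    have h4 : η * (kappa K ε * τ) ≤ 1 * (kappa K ε * τ) := by gcongr
    nlinarith [mul_pos hκ0 hτ]
  intro x hx
  set y : Vec K := x - (1 - δ) • c with hy
  have hyk : ∀ k, |y k| ≤ δ * τ / 2 := fun k => by
    have := hx k; simpa [hy] using this
  have hyn : ‖y‖ ≤ Real.sqrt K * (δ * τ / 2) := norm_le_of_forall_abs_le (by positivity) hyk
  have hxy : x = (1 - δ) • c + y := by rw [hy]; abel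
  have hcn : ‖c‖ ≤ Real.sqrt K * (Δ / 2) := norm_le_of_forall_abs_le (by positivity) fun k =>
    abs_le.mpr ⟨(hc.2 k).1, (hc.2 k).2.le⟩
  refine ⟨⟨?_, fun k => ?_⟩, ?_⟩
  · rw [Metric.mem_ball, dist_eq_norm, show x - c = y - δ • c by rw [hxy, sub_smul, one_smul]; abel]
    calc ‖y - δ • c‖ ≤ ‖y‖ + δ * ‖c‖ := by
          refine (norm_sub_le _ _).trans_eq ?_
          rw [norm_smul, Real.norm_of_nonneg hδ0.le]
      _ ≤ Real.sqrt K * (δ * τ / 2) + δ * (Real.sqrt K * (Δ / 2)) := by gcongr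
      _ < Real.sqrt K * (δ * (Δ + 2 * τ)) / 2 := by
          have : 0 < Real.sqrt K * δ * τ := by positivity
          nlinarith
      _ = d / 4 := by rw [hδeq, hd]; ring
  · have hk := abs_le.mp (hyk k)
    have hxk : x k = (1 - δ) * c k + y k := by
      have := congrArg (fun z : Vec K => z k) hxy
      simpa using this
    have hck := hc.2 k
    have e1 : δ * τ < δ * Δ := by gcongr; linarith
    have e2 : (1 - δ) * c k ≤ (1 - δ) * (Δ / 2) := by
      have := hck.2.le
      have : 0 ≤ 1 - δ := by linarith
      gcongr
    have e3 : (1 - δ) * (-(Δ / 2)) ≤ (1 - δ) * c k := by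
      have := hck.1
      have : 0 ≤ 1 - δ := by linarith
      gcongr
    rw [hxk]
    constructor <;> nlinarith
  · have hr := (mem_ellipsoid_iff hS).mp hc.1
    rw [mem_ellipsoid_iff hS]
    have hKr : (K : ℝ) ≤ rbarSq K n := by
      unfold rbarSq
      have := Real.log_natCast_nonneg n
      have := Real.sqrt_nonneg (2 * K * Real.log n)
      linarith
    set r := Real.sqrt (rbarSq K n) with hrdef
    have hr0 : 0 ≤ rbarSq K n := le_trans (Nat.cast_nonneg K) hKr
    have hcr : ‖rootInv S c‖ ≤ r := Real.le_sqrt_of_sq_le hr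
    have hKr' : Real.sqrt K ≤ r := Real.sqrt_le_sqrt hKr
    have hyr : ‖rootInv S y‖ ≤ δ * r := by
      have e := norm_rootInv_le h2 hS y
      have : τ * ‖rootInv S y‖ ≤ τ * (δ * r) := by
        have e1 : Real.sqrt K * (δ * τ / 2) ≤ r * (δ * τ / 2) := by gcongr
        have e2 : 0 ≤ r * (δ * τ) := by positivity
        nlinarith
      exact le_of_mul_le_mul_left this hτ
    have hxr : ‖rootInv S x‖ ≤ r := by
      rw [hxy, map_add, map_smul]
      calc _ ≤ (1 - δ) * ‖rootInv S c‖ + ‖rootInv S y‖ := by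
            refine (norm_add_le _ _).trans_eq ?_
            rw [norm_smul, Real.norm_of_nonneg (by linarith)]
        _ ≤ (1 - δ) * r + δ * r := by
            have : 0 ≤ 1 - δ := by linarith
            gcongr
        _ = r := by ring
    calc ‖rootInv S x‖ ^ 2 ≤ r ^ 2 := by gcongr
      _ = rbarSq K n := Real.sq_sqrt hr0

/-- A minimal cover is no larger than the cover from a grid of mesh `d / (4 √K)`. -/
lemma card_le_of_isMinCover (hΔ : 0 < Δ) (hτ : 0 < τ) (hη : 0 < η) (hκ : 0 < kappa K ε)
    (hd : d = 2 * η * Real.sqrt K * τ * kappa K ε) {N : Finset (Vec K)}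
    (hN : IsMinCover (d / 4) (ellipsoid S n ∩ cube K Δ) N) :
    (N.card : ℝ) ≤ (1 + (2 * Δ / τ) / (kappa K ε * η)) ^ K := by
  have hl : 0 < η * τ * kappa K ε / 2 := by positivity
  obtain ⟨C, hC, hcard⟩ := exists_isCover (K := K) hΔ hl (r := d / 4) (by rw [hd]; linarith)
    (U := ellipsoid S n ∩ cube K Δ) Set.inter_subset_right
  have h1 : (N.card : ℝ) ≤ C.card := by exact_mod_cast hN.2 C hC
  refine (h1.trans hcard).trans_eq ?_
  congr 2
  field_simp

/-- The smallest value of the Gaussian density on the ellipsoid is of the order `1 / √n`, up to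
lower order terms, so that about half of the power of `n` remains. -/
lemma natCast_mul_exp_rbarSq (hn : 0 < n) :
    (n : ℝ) * Real.exp (-rbarSq K n / 2) =
      Real.exp (1 / 2 * Real.log n - Real.sqrt (1 / 2 * K * Real.log n) - 1 / 2 * K) := by
  have hn' : (0 : ℝ) < n := by exact_mod_cast hn
  nth_rewrite 1 [← Real.exp_log hn']
  rw [← Real.exp_add]
  have : Real.sqrt (1 / 2 * K * Real.log n) = Real.sqrt (2 * K * Real.log n) / 2 := by
    rw [show (1 / 2 * K * Real.log n : ℝ) = 2 * K * Real.log n / 2 ^ 2 by ring,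
      Real.sqrt_div', Real.sqrt_sq (by norm_num)]
    norm_num
  rw [this, rbarSq]
  ring_nf

lemma box_coefficient (hK : 0 < K) (hΔ : 0 < Δ) (hS : S.PosDef) (hτ : 0 < τ) :
    (Real.sqrt (2 * Real.pi))⁻¹ ^ K *
        ((Real.sqrt S.det)⁻¹ * (η * kappa K ε / (Δ / τ + 2) * τ) ^ K) =
      ((τ / S.det ^ (1 / (2 * K) : ℝ)) * kappa K ε * η /
            (Real.sqrt (Real.pi / 2) * (2 * Δ / τ + 4))) ^ K := by
  have hdet := hS.det_pos
  have h1 : Real.sqrt S.det = (S.det ^ (1 / (2 * K) : ℝ)) ^ K := by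
    rw [← Real.rpow_mul_natCast hdet.le, Real.sqrt_eq_rpow]
    congr 1
    field_simp
  have h2 : Real.sqrt (2 * Real.pi) = 2 * Real.sqrt (Real.pi / 2) := by
    rw [show (2 * Real.pi) = 2 ^ 2 * (Real.pi / 2) by ring, Real.sqrt_mul (by norm_num),
      Real.sqrt_sq (by norm_num)]
  have h3 : (0:ℝ) < S.det ^ (1 / (2 * K) : ℝ) := Real.rpow_pos_of_pos hdet _
  have h4 : 0 < Real.sqrt (Real.pi / 2) := Real.sqrt_pos.mpr (by positivity)
  rw [h1, h2, ← inv_pow, ← mul_pow, ← mul_pow]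
  congr 1
  field_simp
  ring

/-- Near each center of the cover there is a small cube inside the cube and the ellipsoid
(`box_subset`). The probability that all `n` points miss it is at most `exp (-n p)` for its
Gaussian probability `p`. A union bound over the centers gives the claim. -/
lemma missCover_le (hK : 0 < K) (hn : 0 < n) (hΔ : 0 < Δ) (hS : S.PosDef) (hτ : 0 < τ)
    (h2 : A2 S τ) (hη : 0 < η) (hη1 : η < 1) (hκ : 1 < kappa K ε)
    (hpack : 2 * (Real.sqrt K * kappa K ε) * τ ≤ Δ)
    (hd : d = 2 * η * Real.sqrt K * τ * kappa K ε) {N : Finset (Vec K)}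
    (hN : IsMinCover (d / 4) (ellipsoid S n ∩ cube K Δ) N) :
    (sampleLaw n S).real (missCover Δ d N) ≤ boundMissCover S n Δ τ ε η := by
  classical
  have hK1 : (1:ℝ) ≤ Real.sqrt K := Real.one_le_sqrt.mpr (by exact_mod_cast hK)
  have hκ0 : 0 < kappa K ε := by linarith
  set δ := η * kappa K ε / (Δ / τ + 2) with hδ
  have hδ0 : 0 < δ := by rw [hδ]; positivity
  set B := ((τ / S.det ^ (1 / (2 * K) : ℝ)) * kappa K ε * η /
            (Real.sqrt (Real.pi / 2) * (2 * Δ / τ + 4))) ^ K *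
        Real.exp (1 / 2 * Real.log n - Real.sqrt (1 / 2 * K * Real.log n) - 1 / 2 * K) with hB
  have key : ∀ c ∈ N, (sampleLaw n S).real {x | ∀ i, wrap Δ (x i) ∉ Metric.ball c (d / 4)} ≤
      Real.exp (-B) := by
    intro c hc
    set b := box ((1 - δ) • c) (δ * τ / 2) with hb
    have hsub := box_subset (n := n) hK hΔ hS hτ h2 hη hη1 hκ hpack hd (hN.1.1 hc) hδ
    set p := (multivariateGaussian 0 S).real b with hp
    have hpB : B ≤ n * p := by
      have h := le_measureReal_box hS ((1 - δ) • c) (w := δ * τ / 2) (R := rbarSq K n)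
        (by positivity) (fun x hx => (mem_ellipsoid_iff hS).mp (hsub hx).2)
      calc B = n * ((Real.sqrt (2 * Real.pi))⁻¹ ^ K * Real.exp (-rbarSq K n / 2) *
            ((Real.sqrt S.det)⁻¹ * (2 * (δ * τ / 2)) ^ K)) := by
            rw [hB, ← natCast_mul_exp_rbarSq hn, ← box_coefficient hK hΔ hS hτ, ← hδ,
              mul_div_cancel₀ _ (two_ne_zero' ℝ)]
            ring
        _ ≤ n * p := by gcongr
    have hset : {x : Fin n → Vec K | ∀ i, wrap Δ (x i) ∉ Metric.ball c (d / 4)} ⊆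
        Set.univ.pi fun _ => bᶜ := by
      intro x hx i _ hxb
      have := hsub hxb
      exact hx i (by rw [wrap_of_mem hΔ this.1.2]; exact this.1.1)
    calc _ ≤ (sampleLaw n S).real (Set.univ.pi fun _ => bᶜ) := measureReal_mono hset
      _ = (1 - p) ^ n := by
          rw [measureReal_def, Measure.pi_pi, ENNReal.toReal_prod]
          simp only [← measureReal_def]
          rw [probReal_compl_eq_one_sub (measurableSet_box _ _), Finset.prod_const,
            Finset.card_univ, Fintype.card_fin]
      _ ≤ Real.exp (-p) ^ n := by
          have h1 : p ≤ 1 := measureReal_le_one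
          refine pow_le_pow_left₀ (by linarith) ?_ n
          linarith [Real.add_one_le_exp (-p)]
      _ = Real.exp (-(n * p)) := by rw [← Real.exp_nat_mul]; ring_nf
      _ ≤ Real.exp (-B) := by gcongr
  have hx : 0 < (2 * Δ / τ) / (kappa K ε * η) := by positivity
  calc (sampleLaw n S).real (missCover Δ d N)
      ≤ (sampleLaw n S).real (⋃ c ∈ N, {x | ∀ i, wrap Δ (x i) ∉ Metric.ball c (d / 4)}) := by
        refine measureReal_mono (fun x hx => ?_) (measure_ne_top _ _)
        obtain ⟨c, hc, h⟩ := hx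
        exact Set.mem_biUnion hc h
    _ ≤ ∑ c ∈ N, (sampleLaw n S).real {x | ∀ i, wrap Δ (x i) ∉ Metric.ball c (d / 4)} :=
        measureReal_biUnion_finset_le _ _
    _ ≤ ∑ _c ∈ N, Real.exp (-B) := Finset.sum_le_sum key
    _ = N.card * Real.exp (-B) := by simp
    _ ≤ (Real.sqrt K + (2 * Δ / τ) / (kappa K ε * η)) ^ K * Real.exp (-B) := by
        gcongr
        refine (card_le_of_isMinCover hΔ hτ hη hκ0 hd hN).trans ?_
        gcongr
    _ = boundMissCover S n Δ τ ε η := by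
        rw [boundMissCover, Real.exp_add, mul_comm, ← hB, Real.exp_nat_mul,
          Real.exp_log (by linarith)]

/-- With fewer than `K²` samples the bound on the missed cover says nothing. -/
lemma one_le_boundMissCover (hK : 0 < K) (hn : 0 < n) (hΔ : 0 < Δ) (hS : S.PosDef) (hτ : 0 < τ)
    (h2 : A2 S τ) (hη : 0 < η) (hη1 : η < 1) (hκ : 1 < kappa K ε)
    (hpack : 2 * (Real.sqrt K * kappa K ε) * τ ≤ Δ) (hnK : n < K ^ 2) :
    1 ≤ boundMissCover S n Δ τ ε η := by
  have hK1 : (1:ℝ) ≤ Real.sqrt K := Real.one_le_sqrt.mpr (by exact_mod_cast hK)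
  have hKr : (1:ℝ) ≤ K := by exact_mod_cast hK
  have hκ0 : 0 < kappa K ε := by linarith
  have hn' : (0 : ℝ) < n := by exact_mod_cast hn
  have h3 : 2 * (kappa K ε * τ) ≤ Δ := by
    have : 1 * (kappa K ε * τ) ≤ Real.sqrt K * (kappa K ε * τ) := by gcongr
    nlinarith
  have hdet := hS.det_pos
  have hpi : 1 ≤ Real.sqrt (Real.pi / 2) :=
    Real.one_le_sqrt.mpr (by linarith [Real.pi_gt_three])
  have hA : (τ / S.det ^ (1 / (2 * K) : ℝ)) * kappa K ε * η /
            (Real.sqrt (Real.pi / 2) * (2 * Δ / τ + 4)) ≤ 1 := by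
    have h4 : τ ≤ S.det ^ (1 / (2 * K) : ℝ) := by
      have e := Real.rpow_le_rpow (by positivity) (pow_le_det h2) (z := (1 / (2 * K) : ℝ))
        (by positivity)
      refine le_trans (le_of_eq ?_) e
      rw [← pow_mul, ← Real.rpow_natCast, ← Real.rpow_mul hτ.le]
      push_cast
      rw [mul_one_div_cancel (by positivity), Real.rpow_one]
    rw [div_le_one (by positivity)]
    have h5 : τ / S.det ^ (1 / (2 * K) : ℝ) ≤ 1 := div_le_one_of_le₀ h4 (by positivity)
    have h6 : kappa K ε ≤ 2 * Δ / τ := by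
      rw [le_div_iff₀ hτ]; linarith
    calc (τ / S.det ^ (1 / (2 * K) : ℝ)) * kappa K ε * η ≤ 1 * kappa K ε * 1 := by gcongr
      _ ≤ 1 * (2 * Δ / τ + 4) := by linarith
      _ ≤ _ := by gcongr
  have hE : Real.exp (1 / 2 * Real.log n - Real.sqrt (1 / 2 * K * Real.log n) - 1 / 2 * K) ≤ 1 := by
    rw [Real.exp_le_one_iff]
    have h4 : Real.log n ≤ K := by
      have h5 : Real.log n ≤ Real.log ((K : ℝ) ^ 2) :=
        Real.log_le_log hn' (by exact_mod_cast hnK.le)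
      rw [Real.log_pow] at h5
      have h6 := Real.add_one_le_exp (K / 2 - 1 : ℝ)
      have h7 : Real.log (K / 2) ≤ K / 2 - 1 := by
        have := Real.log_le_sub_one_of_pos (x := (K : ℝ) / 2) (by positivity)
        linarith
      rw [Real.log_div (by positivity) (by norm_num)] at h7
      have := Real.log_two_lt_d9
      push_cast at h5
      linarith
    have := Real.sqrt_nonneg (1 / 2 * K * Real.log n)
    linarith
  have hL : 1 ≤ Real.log (Real.sqrt K + (2 * Δ / τ) / (kappa K ε * η)) := by
    rw [Real.le_log_iff_exp_le (by positivity)]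
    have h4 : 4 ≤ (2 * Δ / τ) / (kappa K ε * η) := by
      rw [div_div, le_div_iff₀ (by positivity)]
      have : τ * (kappa K ε * η) ≤ τ * (kappa K ε * 1) := by gcongr
      linarith
    have := Real.exp_one_lt_d9
    linarith
  rw [boundMissCover, Real.one_le_exp_iff]
  have h8 : 0 ≤ (τ / S.det ^ (1 / (2 * K) : ℝ)) * kappa K ε * η /
            (Real.sqrt (Real.pi / 2) * (2 * Δ / τ + 4)) := by positivity
  have h9 := mul_le_one₀ (pow_le_one₀ h8 hA (n := K)) (Real.exp_nonneg _) hE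
  have : 1 * 1 ≤ (K : ℝ) * Real.log (Real.sqrt K + (2 * Δ / τ) / (kappa K ε * η)) := by gcongr
  linarith

end Covering

/-! ### The truncated Gaussian distribution -/

section Truncated

variable {K : ℕ} {S : Mat K} {Δ τ P : ℝ}

/-- The Gaussian distribution conditioned on the cube. -/
abbrev truncLaw (S : Mat K) (Δ : ℝ) : Measure (Vec K) :=
  ProbabilityTheory.cond (multivariateGaussian 0 S) (cube K Δ)

/-- The Gaussian probability of the cube. -/
abbrev cubeProb (S : Mat K) (Δ : ℝ) : ℝ := (multivariateGaussian 0 S).real (cube K Δ)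

lemma one_sub_le_cubeProb (h3 : A3 S Δ P) : 1 - P ≤ cubeProb S Δ := by
  have h := probReal_compl_eq_one_sub (μ := multivariateGaussian 0 S)
    (measurableSet_cube (K := K) (Δ := Δ))
  have h' : (multivariateGaussian 0 S).real (cube K Δ)ᶜ ≤ P := h3
  unfold cubeProb
  linarith

lemma integral_truncLaw (f : Vec K → ℝ) :
    ∫ x, f x ∂(truncLaw S Δ) =
      (cubeProb S Δ)⁻¹ * ∫ x in cube K Δ, f x ∂(multivariateGaussian 0 S) := by
  rw [truncLaw, ProbabilityTheory.cond, integral_smul_measure, ENNReal.toReal_inv, smul_eq_mul]; rfl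

lemma isProbabilityMeasure_truncLaw (h0 : 0 < cubeProb S Δ) :
    IsProbabilityMeasure (truncLaw S Δ) := by
  refine cond_isProbabilityMeasure fun h => ?_
  rw [cubeProb, measureReal_def, h] at h0
  simp at h0

lemma ae_mem_cube : ∀ᵐ x ∂(truncLaw S Δ), x ∈ cube K Δ := ae_cond_mem measurableSet_cube

lemma norm_le_of_mem_cube (hΔ : 0 < Δ) {x : Vec K} (hx : x ∈ cube K Δ) :
    ‖x‖ ≤ Real.sqrt K * (Δ / 2) :=
  norm_le_of_forall_abs_le (by positivity) fun k => abs_le.mpr ⟨(hx k).1, (hx k).2.le⟩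

/-- Continuous functions are bounded on the cube, hence integrable for the truncated law. -/
lemma integrable_truncLaw (hΔ : 0 < Δ) {f : Vec K → ℝ} (hf : Continuous f) :
    Integrable f (truncLaw S Δ) := by
  obtain ⟨b, hb⟩ :=
    (isCompact_closedBall (0 : Vec K) (Real.sqrt K * (Δ / 2))).exists_bound_of_continuousOn
    hf.continuousOn
  have : IsFiniteMeasure (truncLaw S Δ) := by unfold truncLaw; infer_instance
  refine Integrable.of_bound hf.aestronglyMeasurable b ?_
  filter_upwards [ae_mem_cube] with x hx
  exact hb x (by simpa using norm_le_of_mem_cube hΔ hx)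

lemma truncCov_quadratic (hΔ : 0 < Δ) (u v : Vec K) :
    inner ℝ u (Matrix.toEuclideanCLM (𝕜 := ℝ) (truncCov S Δ) v) =
      ∫ x, inner ℝ x u * inner ℝ x v ∂(truncLaw S Δ) := by
  have hint : ∀ i j : Fin K, Integrable (fun x : Vec K => x i * x j) (truncLaw S Δ) := fun i j =>
    integrable_truncLaw hΔ (by fun_prop)
  have h1 : ∀ x : Vec K, inner ℝ x u * inner ℝ x v = ∑ i, ∑ j, (u i * v j) * (x i * x j) := by
    intro x
    simp only [PiLp.inner_apply, RCLike.inner_apply, conj_trivial]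
    rw [Finset.sum_mul_sum]
    refine Finset.sum_congr rfl fun i _ => Finset.sum_congr rfl fun j _ => by ring
  simp only [h1]
  rw [integral_finsetSum _ fun i _ => integrable_finsetSum _ fun j _ => (hint i j).const_mul _]
  rw [Matrix.inner_toEuclideanCLM]
  simp only [dotProduct, Matrix.mulVec, Finset.mul_sum]
  refine Finset.sum_congr rfl fun i _ => ?_
  rw [integral_finsetSum _ fun j _ => (hint i j).const_mul _]
  refine Finset.sum_congr rfl fun j _ => ?_
  rw [integral_const_mul, truncCov, Matrix.of_apply]
  ring

lemma measureReal_inner_le (v : Vec K) (hv : 0 < ‖root S v‖) {c : ℝ} (hc : 0 ≤ c) :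
    (multivariateGaussian 0 S).real {x | |inner ℝ x v| ≤ c} =
      (gaussianReal 0 1).real {y | |y| ≤ c / ‖root S v‖} := by
  have h1 := measureReal_inner_gt (S := S) v c hv hc
  have h2 := probReal_compl_eq_one_sub (μ := multivariateGaussian 0 S)
    (s := {x : Vec K | c < |inner ℝ x v|}) (measurableSet_lt (by fun_prop) (by fun_prop))
  rw [h1, ← measureReal_abs_le (by positivity)] at h2
  rw [← h2]
  congr 1; ext x; simp

lemma integral_inner_sq_multivariateGaussian (v : Vec K) :
    ∫ x, inner ℝ x v ^ 2 ∂(multivariateGaussian 0 S) = ‖root S v‖ ^ 2 := by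
  have h := integral_map (μ := multivariateGaussian 0 S) (φ := fun x => inner ℝ x v)
    (by fun_prop) (f := fun y : ℝ => y ^ 2) (by fun_prop)
  rw [← h, map_inner_multivariateGaussian, integral_map (by fun_prop) (by fun_prop)]
  simp only [mul_pow]
  rw [integral_const_mul, integral_sq_gaussianReal, mul_one]

lemma integral_inner_pow_four_multivariateGaussian (v : Vec K) :
    ∫ x, inner ℝ x v ^ 4 ∂(multivariateGaussian 0 S) = 3 * ‖root S v‖ ^ 4 := by
  have h := integral_map (μ := multivariateGaussian 0 S) (φ := fun x => inner ℝ x v)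
    (by fun_prop) (f := fun y : ℝ => y ^ 4) (by fun_prop)
  rw [← h, map_inner_multivariateGaussian, integral_map (by fun_prop) (by fun_prop)]
  simp only [mul_pow]
  rw [integral_const_mul, integral_pow_four_gaussianReal, mul_comm]

lemma memLp_inner (v : Vec K) (p : NNReal) :
    MemLp (fun x : Vec K => inner ℝ x v) p (multivariateGaussian 0 S) := by
  have := IsGaussian.memLp_dual (multivariateGaussian 0 S) (innerSL ℝ v) p (by simp)
  refine this.congr_norm (by fun_prop) (ae_of_all _ fun x => ?_)
  simp [real_inner_comm]

lemma integrable_inner_sq (v : Vec K) :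
    Integrable (fun x : Vec K => inner ℝ x v ^ 2) (multivariateGaussian 0 S) :=
  (memLp_inner v 2).integrable_sq

/-- The lower bound on the truncated second moment from Cauchy–Schwarz. -/
lemma one_sub_sqrt_mul_le (v : Vec K) :
    (1 - Real.sqrt (3 * (1 - cubeProb S Δ))) * ‖root S v‖ ^ 2 ≤
      ∫ x in cube K Δ, inner ℝ x v ^ 2 ∂(multivariateGaussian 0 S) := by
  set γ := multivariateGaussian (0 : Vec K) S
  set A := (cube K Δ)ᶜ
  have hA : MeasurableSet A := measurableSet_cube.compl
  have h4 : MemLp (fun x : Vec K => inner ℝ x v ^ 2) 2 γ := by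
    rw [memLp_two_iff_integrable_sq (by fun_prop)]
    have := (memLp_inner (S := S) v 4).integrable_norm_pow (by norm_num)
    refine this.congr (ae_of_all _ fun x => ?_)
    simp only [Real.norm_eq_abs, ← pow_mul]
    exact (show Even 4 by decide).pow_abs _
  have h1 : MemLp (A.indicator fun _ : Vec K => (1:ℝ)) 2 γ := memLp_indicator_const _ hA _ (by simp)
  have hcs : ∫ x in A, inner ℝ x v ^ 2 ∂γ ≤
      Real.sqrt (3 * (1 - cubeProb S Δ)) * ‖root S v‖ ^ 2 := by
    have hpq : (2:ℝ).HolderConjugate 2 := by rw [Real.holderConjugate_iff]; norm_num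
    have h := integral_mul_le_Lp_mul_Lq_of_nonneg hpq (μ := γ)
      (f := fun x : Vec K => inner ℝ x v ^ 2) (g := A.indicator fun _ : Vec K => (1:ℝ))
      (ae_of_all _ fun x => by positivity)
      (ae_of_all _ fun x => Set.indicator_nonneg (fun _ _ => zero_le_one) x)
      (by simpa using h4) (by simpa using h1)
    have e1 : ∫ x in A, inner ℝ x v ^ 2 ∂γ =
        ∫ x, inner ℝ x v ^ 2 * A.indicator (fun _ : Vec K => (1:ℝ)) x ∂γ := by
      rw [← integral_indicator hA]
      congr 1; ext x
      by_cases hx : x ∈ A <;> simp [hx]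
    have e2 : ∫ x, (inner ℝ x v ^ 2) ^ (2:ℝ) ∂γ = 3 * ‖root S v‖ ^ 4 := by
      rw [← integral_inner_pow_four_multivariateGaussian]
      congr 1; ext x; norm_cast; ring
    have e3 : ∫ x, (A.indicator (fun _ : Vec K => (1:ℝ)) x) ^ (2:ℝ) ∂γ = 1 - cubeProb S Δ := by
      rw [← probReal_compl_eq_one_sub measurableSet_cube, ← integral_indicator_one hA]
      congr 1; ext x
      by_cases hx : x ∈ A <;> simp [hx]
    rw [e1]
    refine h.trans_eq ?_
    rw [e2, e3, ← Real.sqrt_eq_rpow, ← Real.sqrt_eq_rpow,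
      Real.sqrt_mul (by norm_num) (1 - cubeProb S Δ), Real.sqrt_mul (by norm_num),
      show ‖root S v‖ ^ 4 = (‖root S v‖ ^ 2) ^ 2 by ring, Real.sqrt_sq (by positivity)]
    ring
  have hadd := integral_add_compl (measurableSet_cube (K := K) (Δ := Δ))
    (integrable_inner_sq (S := S) v)
  rw [integral_inner_sq_multivariateGaussian] at hadd
  linarith

/-- The lower bound on the truncated second moment from an ellipsoid inscribed in the cube. -/
lemma chiSqCDF_mul_le (hK : 0 < K) (hΔ : 0 < Δ) (hS : S.PosDef) :
    ∃ t : ℝ, 0 ≤ t ∧ cubeProb S Δ ≤ chiSqCDF 1 (t ^ 2) ∧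
      ∀ v : Vec K, chiSqCDF (K + 2) (t ^ 2) * ‖root S v‖ ^ 2 ≤
        ∫ x in cube K Δ, inner ℝ x v ^ 2 ∂(multivariateGaussian 0 S) := by
  have : Nonempty (Fin K) := ⟨⟨0, hK⟩⟩
  set σ : Fin K → ℝ := fun k => ‖root S (EuclideanSpace.single k 1)‖ with hσ
  have hσ0 : ∀ k, 0 < σ k := fun k => by
    rw [hσ, norm_pos_iff]
    intro h0
    have := rootInv_root hS (EuclideanSpace.single k (1:ℝ))
    rw [h0, map_zero] at this
    have h1 := congrArg (fun z : Vec K => z k) this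
    simp at h1
  obtain ⟨k₀, hk₀⟩ := Finite.exists_max σ
  set t := Δ / 2 / σ k₀ with ht
  have ht0 : 0 < t := div_pos (by positivity) (hσ0 k₀)
  have hin : ∀ (x : Vec K) k, inner ℝ x (EuclideanSpace.single k (1:ℝ)) = x k := fun x k => by
    rw [EuclideanSpace.inner_single_right]; simp
  refine ⟨t, ht0.le, ?_, fun v => ?_⟩
  · rw [chiSqCDF_one, abs_of_pos ht0, ht, ← measureReal_inner_le _ (hσ0 k₀) (by positivity)]
    refine measureReal_mono (fun x hx => ?_) (measure_ne_top _ _)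
    rw [Set.mem_ofPred_eq, hin]
    exact abs_le.mpr ⟨(hx k₀).1, (hx k₀).2.le⟩
  · have hmem : ∀ z : Vec K, ‖z‖ < t → root S z ∈ cube K Δ := by
      intro z hz k
      have : |root S z k| < Δ / 2 := by
        rw [← hin, inner_root_left]
        calc _ ≤ ‖z‖ * σ k := abs_real_inner_le_norm _ _
          _ ≤ ‖z‖ * σ k₀ := by gcongr; exact hk₀ k
          _ < t * σ k₀ := by gcongr; exact hσ0 k₀
          _ = Δ / 2 := div_mul_cancel₀ _ (hσ0 k₀).ne'
      exact ⟨(abs_lt.mp this).1.le, (abs_lt.mp this).2⟩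
    have hchi : chiSqCDF (K + 2) (t ^ 2) =
        ∫ z, (Set.Iio t).indicator (fun _ => (1:ℝ)) ‖z‖ ∂(stdGaussian (Vec (K + 2))) := by
      rw [chiSqCDF_sq_eq_integral _ ht0.le]
      refine integral_congr_ae ?_
      have hac : stdGaussian (Vec (K + 2)) ≪ volume := by
        rw [stdGaussian_eq_withDensity]; exact withDensity_absolutelyContinuous _ _
      have hz : ∀ᵐ z ∂(stdGaussian (Vec (K + 2))), z ∉ Metric.sphere (0 : Vec (K + 2)) t :=
        hac.ae_le (measure_eq_zero_iff_ae_notMem.mp (Measure.addHaar_sphere_of_ne_zero _ _ ht0.ne'))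
      filter_upwards [hz] with z hz
      have hne : ‖z‖ ≠ t := by simpa using hz
      by_cases h : ‖z‖ < t
      · simp [h, h.le]
      · have : ¬ ‖z‖ ≤ t := fun h' => h (lt_of_le_of_ne h' hne)
        simp [h, this]
    have hmeas : MeasurableSet (root S ⁻¹' cube K Δ) :=
      measurableSet_cube.preimage (by fun_prop)
    have h := integral_inner_sq_mul hK ((Set.Iio t).indicator fun _ => (1:ℝ))
      (measurable_const.indicator measurableSet_Iio)
      ⟨1, fun y => by by_cases hy : y ∈ Set.Iio t <;> simp [hy]⟩ (root S v)
    rw [← hchi, mul_comm] at h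
    rw [← h, multivariateGaussian_eq_map, setIntegral_map measurableSet_cube (by fun_prop)
      (by fun_prop), ← integral_indicator hmeas]
    refine integral_mono_of_nonneg (ae_of_all _ fun z => ?_) ?_ (ae_of_all _ fun z => ?_)
    · exact mul_nonneg (sq_nonneg _) (Set.indicator_nonneg (fun _ _ => zero_le_one) _)
    · refine Integrable.indicator ?_ hmeas
      have := integrable_inner_sq (S := S) v
      rw [multivariateGaussian_eq_map] at this
      exact this.comp_measurable (by fun_prop)
    · simp only
      by_cases hz : ‖z‖ < t
      · simp [hz, hmem z hz, inner_root_left]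
      · simp only [Set.indicator, Set.mem_Iio, hz, if_false, mul_zero]
        split_ifs <;> positivity

/-- `α` is positive even where `1 - √(3P)` is negative. -/
lemma alpha_pos {P : ℝ} (h0 : 0 < P) (h1 : P < 1) (K : ℕ) : 0 < alpha P K := by
  refine lt_of_lt_of_le ?_ (le_max_left _ _)
  have ht := Qinv_half_pos h0 h1
  rw [chiSqCDF_sq _ ht.le, measureReal_def]
  refine ENNReal.toReal_pos ?_ (measure_ne_top _ _)
  rw [stdGaussian_eq_withDensity, ne_eq, withDensity_apply_eq_zero
    (by have := (continuous_stdDensity (K + 2)).measurable; fun_prop)]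
  have : {z : Vec (K + 2) | ENNReal.ofReal (stdDensity (K + 2) z) ≠ 0} = Set.univ := by
    ext z; simp [stdDensity_pos]
  rw [this, Set.univ_inter]
  have hb : Metric.ball (0 : Vec (K + 2)) (Qinv (P / 2)) ⊆ {z | ‖z‖ ≤ Qinv (P / 2)} :=
      fun z hz => by
    have : ‖z‖ < Qinv (P / 2) := by simpa using hz
    exact this.le
  exact fun h => (Metric.measure_ball_pos volume (0 : Vec (K + 2)) ht).ne' (measure_mono_null hb h)

/-- The truncated second moments are at least `α / (1 - P)` times the untruncated ones. -/
lemma alpha_mul_norm_root_sq_le (hK : 0 < K) (hΔ : 0 < Δ) (hS : S.PosDef) (h0 : 0 < P) (h1 : P < 1)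
    (h3 : A3 S Δ P) (v : Vec K) :
    alpha P K * ‖root S v‖ ^ 2 ≤ (1 - P) * ∫ x, inner ℝ x v ^ 2 ∂(truncLaw S Δ) := by
  have hp := one_sub_le_cubeProb h3
  set p₀ := cubeProb S Δ with hp₀
  have hp1 : p₀ ≤ 1 := measureReal_le_one
  have hp₀0 : 0 < p₀ := by linarith
  rw [integral_truncLaw, ← hp₀]
  set I := ∫ x in cube K Δ, inner ℝ x v ^ 2 ∂(multivariateGaussian 0 S) with hI
  have hI0 : 0 ≤ I := integral_nonneg fun x => by positivity
  suffices h : alpha P K * p₀ * ‖root S v‖ ^ 2 ≤ (1 - P) * I by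
    rw [← mul_assoc, mul_comm (1 - P), mul_assoc, inv_mul_eq_div, le_div_iff₀ hp₀0]
    linarith
  have hs : 0 ≤ ‖root S v‖ ^ 2 := by positivity
  rw [alpha, max_mul_of_nonneg _ _ hp₀0.le, max_mul_of_nonneg _ _ hs]
  refine max_le ?_ ?_
  · obtain ⟨t, ht, hpt, hv⟩ := chiSqCDF_mul_le hK hΔ hS
    have hF := chiSqCDF_one_Qinv h0 h1
    have hQ := Qinv_half_pos h0 h1
    set q := Qinv (P / 2) with hq
    rcases le_total q t with hqt | hqt
    · have hr := chiSqCDF_ratio_mono (m := K + 2) (by omega) hQ.le hqt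
      rw [hF] at hr
      calc chiSqCDF (K + 2) (q ^ 2) * p₀ * ‖root S v‖ ^ 2
          ≤ chiSqCDF (K + 2) (q ^ 2) * chiSqCDF 1 (t ^ 2) * ‖root S v‖ ^ 2 := by
            have := chiSqCDF_nonneg (K + 2) (q ^ 2)
            gcongr
        _ ≤ chiSqCDF (K + 2) (t ^ 2) * (1 - P) * ‖root S v‖ ^ 2 := by gcongr
        _ = (1 - P) * (chiSqCDF (K + 2) (t ^ 2) * ‖root S v‖ ^ 2) := by ring
        _ ≤ (1 - P) * I := by
            have : 0 ≤ 1 - P := by linarith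
            gcongr
            exact hv v
    · -- here `F₁(t²) ≤ F₁(q²) = 1 - P ≤ p₀ ≤ F₁(t²)`, and the two radii give the same value
      have hr := chiSqCDF_ratio_mono (m := K + 2) (by omega) ht hqt
      have hF' : chiSqCDF 1 (t ^ 2) ≤ 1 - P := by
        rw [← hF, chiSqCDF_one, chiSqCDF_one]
        refine measureReal_mono (fun y hy => ?_) (measure_ne_top _ _)
        simp only [Set.mem_ofPred_eq] at hy ⊢
        rw [abs_of_nonneg hQ.le]; rw [abs_of_nonneg ht] at hy
        linarith
      have e1 : p₀ = 1 - P := le_antisymm (hpt.trans hF') hp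
      have e2 : chiSqCDF 1 (t ^ 2) = 1 - P := le_antisymm hF' (by linarith)
      have hle : t = q := by
        by_contra hne
        have hlt : t < q := lt_of_le_of_ne hqt hne
        have e3 := Q_strictAnti hlt
        rw [chiSqCDF_one, abs_of_nonneg ht, measureReal_abs_le ht] at e2
        rw [chiSqCDF_one, abs_of_nonneg hQ.le, measureReal_abs_le hQ.le] at hF
        linarith
      rw [← hle]
      calc chiSqCDF (K + 2) (t ^ 2) * p₀ * ‖root S v‖ ^ 2
          = (1 - P) * (chiSqCDF (K + 2) (t ^ 2) * ‖root S v‖ ^ 2) := by rw [e1]; ring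
        _ ≤ (1 - P) * I := by
            have : 0 ≤ 1 - P := by linarith
            gcongr
            exact hv v
  · have hcs := one_sub_sqrt_mul_le (S := S) (Δ := Δ) v
    rw [← hp₀, ← hI] at hcs
    rcases le_total (1 - Real.sqrt (3 * P)) 0 with hneg | hpos
    · have : (1 - Real.sqrt (3 * P)) * p₀ * ‖root S v‖ ^ 2 ≤ 0 := by
        rw [mul_assoc]; exact mul_nonpos_of_nonpos_of_nonneg hneg (by positivity)
      have : 0 ≤ (1 - P) * I := mul_nonneg (by linarith) hI0
      linarith
    · have hmono : (1 - Real.sqrt (3 * P)) * p₀ ≤ (1 - P) * (1 - Real.sqrt (3 * (1 - p₀))) := by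
        have ha : Real.sqrt (3 * (1 - p₀)) ^ 2 = 3 * (1 - p₀) := Real.sq_sqrt (by linarith)
        have hb : Real.sqrt (3 * P) ^ 2 = 3 * P := Real.sq_sqrt (by linarith)
        have hab : Real.sqrt (3 * (1 - p₀)) ≤ Real.sqrt (3 * P) := Real.sqrt_le_sqrt (by linarith)
        have ha0 := Real.sqrt_nonneg (3 * (1 - p₀))
        set a := Real.sqrt (3 * (1 - p₀))
        set b := Real.sqrt (3 * P)
        have e1 : p₀ = 1 - a ^ 2 / 3 := by linarith
        have e2 : P = b ^ 2 / 3 := by linarith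
        rw [e1, e2]
        have : 0 ≤ (b - a) * (3 - (a + b) + a * b) := by
          apply mul_nonneg (by linarith)
          nlinarith [mul_nonneg ha0 (ha0.trans hab)]
        nlinarith
      calc (1 - Real.sqrt (3 * P)) * p₀ * ‖root S v‖ ^ 2
          ≤ (1 - P) * (1 - Real.sqrt (3 * (1 - p₀))) * ‖root S v‖ ^ 2 := by gcongr
        _ = (1 - P) * ((1 - Real.sqrt (3 * (1 - p₀))) * ‖root S v‖ ^ 2) := by ring
        _ ≤ (1 - P) * I := by
            have : 0 ≤ 1 - P := by linarith
            gcongr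

lemma gaussianReal_real_abs_le_le {h : ℝ} (h0 : 0 ≤ h) :
    (gaussianReal 0 1).real {y | |y| ≤ h} ≤ h := by
  have hset : {y : ℝ | |y| ≤ h} = Set.Icc (-h) h := by ext y; simp [abs_le]
  rw [hset, measureReal_def, gaussianReal_apply_eq_integral _ one_ne_zero, ENNReal.toReal_ofReal
    (integral_nonneg fun y => gaussianPDFReal_nonneg _ _ _)]
  have hc : (Real.sqrt (2 * Real.pi))⁻¹ ≤ 1 / 2 := by
    rw [inv_le_comm₀ (by positivity) (by norm_num)]
    refine Real.le_sqrt_of_sq_le ?_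
    have := Real.pi_gt_three
    norm_num; linarith
  calc ∫ y in Set.Icc (-h) h, gaussianPDFReal 0 1 y ≤ ∫ _y in Set.Icc (-h) h, (1 / 2 : ℝ) := by
        refine setIntegral_mono (integrable_gaussianPDFReal 0 1).integrableOn (by simp) fun y => ?_
        simp only [gaussianPDFReal, NNReal.coe_one, mul_one, sub_zero]
        have : Real.exp (-y ^ 2 / 2) ≤ 1 := Real.exp_le_one_iff.mpr (by nlinarith [sq_nonneg y])
        calc _ ≤ (Real.sqrt (2 * Real.pi))⁻¹ * 1 := by gcongr
          _ ≤ 1 / 2 := by linarith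
    _ = h := by
        rw [setIntegral_const, measureReal_def, Real.volume_Icc,
          ENNReal.toReal_ofReal (by linarith), smul_eq_mul]
        ring

/-- A lower bound on the truncated second moments in terms of the probability of the cube alone:
a strip of small width carries at most half of the probability of the cube. -/
lemma cubeProb_sq_mul_le (hΔ : 0 < Δ) (h0 : 0 < cubeProb S Δ) (v : Vec K) :
    cubeProb S Δ ^ 2 / 8 * ‖root S v‖ ^ 2 ≤ ∫ x, inner ℝ x v ^ 2 ∂(truncLaw S Δ) := by
  rcases (norm_nonneg (root S v)).eq_or_lt with hv | hv
  · rw [← hv]; simp only [ne_eq, OfNat.ofNat_ne_zero, not_false_eq_true, zero_pow, mul_zero]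
    exact integral_nonneg fun x => by positivity
  have hprob := isProbabilityMeasure_truncLaw h0
  set p₀ := cubeProb S Δ with hp₀
  set c := p₀ / 2 * ‖root S v‖ with hc
  set A : Set (Vec K) := {x | |inner ℝ x v| ≤ c} with hA
  have hAm : MeasurableSet A := measurableSet_le (by fun_prop) (by fun_prop)
  have h1 : (multivariateGaussian 0 S).real A ≤ p₀ / 2 := by
    rw [hA, measureReal_inner_le v hv (by positivity), hc, mul_div_assoc, div_self hv.ne', mul_one]
    exact gaussianReal_real_abs_le_le (by positivity)
  have h2 : (truncLaw S Δ).real A ≤ 1 / 2 := by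
    rw [measureReal_def, cond_apply measurableSet_cube, ENNReal.toReal_mul, ENNReal.toReal_inv,
      ← measureReal_def, ← measureReal_def, inv_mul_eq_div, div_le_iff₀ h0]
    refine (measureReal_mono Set.inter_subset_right).trans ?_
    linarith
  have h3 : 1 / 2 ≤ (truncLaw S Δ).real Aᶜ := by
    rw [probReal_compl_eq_one_sub hAm]; linarith
  calc p₀ ^ 2 / 8 * ‖root S v‖ ^ 2 = c ^ 2 * (1 / 2) := by rw [hc]; ring
    _ ≤ c ^ 2 * (truncLaw S Δ).real Aᶜ := by gcongr
    _ = ∫ x in Aᶜ, c ^ 2 ∂(truncLaw S Δ) := by rw [setIntegral_const, smul_eq_mul, mul_comm]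
    _ ≤ ∫ x in Aᶜ, inner ℝ x v ^ 2 ∂(truncLaw S Δ) := by
        refine setIntegral_mono_on (by simp) (integrable_truncLaw hΔ (by fun_prop)).integrableOn
          hAm.compl fun x hx => ?_
        have : c < |inner ℝ x v| := not_le.mp hx
        rw [← sq_abs (inner ℝ x v)]
        have hc0 : 0 ≤ c := by positivity
        gcongr
    _ ≤ _ := setIntegral_le_integral (integrable_truncLaw hΔ (by fun_prop))
        (ae_of_all _ fun x => by positivity)

lemma truncCov_isHermitian : (truncCov S Δ).IsHermitian := by
  ext i j
  simp [truncCov, mul_comm]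

lemma norm_root_pos (hS : S.PosDef) {v : Vec K} (hv : v ≠ 0) : 0 < ‖root S v‖ := by
  rw [norm_pos_iff]
  intro h0
  have := rootInv_root hS v
  rw [h0, map_zero] at this
  exact hv this.symm

lemma truncCov_posDef (hΔ : 0 < Δ) (hS : S.PosDef) (h0 : 0 < cubeProb S Δ) :
    (truncCov S Δ).PosDef := by
  refine Matrix.PosDef.of_dotProduct_mulVec_pos truncCov_isHermitian fun v hv => ?_
  have h := truncCov_quadratic (S := S) hΔ (WithLp.toLp 2 v) (WithLp.toLp 2 v)
  rw [Matrix.inner_toEuclideanCLM] at h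
  simp only [star_trivial]
  simp only [← sq] at h
  rw [h]
  have hne : (WithLp.toLp 2 v : Vec K) ≠ 0 := by simpa using hv
  have := norm_root_pos hS hne
  exact lt_of_lt_of_le (by positivity) (cubeProb_sq_mul_le hΔ h0 (WithLp.toLp 2 v))

/-! ### Whitening -/

lemma whitening_isSelfAdjoint : IsSelfAdjoint (whitening S Δ) := cfc_predicate _ _

lemma whitening_mul_truncCov_mul_whitening (h : (truncCov S Δ).PosDef) :
    whitening S Δ * truncCov S Δ * whitening S Δ = 1 := by
  have hsa : IsSelfAdjoint (truncCov S Δ) := h.isHermitian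
  have hfin : (spectrum ℝ (truncCov S Δ)).Finite := by
    rw [h.isHermitian.spectrum_real_eq_range_eigenvalues]; exact Set.finite_range _
  have hc : ∀ f : ℝ → ℝ, ContinuousOn f (spectrum ℝ (truncCov S Δ)) := fun f =>
    hfin.continuousOn f
  have h1 : truncCov S Δ = cfc (fun x : ℝ => x) (truncCov S Δ) := (cfc_id' ℝ _ hsa).symm
  conv_lhs => rw [whitening]; arg 1; arg 2; rw [h1]
  rw [← cfc_mul _ _ _ (hc _) (hc _), ← cfc_mul _ _ _ (hc _) (hc _), ← cfc_const_one ℝ _ hsa]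
  refine cfc_congr fun x hx => ?_
  rw [h.isHermitian.spectrum_real_eq_range_eigenvalues] at hx
  obtain ⟨i, rfl⟩ := hx
  have hpos := h.eigenvalues_pos i
  have hs := Real.sqrt_pos.mpr hpos
  nth_rewrite 2 [← Real.sq_sqrt hpos.le]
  field_simp

/-- The whitening matrix as a map of Euclidean space. -/
def whiten (S : Mat K) (Δ : ℝ) : Vec K →L[ℝ] Vec K :=
  Matrix.toEuclideanCLM (𝕜 := ℝ) (whitening S Δ)

lemma inner_whiten_left (x y : Vec K) :
    inner ℝ (whiten S Δ x) y = inner ℝ x (whiten S Δ y) := by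
  have h : IsSelfAdjoint (whiten S Δ) := whitening_isSelfAdjoint.map _
  rw [← ContinuousLinearMap.adjoint_inner_right, h.adjoint_eq]

lemma integral_inner_whiten (hΔ : 0 < Δ) (h : (truncCov S Δ).PosDef) (u v : Vec K) :
    ∫ x, inner ℝ (whiten S Δ x) u * inner ℝ (whiten S Δ x) v ∂(truncLaw S Δ) = inner ℝ u v := by
  simp only [inner_whiten_left]
  rw [← truncCov_quadratic hΔ, inner_whiten_left]
  congr 1
  rw [whiten, ← ContinuousLinearMap.comp_apply, ← ContinuousLinearMap.comp_apply,
    ← ContinuousLinearMap.mul_def, ← ContinuousLinearMap.mul_def, ← map_mul, ← map_mul,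
    whitening_mul_truncCov_mul_whitening h, map_one]
  rfl

lemma integral_inner_sq_whiten (hΔ : 0 < Δ) (h : (truncCov S Δ).PosDef) (u : Vec K) :
    ∫ x, inner ℝ x (whiten S Δ u) ^ 2 ∂(truncLaw S Δ) = ‖u‖ ^ 2 := by
  rw [← real_inner_self_eq_norm_sq, ← integral_inner_whiten hΔ h]
  simp only [inner_whiten_left, sq]

lemma inner_whiten_whiten (x : Vec K) :
    inner ℝ x (whiten S Δ (whiten S Δ x)) = ‖whiten S Δ x‖ ^ 2 := by
  rw [← inner_whiten_left, real_inner_self_eq_norm_sq]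

lemma exists_whiten_eq (h : (truncCov S Δ).PosDef) (v : Vec K) : ∃ u, whiten S Δ u = v := by
  have h1 := whitening_mul_truncCov_mul_whitening h
  rw [mul_assoc] at h1
  refine ⟨Matrix.toEuclideanCLM (𝕜 := ℝ) (truncCov S Δ * whitening S Δ) v, ?_⟩
  rw [whiten, ← ContinuousLinearMap.comp_apply, ← ContinuousLinearMap.mul_def, ← map_mul, h1,
    map_one]
  rfl

/-- The bound `M = K (Δ/τ)² (1 - P) / (4 α)` on the squared norm of the whitened points. -/
def normBound (K : ℕ) (Δ τ P : ℝ) : ℝ := K * (Δ / τ) ^ 2 * (1 - P) / (4 * alpha P K)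

/-- On the cube, the square of a linear functional is at most `M` times its second moment. -/
lemma inner_sq_le_normBound (hK : 0 < K) (hΔ : 0 < Δ) (hS : S.PosDef) (hτ : 0 < τ) (h2 : A2 S τ)
    (h0 : 0 < P) (h1 : P < 1) (h3 : A3 S Δ P) {x : Vec K} (hx : x ∈ cube K Δ) (v : Vec K) :
    inner ℝ x v ^ 2 ≤ normBound K Δ τ P * ∫ y, inner ℝ y v ^ 2 ∂(truncLaw S Δ) := by
  have hα := alpha_pos h0 h1 K
  have e1 := alpha_mul_norm_root_sq_le hK hΔ hS h0 h1 h3 v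
  have e2 := le_norm_root_sq h2 hS v
  have e3 := norm_sq_le_of_mem_cube hx
  set I := ∫ y, inner ℝ y v ^ 2 ∂(truncLaw S Δ)
  have e4 : inner ℝ x v ^ 2 ≤ ‖x‖ ^ 2 * ‖v‖ ^ 2 := by
    rw [← mul_pow, ← sq_abs]
    exact pow_le_pow_left₀ (abs_nonneg _) (abs_real_inner_le_norm _ _) 2
  have e5 : alpha P K * (τ ^ 2 * ‖v‖ ^ 2) ≤ (1 - P) * I := le_trans (by gcongr) e1
  calc inner ℝ x v ^ 2 ≤ K * (Δ / 2) ^ 2 * ‖v‖ ^ 2 := e4.trans (by gcongr)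
    _ = K * (Δ / τ) ^ 2 / (4 * alpha P K) * (alpha P K * (τ ^ 2 * ‖v‖ ^ 2)) := by field_simp; ring
    _ ≤ K * (Δ / τ) ^ 2 / (4 * alpha P K) * ((1 - P) * I) := by gcongr
    _ = _ := by rw [normBound]; ring

/-- If `x` is in the cube and `W` is the whitening matrix, then the bound on linear functionals for
the direction `W (W x)` reads `‖W x‖⁴ ≤ M ‖W x‖²`. -/
lemma norm_whiten_sq_le (hK : 0 < K) (hΔ : 0 < Δ) (hS : S.PosDef) (hτ : 0 < τ) (h2 : A2 S τ)
    (h0 : 0 < P) (h1 : P < 1) (h3 : A3 S Δ P) {x : Vec K} (hx : x ∈ cube K Δ) :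
    ‖whiten S Δ x‖ ^ 2 ≤ normBound K Δ τ P := by
  have hpd := truncCov_posDef hΔ hS (lt_of_lt_of_le (by linarith) (one_sub_le_cubeProb h3))
  have e := inner_sq_le_normBound hK hΔ hS hτ h2 h0 h1 h3 hx (whiten S Δ (whiten S Δ x))
  rw [inner_whiten_whiten, integral_inner_sq_whiten hΔ hpd, sq (‖whiten S Δ x‖ ^ 2)] at e
  rcases (norm_nonneg (whiten S Δ x)).eq_or_lt with hv | hv
  · rw [← hv]
    have := alpha_pos h0 h1 K
    have : 0 < 1 - P := by linarith
    simp only [ne_eq, OfNat.ofNat_ne_zero, not_false_eq_true, zero_pow, normBound]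
    positivity
  · exact le_of_mul_le_mul_right e (by positivity)

/-- The whitened norm is controlled by the norm that whitens the untruncated Gaussian vector. Unlike
`norm_whiten_sq_le`, this holds outside of the cube too. -/
lemma norm_whiten_sq_le_norm_rootInv_sq (hΔ : 0 < Δ) (hS : S.PosDef) (h0 : 0 < cubeProb S Δ)
    (x : Vec K) :
    cubeProb S Δ ^ 2 / 8 * ‖whiten S Δ x‖ ^ 2 ≤ ‖rootInv S x‖ ^ 2 := by
  have hpd := truncCov_posDef hΔ hS h0
  have e := cubeProb_sq_mul_le hΔ h0 (whiten S Δ (whiten S Δ x))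
  rw [integral_inner_sq_whiten hΔ hpd] at e
  have e2 : ‖whiten S Δ x‖ ^ 2 ≤ ‖rootInv S x‖ * ‖root S (whiten S Δ (whiten S Δ x))‖ := by
    rw [← real_inner_self_eq_norm_sq, inner_whiten_left, inner_eq_inner_rootInv_root hS]
    exact real_inner_le_norm _ _
  rcases (norm_nonneg (whiten S Δ x)).eq_or_lt with hv | hv
  · rw [← hv]; simp only [ne_eq, OfNat.ofNat_ne_zero, not_false_eq_true, zero_pow, mul_zero]
    positivity
  · refine le_of_mul_le_mul_right ?_ (show 0 < ‖whiten S Δ x‖ ^ 2 by positivity)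
    calc cubeProb S Δ ^ 2 / 8 * ‖whiten S Δ x‖ ^ 2 * ‖whiten S Δ x‖ ^ 2
        = cubeProb S Δ ^ 2 / 8 * (‖whiten S Δ x‖ ^ 2) ^ 2 := by ring
      _ ≤ cubeProb S Δ ^ 2 / 8 * (‖rootInv S x‖ * ‖root S (whiten S Δ (whiten S Δ x))‖) ^ 2 := by
          gcongr
      _ = ‖rootInv S x‖ ^ 2 *
          (cubeProb S Δ ^ 2 / 8 * ‖root S (whiten S Δ (whiten S Δ x))‖ ^ 2) := by ring
      _ ≤ _ := by gcongr

end Truncated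

/-! ### The component outside the bad events -/

section Deterministic

variable {K n : ℕ} {S : Mat K} {Δ τ P β βbar d : ℝ}

lemma inner_vecMulVec (y v : Vec K) :
    inner ℝ v (Matrix.toEuclideanCLM (𝕜 := ℝ) (Matrix.vecMulVec y y) v) = inner ℝ y v ^ 2 := by
  rw [Matrix.inner_toEuclideanCLM, Matrix.vecMulVec_mulVec]
  simp only [PiLp.inner_apply, RCLike.inner_apply, conj_trivial, dotProduct, Pi.smul_apply,
    MulOpposite.smul_eq_mul_unop, MulOpposite.unop_op]
  rw [sq, Finset.sum_mul]
  refine Finset.sum_congr rfl fun i _ => ?_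
  rw [Finset.mul_sum, Finset.mul_sum, Finset.mul_sum]
  exact Finset.sum_congr rfl fun j _ => by ring

lemma smul_sum_vecMulVec_quadratic {ι : Type*} (s : Finset ι) (c : ℝ) (y : ι → Vec K) (v : Vec K) :
    inner ℝ v (Matrix.toEuclideanCLM (𝕜 := ℝ) (c • ∑ i ∈ s, Matrix.vecMulVec (y i) (y i)) v) =
      c * ∑ i ∈ s, inner ℝ (y i) v ^ 2 := by
  rw [map_smul, map_sum, smul_apply, inner_smul_right,
    sum_apply, inner_sum]
  simp only [inner_vecMulVec]

lemma smul_sum_vecMulVec_isHermitian {ι : Type*} (s : Finset ι) (c : ℝ) (y : ι → Vec K) :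
    (c • ∑ i ∈ s, Matrix.vecMulVec (y i) (y i)).IsHermitian := by
  ext i j
  simp [Matrix.sum_apply, Matrix.vecMulVec, mul_comm]

lemma posSemidef_sub_of_inner_le {A B : Mat K} (hA : A.IsHermitian) (hB : B.IsHermitian)
    (h : ∀ v : Vec K, inner ℝ v (Matrix.toEuclideanCLM (𝕜 := ℝ) A v) ≤
      inner ℝ v (Matrix.toEuclideanCLM (𝕜 := ℝ) B v)) : (B - A).PosSemidef := by
  refine Matrix.PosSemidef.of_dotProduct_mulVec_nonneg (hB.sub hA) fun v => ?_
  have h' := h (WithLp.toLp 2 v)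
  rw [Matrix.inner_toEuclideanCLM, Matrix.inner_toEuclideanCLM] at h'
  rw [Matrix.sub_mulVec, dotProduct_sub]
  simpa using h'

lemma whitenedCov_quadratic (x : Fin n → Vec K) (u : Vec K) :
    inner ℝ u (Matrix.toEuclideanCLM (𝕜 := ℝ) (whitenedCov S Δ x) u) =
      ((unwrapped Δ x).card : ℝ)⁻¹ * ∑ i ∈ unwrapped Δ x, inner ℝ (whiten S Δ (x i)) u ^ 2 :=
  smul_sum_vecMulVec_quadratic (unwrapped Δ x) _ (fun i => whiten S Δ (x i)) u

lemma mem_unwrapped {x : Fin n → Vec K} {i : Fin n} : i ∈ unwrapped Δ x ↔ x i ∈ cube K Δ := by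
  classical
  simp [unwrapped]

open scoped Classical in
/-- The indices of the sample points in the component. -/
def componentSample (v : Fin n → Vec K) (d : ℝ) : Finset (Fin n) :=
  Finset.univ.filter fun i => i.succ ∈ component v d

lemma mem_componentSample {v : Fin n → Vec K} {i : Fin n} :
    i ∈ componentSample v d ↔ i.succ ∈ component v d := by
  classical
  simp [componentSample]

lemma component_eq (v : Fin n → Vec K) (d : ℝ) :
    component v d = Finset.cons 0 ((componentSample v d).map (Fin.succEmb n))
      (by simp [Fin.succ_ne_zero]) := by
  ext i
  refine Fin.cases ?_ (fun j => ?_) i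
  · simp [mem_component]
  · simp [mem_componentSample]

lemma card_component (v : Fin n → Vec K) (d : ℝ) :
    (component v d).card = (componentSample v d).card + 1 := by
  rw [component_eq, Finset.card_cons, Finset.card_map]

lemma componentCov_quadratic (w : Fin n → Vec K) (d : ℝ) (v : Vec K) :
    inner ℝ v (Matrix.toEuclideanCLM (𝕜 := ℝ) (componentCov w d) v) =
      ((componentSample w d).card + 1 : ℝ)⁻¹ * ∑ i ∈ componentSample w d, inner ℝ (w i) v ^ 2 := by
  rw [componentCov, smul_sum_vecMulVec_quadratic, card_component]
  congr 1
  · push_cast; rfl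
  · rw [component_eq, Finset.sum_cons, Finset.sum_map]
    simp [points]

/-- Every sample point of the cube and the ellipsoid is connected to the origin: along the segment
from the origin, which lies in the cube and the ellipsoid, no point is farther than `d/2` from a
wrapped sample point, and a connected set is not the union of two disjoint nonempty open parts. -/
lemma mem_componentSample_of_mem (hΔ : 0 < Δ) (hd : 0 < d) (hS : S.PosDef) {N : Finset (Vec K)}
    (hN : IsCover (d / 4) (ellipsoid S n ∩ cube K Δ) N) {x : Fin n → Vec K}
    (hx : x ∉ missCover Δ d N) {i : Fin n} (hi : x i ∈ ellipsoid S n) (hi' : x i ∈ cube K Δ) :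
    i ∈ componentSample (fun i => wrap Δ (x i)) d := by
  set w : Fin n → Vec K := fun i => wrap Δ (x i) with hw
  have hseg : ∀ t ∈ Set.Icc (0:ℝ) 1, t • x i ∈ ellipsoid S n ∩ cube K Δ := by
    intro t ht
    refine ⟨?_, fun k => ?_⟩
    · rw [mem_ellipsoid_iff hS] at hi ⊢
      rw [map_smul, norm_smul, Real.norm_of_nonneg ht.1]
      refine le_trans (pow_le_pow_left₀ (by have := ht.1; positivity) ?_ 2) hi
      exact mul_le_of_le_one_left (norm_nonneg _) ht.2
    · have h := hi' k
      have e : (t • x i) k = t * x i k := by simp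
      rw [e]
      constructor
      · nlinarith [ht.1, ht.2, h.1, h.2, mul_le_mul_of_nonneg_left h.1 ht.1]
      · rcases le_or_gt (x i k) 0 with hneg | hpos
        · have := mul_nonpos_of_nonneg_of_nonpos ht.1 hneg
          linarith
        · exact (mul_le_of_le_one_left hpos.le ht.2).trans_lt h.2
  have hnear : ∀ t ∈ Set.Icc (0:ℝ) 1, ∃ j, ‖w j - t • x i‖ < d / 2 := by
    intro t ht
    obtain ⟨c, hc, hct⟩ := hN.2 _ (hseg t ht)
    simp only [missCover, Set.mem_ofPred_eq, not_exists, not_and, not_forall, not_not] at hx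
    obtain ⟨j, hj⟩ := hx c hc
    refine ⟨j, ?_⟩
    rw [Metric.mem_ball, dist_eq_norm] at hj
    calc ‖w j - t • x i‖ = ‖(w j - c) - (t • x i - c)‖ := by congr 1; abel
      _ ≤ ‖w j - c‖ + ‖t • x i - c‖ := norm_sub_le _ _
      _ < d / 2 := by linarith
  have hopen : ∀ s : Set (Fin n), IsOpen {t : ℝ | ∃ j ∈ s, ‖w j - t • x i‖ < d / 2} := by
    intro s
    have : {t : ℝ | ∃ j ∈ s, ‖w j - t • x i‖ < d / 2} =
        ⋃ j ∈ s, {t : ℝ | ‖w j - t • x i‖ < d / 2} := by ext t; simp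
    rw [this]
    exact isOpen_biUnion fun j _ => isOpen_lt (by fun_prop) continuous_const
  set T : Set (Fin n) := {j | j ∈ componentSample w d} with hT
  have hclose : ∀ a b : Fin n, ‖w a - w b‖ < d → a ∈ T → b ∈ T := by
    intro a b hab ha
    simp only [hT, Set.mem_ofPred_eq, mem_componentSample, mem_component] at ha ⊢
    by_cases hne : a = b
    · rwa [← hne]
    · exact ha.trans (SimpleGraph.Adj.reachable ⟨fun h => hne (Fin.succ_injective _ h), hab⟩)
  have hzero : ∀ a : Fin n, ‖w a‖ < d → a ∈ T := by
    intro a ha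
    simp only [hT, Set.mem_ofPred_eq, mem_componentSample, mem_component]
    refine SimpleGraph.Adj.reachable ⟨(Fin.succ_ne_zero a).symm, ?_⟩
    simpa [points] using ha
  by_contra hcon
  obtain ⟨t, -, ⟨a, ha, hat⟩, ⟨b, hb, hbt⟩⟩ := isPreconnected_Icc (a := (0:ℝ)) (b := 1) _ _
    (hopen T) (hopen Tᶜ)
    (fun t ht => by
      obtain ⟨j, hj⟩ := hnear t ht
      by_cases hjT : j ∈ T
      · exact Or.inl ⟨j, hjT, hj⟩
      · exact Or.inr ⟨j, hjT, hj⟩)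
    (by
      obtain ⟨j, hj⟩ := hnear 0 (by simp)
      refine ⟨0, by simp, j, hzero j ?_, hj⟩
      rw [zero_smul, sub_zero] at hj
      linarith)
    ⟨1, by simp, i, hcon, by simp [hw, wrap_of_mem hΔ hi', hd]⟩
  refine hb (hclose a b ?_ ha)
  calc ‖w a - w b‖ = ‖(w a - t • x i) - (w b - t • x i)‖ := by congr 1; abel
    _ ≤ ‖w a - t • x i‖ + ‖w b - t • x i‖ := norm_sub_le _ _
    _ < d := by linarith

/-- The procedure terminates: for a large distance all points are connected to the origin. -/
lemma exists_pow_card_component (hd : 0 < d) (hKn : K ≤ n) (v : Fin n → Vec K) :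
    ∃ j : ℕ, K + 1 ≤ (component v ((1.1 : ℝ) ^ j * d)).card := by
  obtain ⟨R, hR⟩ : ∃ R : ℝ, ∀ i, ‖v i‖ < R := by
    obtain ⟨R, hR⟩ := (Set.finite_range fun i => ‖v i‖).bddAbove
    exact ⟨R + 1, fun i => by linarith [hR ⟨i, rfl⟩]⟩
  obtain ⟨j, hj⟩ := pow_unbounded_of_one_lt (R / d) (show (1:ℝ) < 1.1 by norm_num)
  refine ⟨j, ?_⟩
  rw [div_lt_iff₀ hd] at hj
  have : componentSample v ((1.1 : ℝ) ^ j * d) = Finset.univ := by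
    ext i
    simp only [mem_componentSample, mem_component, Finset.mem_univ, iff_true]
    refine SimpleGraph.Adj.reachable ⟨(Fin.succ_ne_zero i).symm, ?_⟩
    have := (hR i).trans hj
    simpa [points] using this
  rw [card_component, this]
  simpa using hKn

/-- The matrix inequalities that define accuracy are inequalities between quadratic forms. The
summand `1` counts the origin, which lies in the component but adds nothing to the sum. -/
lemma mem_accurate_of_quadratic {b : ℝ} {x : Fin n → Vec K} {D : ℝ} (hΔ : 0 < Δ)
    (h : estimateTruncCov (fun i => wrap Δ (x i)) d = some (componentCov (fun i => wrap Δ (x i)) D))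
    (hq : ∀ v : Vec K,
      (1 - b) * (∫ y, inner ℝ y v ^ 2 ∂(truncLaw S Δ)) ≤
        ((componentSample (fun i => wrap Δ (x i)) D).card + 1 : ℝ)⁻¹ *
          ∑ i ∈ componentSample (fun i => wrap Δ (x i)) D, inner ℝ (wrap Δ (x i)) v ^ 2 ∧
      ((componentSample (fun i => wrap Δ (x i)) D).card + 1 : ℝ)⁻¹ *
          ∑ i ∈ componentSample (fun i => wrap Δ (x i)) D, inner ℝ (wrap Δ (x i)) v ^ 2 ≤
        (1 + b) * (∫ y, inner ℝ y v ^ 2 ∂(truncLaw S Δ))) :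
    x ∈ accurate S Δ d b := by
  have hc : (componentCov (fun i => wrap Δ (x i)) D).IsHermitian :=
    smul_sum_vecMulVec_isHermitian _ _ _
  have ht : ∀ c : ℝ, (c • truncCov S Δ).IsHermitian := fun c => by
    ext i j; simp [truncCov, mul_comm]
  have hquad : ∀ (c : ℝ) (v : Vec K),
      inner ℝ v (Matrix.toEuclideanCLM (𝕜 := ℝ) (c • truncCov S Δ) v) =
        c * ∫ y, inner ℝ y v ^ 2 ∂(truncLaw S Δ) := by
    intro c v
    rw [map_smul, smul_apply, inner_smul_right, truncCov_quadratic hΔ]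
    simp only [sq]
  refine ⟨_, h, posSemidef_sub_of_inner_le (ht _) hc fun v => ?_,
    posSemidef_sub_of_inner_le hc (ht _) fun v => ?_⟩
  · rw [hquad, componentCov_quadratic]; exact (hq v).1
  · rw [hquad, componentCov_quadratic]; exact (hq v).2

/-- Dropping a few bounded terms from an average, and counting one more term in the denominator,
changes the average by little. -/
lemma average_perturbation {ι : Type*} {T U : Finset ι} (hTU : T ⊆ U) {a : ι → ℝ} {m e : ℝ}
    (ha : ∀ i ∈ U, 0 ≤ a i ∧ a i ≤ m) (hm : 0 ≤ m) (he : 1 ≤ e) (hU : 0 < U.card)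
    (hcard : (U.card : ℝ) ≤ T.card + e) :
    |(T.card + 1 : ℝ)⁻¹ * ∑ i ∈ T, a i - (U.card : ℝ)⁻¹ * ∑ i ∈ U, a i| ≤ e * m / U.card := by
  classical
  have hU' : (0:ℝ) < U.card := by exact_mod_cast hU
  have hN : (T.card : ℝ) ≤ U.card := by exact_mod_cast Finset.card_le_card hTU
  set A := ∑ i ∈ T, a i with hA
  set B := ∑ i ∈ U \ T, a i with hB
  have hsum : ∑ i ∈ U, a i = B + A := (Finset.sum_sdiff hTU).symm
  have hA0 : 0 ≤ A := Finset.sum_nonneg fun i hi => (ha i (hTU hi)).1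
  have hB0 : 0 ≤ B := Finset.sum_nonneg fun i hi => (ha i (Finset.sdiff_subset hi)).1
  have hAm : A ≤ T.card * m := by
    rw [← nsmul_eq_mul]; exact Finset.sum_le_card_nsmul _ _ _ fun i hi => (ha i (hTU hi)).2
  have hBm : B ≤ (U.card - T.card) * m := by
    have := Finset.sum_le_card_nsmul (U \ T) a m fun i hi => (ha i (Finset.sdiff_subset hi)).2
    rw [nsmul_eq_mul, Finset.card_sdiff_of_subset hTU,
      Nat.cast_sub (Finset.card_le_card hTU)] at this
    exact this
  set t := (T.card : ℝ) with ht
  have ht0 : 0 ≤ t := Nat.cast_nonneg _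
  set u := (U.card : ℝ) with hu
  have e1 : (t + 1)⁻¹ * A - u⁻¹ * ∑ i ∈ U, a i = (A * (u - t - 1) / (t + 1) - B) / u := by
    rw [hsum]; field_simp; ring
  rw [e1, abs_div, abs_of_pos hU']
  have e2 : A / (t + 1) ≤ m := by
    rw [div_le_iff₀ (by positivity)]; nlinarith
  have e3 : 0 ≤ A / (t + 1) := by positivity
  have e4 : A * (u - t - 1) / (t + 1) = A / (t + 1) * (u - t) - A / (t + 1) := by ring
  have e5 : A / (t + 1) * (u - t) ≤ m * (u - t) := by gcongr
  have e6 : 0 ≤ A / (t + 1) * (u - t) := mul_nonneg e3 (by linarith)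
  have e7 : (u - t) * m ≤ e * m := by gcongr; linarith
  have e8 : 1 * m ≤ e * m := by gcongr
  gcongr
  rw [e4, abs_le]
  -- `T` misses no term or at least one term of `U`
  rcases Finset.eq_empty_or_nonempty (U \ T) with h0 | h0
  · have : B = 0 := by rw [hB, h0, Finset.sum_empty]
    constructor <;> linarith
  · have h1 : 1 ≤ u - t := by
      have := Finset.card_pos.mpr h0
      rw [Finset.card_sdiff_of_subset hTU] at this
      have h2 : T.card + 1 ≤ U.card := by omega
      have h3 : (T.card : ℝ) + 1 ≤ U.card := by exact_mod_cast h2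
      linarith
    have e9 : A / (t + 1) * 1 ≤ A / (t + 1) * (u - t) := by gcongr
    constructor <;> linarith

/-- Outside the four bad events the estimate is accurate. -/
lemma mem_accurate (hK : 0 < K) (hn : K ^ 2 ≤ n) (hΔ : 0 < Δ) (hd : 0 < d) (hS : S.PosDef)
    (hτ : 0 < τ) (h2 : A2 S τ) (h0 : 0 < P) (h1 : P < 1) (h3 : A3 S Δ P) (hβ : 0 < β)
    (hM : 1 ≤ normBound K Δ τ P)
    (hb : βbar = β + 2 * K * (Δ / τ) ^ 2 / (alpha P K * Real.sqrt n)) {N : Finset (Vec K)}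
    (hN : IsCover (d / 4) (ellipsoid S n ∩ cube K Δ) N) {x : Fin n → Vec K}
    (hfp : x ∉ falsePositive Δ d) (hse : x ∉ sampleEst S Δ P β) (hme : x ∉ manyEscapees S)
    (hmc : x ∉ missCover Δ d N) : x ∈ accurate S Δ d βbar := by
  classical
  have hp : 0 < 1 - P := by linarith
  have hα := alpha_pos h0 h1 K
  have hKn : K ≤ n := le_trans (Nat.le_self_pow two_ne_zero K) hn
  have hn0 : (0:ℝ) < n := by exact_mod_cast lt_of_lt_of_le hK hKn
  have hs : 0 < Real.sqrt n := Real.sqrt_pos.mpr hn0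
  have hss : Real.sqrt n * Real.sqrt n = n := Real.mul_self_sqrt hn0.le
  have hsK : (K:ℝ) ≤ Real.sqrt n := Real.le_sqrt_of_sq_le (by exact_mod_cast hn)
  have hK1 : (1:ℝ) ≤ K := by exact_mod_cast hK
  set M := normBound K Δ τ P with hMdef
  have hb' : βbar = β + 8 * M / ((1 - P) * Real.sqrt n) := by
    rw [hb, hMdef, normBound]; field_simp; ring
  set w : Fin n → Vec K := fun i => wrap Δ (x i) with hw
  have hq0 : ∀ v : Vec K, 0 ≤ ∫ y, inner ℝ y v ^ 2 ∂(truncLaw S Δ) := fun v =>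
    integral_nonneg fun y => by positivity
  have hMq : ∀ (y v : Vec K), y ∈ cube K Δ →
      inner ℝ y v ^ 2 ≤ M * ∫ y, inner ℝ y v ^ 2 ∂(truncLaw S Δ) := fun y v hy =>
    inner_sq_le_normBound hK hΔ hS hτ h2 h0 h1 h3 hy v
  have hex := exists_pow_card_component hd hKn w
  have hest : estimateTruncCov w d = some (componentCov w ((1.1 : ℝ) ^ (Nat.find hex) * d)) := by
    rw [estimateTruncCov, dif_pos hex]
  rcases le_or_gt ((1 - P) * Real.sqrt n) 8 with hsmall | hlarge
  · -- the allowed error is at least `M`, and then any estimate from points of the cube will do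
    refine mem_accurate_of_quadratic hΔ hest fun v => ?_
    set T := componentSample w ((1.1 : ℝ) ^ (Nat.find hex) * d)
    have hbM : M ≤ βbar := by
      rw [hb']
      have : M ≤ 8 * M / ((1 - P) * Real.sqrt n) := by
        rw [le_div_iff₀ (by positivity)]; nlinarith
      linarith
    have hT0 : 0 ≤ ∑ i ∈ T, inner ℝ (w i) v ^ 2 := Finset.sum_nonneg fun i _ => by positivity
    constructor
    · have : (1 - βbar) * ∫ y, inner ℝ y v ^ 2 ∂(truncLaw S Δ) ≤ 0 :=
        mul_nonpos_of_nonpos_of_nonneg (by linarith) (hq0 v)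
      exact this.trans (by positivity)
    · have hle : ∑ i ∈ T, inner ℝ (w i) v ^ 2 ≤
          T.card * (M * ∫ y, inner ℝ y v ^ 2 ∂(truncLaw S Δ)) := by
        rw [← nsmul_eq_mul]
        exact Finset.sum_le_card_nsmul _ _ _ fun i _ => hMq _ v (wrap_mem_cube hΔ _)
      rw [inv_mul_le_iff₀ (by positivity)]
      refine hle.trans ?_
      have hq := hq0 v
      have hMq0 : 0 ≤ M * ∫ y, inner ℝ y v ^ 2 ∂(truncLaw S Δ) := by positivity
      have : M * ∫ y, inner ℝ y v ^ 2 ∂(truncLaw S Δ) ≤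
          (1 + βbar) * ∫ y, inner ℝ y v ^ 2 ∂(truncLaw S Δ) := by gcongr; linarith
      calc (T.card : ℝ) * (M * ∫ y, inner ℝ y v ^ 2 ∂(truncLaw S Δ))
          ≤ (T.card + 1) * (M * ∫ y, inner ℝ y v ^ 2 ∂(truncLaw S Δ)) := by gcongr; linarith
        _ ≤ _ := by gcongr
  · -- now at least `4 √n` points lie in the cube, and all of them but `2 √n` are in the component,
    -- which has more than `K` points already for the initial distance
    set U := unwrapped Δ x with hU
    set T := componentSample w d with hT
    have hTU : T ⊆ U := by
      intro i hi
      rw [hU, mem_unwrapped]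
      by_contra hcon
      exact hfp ⟨i, hcon, mem_componentSample.mp hi⟩
    have hwx : ∀ i ∈ U, w i = x i := fun i hi => wrap_of_mem hΔ (mem_unwrapped.mp hi)
    simp only [sampleEst, Set.mem_ofPred_eq, not_or, not_lt] at hse
    obtain ⟨hUcard, hop⟩ := hse
    have hUT : (U.card : ℝ) ≤ T.card + 2 * Real.sqrt n := by
      have hE : (({i | x i ∉ ellipsoid S n} : Set (Fin n)).ncard : ℝ) ≤ 2 * Real.sqrt n := by
        simpa [manyEscapees] using hme
      have hsub : U ⊆ T ∪ ({i | x i ∉ ellipsoid S n} : Set (Fin n)).toFinset := by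
        intro i hi
        by_cases hie : x i ∈ ellipsoid S n
        · exact Finset.mem_union_left _
            (mem_componentSample_of_mem hΔ hd hS hN hmc hie (mem_unwrapped.mp hi))
        · exact Finset.mem_union_right _ (by simpa using hie)
      have h5 := (Finset.card_le_card hsub).trans (Finset.card_union_le _ _)
      rw [← Set.ncard_eq_toFinset_card'] at h5
      have h6 : (U.card : ℝ) ≤ T.card + (({i | x i ∉ ellipsoid S n} : Set (Fin n)).ncard : ℝ) := by
        exact_mod_cast h5
      linarith
    have hUs : 4 * Real.sqrt n ≤ U.card := by
      have : 8 * Real.sqrt n ≤ (1 - P) * n := by nlinarith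
      linarith
    have hU0 : (0:ℝ) < U.card := by linarith
    have hTK : K + 1 ≤ (component w d).card := by
      rw [card_component]
      have : (K:ℝ) ≤ T.card := by linarith
      have : K ≤ T.card := by exact_mod_cast this
      exact Nat.succ_le_succ this
    have hfind : Nat.find hex = 0 := (Nat.find_eq_zero hex).mpr (by simpa using hTK)
    rw [hfind, pow_zero, one_mul] at hest
    refine mem_accurate_of_quadratic hΔ hest fun v => ?_
    obtain ⟨u, rfl⟩ := exists_whiten_eq (truncCov_posDef hΔ hS (lt_of_lt_of_le hp
      (one_sub_le_cubeProb h3))) v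
    set v := whiten S Δ u with hv
    set q := ∫ y, inner ℝ y v ^ 2 ∂(truncLaw S Δ) with hq
    have hqu : q = ‖u‖ ^ 2 := integral_inner_sq_whiten hΔ (truncCov_posDef hΔ hS
      (lt_of_lt_of_le hp (one_sub_le_cubeProb h3))) u
    have hq0' := hq0 v
    have havg : |(U.card : ℝ)⁻¹ * ∑ i ∈ U, inner ℝ (x i) v ^ 2 - q| ≤ β * q := by
      have h5 := whitenedCov_quadratic (S := S) (Δ := Δ) x u
      simp only [inner_whiten_left] at h5
      rw [← hU, ← hv] at h5
      rw [← h5, hqu, ← real_inner_self_eq_norm_sq]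
      set E := Matrix.toEuclideanCLM (n := Fin K) (𝕜 := ℝ) (whitenedCov S Δ x - 1) with hE
      have h6 : inner ℝ u (Matrix.toEuclideanCLM (𝕜 := ℝ) (whitenedCov S Δ x) u) - inner ℝ u u =
          inner ℝ u (E u) := by
        rw [hE, map_sub, map_one, sub_apply, inner_sub_right]; rfl
      rw [h6]
      calc |inner ℝ u (E u)| ≤ ‖u‖ * ‖E u‖ := abs_real_inner_le_norm _ _
        _ ≤ ‖u‖ * (‖E‖ * ‖u‖) := by gcongr; exact E.le_opNorm u
        _ ≤ ‖u‖ * (β * ‖u‖) := by gcongr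
        _ = β * inner ℝ u u := by rw [real_inner_self_eq_norm_sq]; ring
    have hpert := average_perturbation hTU (a := fun i => inner ℝ (x i) v ^ 2) (m := M * q)
      (fun i hi => ⟨by positivity, hMq _ v (mem_unwrapped.mp hi)⟩) (by positivity)
      (by linarith) (by exact_mod_cast hU0) hUT
    have hTsum : ∑ i ∈ T, inner ℝ (w i) v ^ 2 = ∑ i ∈ T, inner ℝ (x i) v ^ 2 :=
      Finset.sum_congr rfl fun i hi => by rw [hwx i (hTU hi)]
    have hpert' : 2 * Real.sqrt n * (M * q) / U.card ≤ 8 * M / ((1 - P) * Real.sqrt n) * q := by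
      rw [div_le_iff₀ hU0]
      calc 2 * Real.sqrt n * (M * q)
          ≤ 8 * M / ((1 - P) * Real.sqrt n) * q * ((1 - P) * n / 2) := by
            have h7 : 8 * M / ((1 - P) * Real.sqrt n) * q *
                ((1 - P) * (Real.sqrt n * Real.sqrt n) / 2) = 4 * Real.sqrt n * (M * q) := by
              field_simp; ring
            rw [hss] at h7
            rw [h7]
            have : 0 ≤ Real.sqrt n * (M * q) := by positivity
            linarith
        _ ≤ _ := by gcongr
    change (1 - βbar) * q ≤ ((T.card : ℝ) + 1)⁻¹ * ∑ i ∈ T, inner ℝ (w i) v ^ 2 ∧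
      ((T.card : ℝ) + 1)⁻¹ * ∑ i ∈ T, inner ℝ (w i) v ^ 2 ≤ (1 + βbar) * q
    rw [hTsum, hb']
    rw [abs_le] at havg hpert
    constructor <;> linarith [havg.1, havg.2, hpert.1, hpert.2]

end Deterministic

/-! ### Exponential bounds for sums over the sample points in the cube -/

section Chernoff

variable {K n : ℕ} {S : Mat K} {Δ P : ℝ}

lemma integrableOn_cube (hΔ : 0 < Δ) {f : Vec K → ℝ} (hf : Continuous f) :
    IntegrableOn f (cube K Δ) (multivariateGaussian 0 S) := by
  obtain ⟨b, hb⟩ :=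
    (isCompact_closedBall (0 : Vec K) (Real.sqrt K * (Δ / 2))).exists_bound_of_continuousOn
    hf.continuousOn
  refine Integrable.of_bound hf.aestronglyMeasurable b ?_
  filter_upwards [ae_restrict_mem measurableSet_cube] with x hx
  exact hb x (by simpa using norm_le_of_mem_cube hΔ hx)

/-- Markov's inequality for the exponential of a sum over the sample points in the cube. Points
outside the cube contribute the factor `1`, so that the expectation of the product factorizes. -/
lemma measureReal_le_of_sum_nonneg (hΔ : 0 < Δ) (h0 : 0 < cubeProb S Δ) {g : Vec K → ℝ}
    (hg : Continuous g) {a : ℝ} {E : Set (Fin n → Vec K)}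
    (hE : ∀ x ∈ E, 0 ≤ a + ∑ i ∈ unwrapped Δ x, g (x i)) :
    (sampleLaw n S).real E ≤ Real.exp a *
      (1 - cubeProb S Δ + cubeProb S Δ * ∫ y, Real.exp (g y) ∂(truncLaw S Δ)) ^ n := by
  classical
  set f : Vec K → ℝ := fun y => (cube K Δ).indicator (fun y => Real.exp (g y)) y +
    (cube K Δ)ᶜ.indicator (fun _ => 1) y with hf
  have hi1 : Integrable ((cube K Δ).indicator fun y => Real.exp (g y))
      (multivariateGaussian 0 S) :=
    (integrable_indicator_iff measurableSet_cube).mpr (integrableOn_cube hΔ (by fun_prop))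
  have hi2 : Integrable ((cube K Δ)ᶜ.indicator fun _ => (1:ℝ)) (multivariateGaussian 0 S) :=
    (integrable_const _).indicator measurableSet_cube.compl
  have hfm : Integrable f (multivariateGaussian 0 S) := hi1.add hi2
  have hfi : ∫ y, f y ∂(multivariateGaussian 0 S) =
      1 - cubeProb S Δ + cubeProb S Δ * ∫ y, Real.exp (g y) ∂(truncLaw S Δ) := by
    rw [hf, integral_add hi1 hi2, integral_indicator measurableSet_cube,
      integral_indicator measurableSet_cube.compl, setIntegral_const, smul_eq_mul, mul_one,
      probReal_compl_eq_one_sub measurableSet_cube, integral_truncLaw, ← mul_assoc,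
      mul_inv_cancel₀ h0.ne']
    ring
  have hf0 : ∀ y, 0 ≤ f y := fun y => add_nonneg
    (Set.indicator_nonneg (fun _ _ => (Real.exp_pos _).le) y)
    (Set.indicator_nonneg (fun _ _ => zero_le_one) y)
  have hprod : ∀ x : Fin n → Vec K, ∏ i, f (x i) = Real.exp (∑ i ∈ unwrapped Δ x, g (x i)) := by
    intro x
    rw [Real.exp_sum, unwrapped, Finset.prod_filter]
    refine Finset.prod_congr rfl fun i _ => ?_
    by_cases h : x i ∈ cube K Δ <;> simp [hf, h]
  have hsub : E ⊆ {x : Fin n → Vec K | Real.exp (-a) ≤ ∏ i, f (x i)} := by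
    intro x hx
    have := hE x hx
    simp only [Set.mem_ofPred_eq]
    rw [hprod, Real.exp_le_exp]
    linarith
  have hm := mul_meas_ge_le_integral_of_nonneg (μ := sampleLaw n S)
    (ae_of_all _ fun x => Finset.prod_nonneg fun i _ => hf0 (x i))
    (Integrable.fintype_prod (f := fun _ => f) fun _ => hfm) (Real.exp (-a))
  rw [integral_fintype_prod_eq_pow, hfi, Fintype.card_fin] at hm
  have h1 := (mul_le_mul_of_nonneg_left (measureReal_mono hsub) (Real.exp_pos _).le).trans hm
  have h2 := mul_le_mul_of_nonneg_left h1 (Real.exp_pos a).le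
  rwa [← mul_assoc, ← Real.exp_add, add_neg_cancel, Real.exp_zero, one_mul] at h2

/-- A Chernoff bound for a sum over the sample points in the cube, on the event that there are at
least `k` such points. -/
lemma measureReal_sum_nonneg_le (hΔ : 0 < Δ) (h0 : 0 < cubeProb S Δ) {g : Vec K → ℝ}
    (hg : Continuous g) {θ k : ℝ} (hθ : 0 ≤ θ)
    (hgθ : ∫ y, Real.exp (g y) ∂(truncLaw S Δ) ≤ Real.exp (-θ)) :
    (sampleLaw n S).real {x | k ≤ (unwrapped Δ x).card ∧ 0 ≤ ∑ i ∈ unwrapped Δ x, g (x i)} ≤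
      Real.exp (-(θ * k)) := by
  -- tilting by `e^θ` per point normalizes each factor to at most `1`
  refine (measureReal_le_of_sum_nonneg hΔ h0 (g := fun y => g y + θ) (by fun_prop)
    (a := -(θ * k)) fun x hx => ?_).trans ?_
  · rw [Finset.sum_add_distrib, Finset.sum_const, nsmul_eq_mul]
    nlinarith [hx.1, hx.2]
  · have h1 : ∫ y, Real.exp (g y + θ) ∂(truncLaw S Δ) ≤ 1 := by
      simp only [Real.exp_add]
      rw [integral_mul_const]
      calc _ ≤ Real.exp (-θ) * Real.exp θ := by gcongr
        _ = 1 := by rw [← Real.exp_add]; simp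
    have h2 : 0 ≤ ∫ y, Real.exp (g y + θ) ∂(truncLaw S Δ) :=
      integral_nonneg fun y => (Real.exp_pos _).le
    have h3 : cubeProb S Δ ≤ 1 := measureReal_le_one
    have h4 : (1 - cubeProb S Δ + cubeProb S Δ * ∫ y, Real.exp (g y + θ) ∂(truncLaw S Δ)) ^ n ≤
        1 := by
      refine pow_le_one₀ ?_ ?_
      · have := mul_nonneg h0.le h2; linarith
      · nlinarith
    exact mul_le_of_le_one_right (Real.exp_pos _).le h4

/-- Hoeffding's lemma for the indicator of the cube. -/
lemma one_sub_add_mul_exp_le (t : ℝ) :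
    1 - cubeProb S Δ + cubeProb S Δ * Real.exp (-t) ≤
      Real.exp (-(cubeProb S Δ * t) + t ^ 2 / 8) := by
  set p₀ := cubeProb S Δ with hp
  set X : Vec K → ℝ := (cube K Δ).indicator fun _ => 1 with hX
  have hXm : AEMeasurable X (multivariateGaussian 0 S) :=
    (measurable_const.indicator measurableSet_cube).aemeasurable
  have hXi : ∫ y, X y ∂(multivariateGaussian 0 S) = p₀ :=
    integral_indicator_one measurableSet_cube
  have h := (hasSubgaussianMGF_of_mem_Icc (a := 0) (b := 1) hXm
    (ae_of_all _ fun y => ⟨Set.indicator_nonneg (fun _ _ => zero_le_one) y,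
      Set.indicator_le_self' (fun _ _ => zero_le_one) y |>.trans (by simp)⟩)).mgf_le (-t)
  rw [hXi, mgf] at h
  have e1 : ∀ y, Real.exp (-t * (X y - p₀)) = Real.exp (t * p₀) *
      (1 + X y * (Real.exp (-t) - 1)) := by
    intro y
    rw [show -t * (X y - p₀) = t * p₀ + -t * X y by ring, Real.exp_add]
    by_cases hy : y ∈ cube K Δ <;> simp [hX, hy]
  simp only [e1] at h
  have hXint : Integrable X (multivariateGaussian 0 S) :=
    (integrable_const _).indicator measurableSet_cube
  rw [integral_const_mul, integral_add (integrable_const _) (hXint.mul_const _),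
    integral_mul_const, hXi] at h
  have h5 := mul_le_mul_of_nonneg_left h (Real.exp_pos (-(p₀ * t))).le
  rw [← mul_assoc, ← Real.exp_add, ← Real.exp_add] at h5
  refine le_trans (le_of_eq ?_) (h5.trans (le_of_eq ?_))
  · rw [show -(p₀ * t) + t * p₀ = 0 by ring, Real.exp_zero]
    simp; ring
  · congr 1
    simp
    ring

lemma cubeProb_le_one : cubeProb S Δ ≤ 1 := measureReal_le_one

/-- Hoeffding's inequality for the number of sample points in the cube. -/
lemma measureReal_card_unwrapped_lt (hΔ : 0 < Δ) (h1 : P < 1) (h3 : A3 S Δ P) :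
    (sampleLaw n S).real {x | ((unwrapped Δ x).card : ℝ) < (1 - P) * n / 2} ≤
      Real.exp (-(1 / 2) * (1 - P) ^ 2 * n) := by
  have hp := one_sub_le_cubeProb h3
  set p₀ := cubeProb S Δ with hp0
  have h0 : 0 < p₀ := by linarith
  have hprob := isProbabilityMeasure_truncLaw h0
  have hp1 : p₀ ≤ 1 := cubeProb_le_one
  have hn : (0:ℝ) ≤ n := Nat.cast_nonneg n
  refine (measureReal_le_of_sum_nonneg hΔ h0 (g := fun _ => -(2 * p₀)) (by fun_prop)
    (a := 2 * p₀ * (p₀ * n / 2)) fun x hx => ?_).trans ?_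
  · have hx' : ((unwrapped Δ x).card : ℝ) < (1 - P) * n / 2 := hx
    rw [Finset.sum_const, nsmul_eq_mul]
    have : (1 - P) * n / 2 ≤ p₀ * n / 2 := by gcongr
    nlinarith
  · simp only [integral_const, probReal_univ, one_smul]
    rw [← hp0]
    have e := one_sub_add_mul_exp_le (S := S) (Δ := Δ) (2 * p₀)
    rw [← hp0] at e
    have h4 : 0 ≤ 1 - p₀ + p₀ * Real.exp (-(2 * p₀)) := by
      have := mul_nonneg h0.le (Real.exp_pos (-(2 * p₀))).le; linarith
    calc _ ≤ Real.exp (2 * p₀ * (p₀ * n / 2)) *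
          (Real.exp (-(p₀ * (2 * p₀)) + (2 * p₀) ^ 2 / 8)) ^ n := by gcongr
      _ = Real.exp (-(1 / 2) * p₀ ^ 2 * n) := by
          rw [← Real.exp_nat_mul, ← Real.exp_add]; congr 1; ring
      _ ≤ _ := by
          refine Real.exp_le_exp.mpr ?_
          have : (1 - P) ^ 2 * n ≤ p₀ ^ 2 * n := by
            have : 0 ≤ 1 - P := by linarith
            gcongr
          linarith

/-- If the probability of the cube is small, then a moderate tilt bounds simultaneously the
probability of few points in the cube and that of a large sum over these points. -/
lemma measureReal_card_lt_or_sum_nonneg_le (hΔ : 0 < Δ) (h1 : P < 1) (h3 : A3 S Δ P)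
    (hsmall : 1 - P ≤ 1 / 16) {g : Vec K → ℝ} (hg : Continuous g)
    (hlow : ∀ y, -(2 * (1 - P)) ≤ g y)
    (hgθ : ∫ y, Real.exp (g y) ∂(truncLaw S Δ) ≤ Real.exp (-(9 / 10 * (2 * (1 - P))))) :
    (sampleLaw n S).real {x | ((unwrapped Δ x).card : ℝ) < (1 - P) * n / 2 ∨
      0 ≤ ∑ i ∈ unwrapped Δ x, g (x i)} ≤ Real.exp (-(1 / 2) * (1 - P) ^ 2 * n) := by
  have hp := one_sub_le_cubeProb h3
  set p₀ := cubeProb S Δ with hp0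
  have hp1 : p₀ ≤ 1 := cubeProb_le_one
  set p := 1 - P with hpdef
  have hp' : 0 < p := by linarith
  have h0 : 0 < p₀ := by linarith
  have hn : (0:ℝ) ≤ n := Nat.cast_nonneg n
  refine (measureReal_le_of_sum_nonneg hΔ h0 hg (a := 2 * p * (p₀ * n / 2)) fun x hx => ?_).trans ?_
  · rcases hx with hx | hx
    · have h4 : ∑ i ∈ unwrapped Δ x, -(2 * p) ≤ ∑ i ∈ unwrapped Δ x, g (x i) :=
        Finset.sum_le_sum fun i _ => hlow _
      rw [Finset.sum_const, nsmul_eq_mul] at h4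
      have : p * n / 2 ≤ p₀ * n / 2 := by gcongr
      nlinarith
    · positivity
  · rw [← hp0]
    have h5 : Real.exp (-(9 / 10 * (2 * p))) ≤ 1 - 3 / 2 * p := by
      have e1 : (1:ℝ) - -(9 / 10 * (2 * p)) ≤ Real.exp (9 / 10 * (2 * p)) := by
        have := Real.add_one_le_exp (9 / 10 * (2 * p)); linarith
      rw [Real.exp_neg]
      rw [inv_le_comm₀ (Real.exp_pos _) (by linarith)]
      refine le_trans ?_ e1
      rw [inv_le_iff_one_le_mul₀ (by linarith)]
      nlinarith
    have h6 : 0 ≤ ∫ y, Real.exp (g y) ∂(truncLaw S Δ) :=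
      integral_nonneg fun y => (Real.exp_pos _).le
    have h7 : 1 - p₀ + p₀ * ∫ y, Real.exp (g y) ∂(truncLaw S Δ) ≤
        Real.exp (-(3 / 2 * (p₀ * p))) := by
      have e1 := Real.add_one_le_exp (-(3 / 2 * (p₀ * p)))
      have e2 : p₀ * ∫ y, Real.exp (g y) ∂(truncLaw S Δ) ≤ p₀ * (1 - 3 / 2 * p) := by
        gcongr; exact hgθ.trans h5
      linarith
    have h8 : 0 ≤ 1 - p₀ + p₀ * ∫ y, Real.exp (g y) ∂(truncLaw S Δ) := by
      have := mul_nonneg h0.le h6; linarith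
    calc _ ≤ Real.exp (2 * p * (p₀ * n / 2)) * Real.exp (-(3 / 2 * (p₀ * p))) ^ n := by gcongr
      _ = Real.exp (-(1 / 2) * (p₀ * p) * n) := by
          rw [← Real.exp_nat_mul, ← Real.exp_add]; congr 1; ring
      _ ≤ _ := by
          refine Real.exp_le_exp.mpr ?_
          have : p * p * n ≤ p₀ * p * n := by gcongr
          linarith

end Chernoff

/-! ### Moment generating functions of variables with exponential moments -/

section Scalar

lemma exp_le_quadratic (z : ℝ) : Real.exp z ≤ 1 + z + z ^ 2 * Real.exp |z| := by
  -- `z² e^{|z|}` dominates the remainder of the exponential series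
  have h := Real.abs_exp_sub_one_sub_id_le (x := z)
  rcases le_or_gt |z| 1 with h1 | h1
  · have h2 := (abs_le.mp (h h1)).2
    have : z ^ 2 * 1 ≤ z ^ 2 * Real.exp |z| := by
      gcongr; exact Real.one_le_exp (abs_nonneg z)
    linarith
  · rcases le_or_gt 0 z with h0 | h0
    · rw [abs_of_nonneg h0] at h1 ⊢
      nlinarith [Real.exp_pos z, mul_self_le_mul_self zero_le_one h1.le]
    · rw [abs_of_neg h0] at h1 ⊢
      have e1 := Real.add_one_le_exp (-z)
      have e2 : Real.exp z ≤ 1 := Real.exp_le_one_iff.mpr h0.le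
      nlinarith

/-- The pointwise inequality behind the bound on the moment generating function; `r = p₀^{-1/2}`
and `L = 2¹⁰ r⁵`, so that `θ L = 32 r` for the exponent `θ = p₀² / 32`. -/
lemma sq_mul_exp_le {r v s : ℝ} (hr : 1 ≤ r) (hv : 0 ≤ v) (hs : 0 ≤ s)
    (hsL : s * (2 ^ 10 * r ^ 5) ≤ 1) :
    v ^ 2 * Real.exp (s * v) ≤ 3 * (2 ^ 10 * r ^ 5) * v +
      2 ^ 10 * r ^ 5 * (r⁻¹ ^ 2 * Real.exp (r⁻¹ ^ 4 / 32 * v)) := by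
  have hr0 : 0 < r := by linarith
  set L := 2 ^ 10 * r ^ 5 with hL
  have hL0 : 0 < L := by positivity
  rcases le_or_gt v L with h | h
  · have h1 : s * v ≤ 1 := le_trans (by gcongr) hsL
    have h2 : Real.exp (s * v) ≤ 3 := (Real.exp_le_exp.mpr h1).trans
      (by linarith [Real.exp_one_lt_d9])
    have h3 : v ^ 2 * Real.exp (s * v) ≤ 3 * L * v := by
      calc v ^ 2 * Real.exp (s * v) ≤ v ^ 2 * 3 := by gcongr
        _ = 3 * v * v := by ring
        _ ≤ 3 * L * v := by gcongr
    have : 0 ≤ L * (r⁻¹ ^ 2 * Real.exp (r⁻¹ ^ 4 / 32 * v)) := by positivity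
    linarith
  · -- with `t = r v / L ≥ 1` the claim is `2¹⁰ t⁹ e^t ≤ e^{32 t}`
    set z := v / L with hz
    have hvz : v = L * z := by rw [hz]; field_simp
    have hz1 : 1 ≤ z := by rw [hz, le_div_iff₀ hL0]; linarith
    set t := r * z with ht
    have ht1 : 1 ≤ t := by rw [ht]; nlinarith
    have hrt : r ≤ t := by rw [ht]; nlinarith
    have hzt : z ≤ t := by rw [ht]; nlinarith
    have e1 : Real.exp (s * v) ≤ Real.exp t := by
      refine Real.exp_le_exp.mpr ?_
      rw [hvz]
      calc s * (L * z) = s * L * z := by ring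
        _ ≤ 1 * z := by gcongr
        _ ≤ t := by linarith
    have e2 : r⁻¹ ^ 4 / 32 * v = 32 * t := by
      rw [hvz, ht, hL]; field_simp; norm_num
    have e3 : t ^ 9 ≤ Real.exp (9 * t) := by
      rw [show (9:ℝ) * t = (9:ℕ) * t by norm_num, Real.exp_nat_mul]
      gcongr
      linarith [Real.add_one_le_exp t]
    have e4 : (2:ℝ) ^ 10 ≤ Real.exp (10 * t) := by
      rw [show (10:ℝ) * t = (10:ℕ) * t by norm_num, Real.exp_nat_mul]
      gcongr
      linarith [Real.add_one_le_exp t]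
    have e5 : 2 ^ 10 * r ^ 7 * z ^ 2 * Real.exp t ≤ Real.exp (32 * t) := by
      calc 2 ^ 10 * r ^ 7 * z ^ 2 * Real.exp t ≤ 2 ^ 10 * t ^ 7 * t ^ 2 * Real.exp t := by gcongr
        _ = 2 ^ 10 * t ^ 9 * Real.exp t := by ring
        _ ≤ Real.exp (10 * t) * Real.exp (9 * t) * Real.exp t := by gcongr
        _ = Real.exp (20 * t) := by rw [← Real.exp_add, ← Real.exp_add]; ring_nf
        _ ≤ _ := Real.exp_le_exp.mpr (by linarith)
    have h6 : v ^ 2 * Real.exp (s * v) ≤ L * (r⁻¹ ^ 2 * Real.exp (r⁻¹ ^ 4 / 32 * v)) := by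
      rw [e2]
      calc v ^ 2 * Real.exp (s * v) ≤ v ^ 2 * Real.exp t := by gcongr
        _ = L * (r⁻¹ ^ 2 * (2 ^ 10 * r ^ 7 * z ^ 2 * Real.exp t)) := by
            rw [hvz, hL]; field_simp
        _ ≤ _ := by gcongr
    have : 0 ≤ 3 * L * v := by positivity
    linarith

/-- A centered variable that is dominated by a variable `V` of mean at most `1` with an
exponential moment has a moment generating function of sub-Gaussian type near the origin. -/
lemma integral_exp_mul_le {Ω : Type*} [MeasurableSpace Ω] {ν : Measure Ω} [IsProbabilityMeasure ν]
    {W V : Ω → ℝ} {r s : ℝ} (hr : 1 ≤ r) (hsL : |s| * (2 ^ 10 * r ^ 5) ≤ 1)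
    (hV : ∀ ω, 0 ≤ V ω) (hWV : ∀ ω, |W ω| ≤ V ω + 1)
    (hW : ∫ ω, W ω ∂ν = 0) (hV1 : ∫ ω, V ω ∂ν ≤ 1)
    (hVθ : ∫ ω, Real.exp (r⁻¹ ^ 4 / 32 * V ω) ∂ν ≤ 2 * r ^ 2)
    (iW : Integrable W ν) (iV : Integrable V ν)
    (iθ : Integrable (fun ω => Real.exp (r⁻¹ ^ 4 / 32 * V ω)) ν)
    (iW' : Integrable (fun ω => Real.exp (s * W ω)) ν) :
    ∫ ω, Real.exp (s * W ω) ∂ν ≤ Real.exp (2 ^ 16 * r ^ 5 * s ^ 2) := by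
  set L := 2 ^ 10 * r ^ 5 with hL
  have hr0 : 0 < r := by linarith
  have hL1 : 2 ^ 10 ≤ L := by
    rw [hL]; exact le_mul_of_one_le_right (by norm_num) (one_le_pow₀ hr)
  have hs0 := abs_nonneg s
  have hs1 : |s| ≤ 1 / 2 ^ 10 := by
    rw [le_div_iff₀ (by norm_num)]
    exact le_trans (by gcongr) hsL
  have hpt : ∀ ω, Real.exp (s * W ω) ≤ 1 + s * W ω + s ^ 2 * (3 * (2 * (3 * L * V ω +
      L * (r⁻¹ ^ 2 * Real.exp (r⁻¹ ^ 4 / 32 * V ω))) + 2 * (3 + (3 * L * V ω +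
      L * (r⁻¹ ^ 2 * Real.exp (r⁻¹ ^ 4 / 32 * V ω)))))) := by
    intro ω
    have hv := hV ω
    set v := V ω with hv'
    have e0 := exp_le_quadratic (s * W ω)
    have e1 : |s * W ω| ≤ |s| * (v + 1) := by rw [abs_mul]; gcongr; exact hWV ω
    have e2 : (s * W ω) ^ 2 ≤ s ^ 2 * (v + 1) ^ 2 := by
      rw [mul_pow, ← sq_abs (W ω)]
      gcongr
      exact hWV ω
    have e3 : Real.exp |s * W ω| ≤ 3 * Real.exp (|s| * v) := by
      calc Real.exp |s * W ω| ≤ Real.exp (|s| + |s| * v) := Real.exp_le_exp.mpr (by linarith)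
        _ = Real.exp |s| * Real.exp (|s| * v) := Real.exp_add _ _
        _ ≤ 3 * Real.exp (|s| * v) := by
            gcongr
            have : Real.exp |s| ≤ Real.exp 1 := Real.exp_le_exp.mpr (by linarith)
            linarith [Real.exp_one_lt_d9]
    set G := 3 * L * v + L * (r⁻¹ ^ 2 * Real.exp (r⁻¹ ^ 4 / 32 * v)) with hG
    have e4 : v ^ 2 * Real.exp (|s| * v) ≤ G := sq_mul_exp_le hr hv hs0 hsL
    have e5 : Real.exp (|s| * v) ≤ 3 + G := by
      rcases le_or_gt v 1 with h | h
      · have h1 : |s| * v ≤ 1 := by nlinarith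
        have h2 : Real.exp (|s| * v) ≤ 3 := (Real.exp_le_exp.mpr h1).trans
          (by linarith [Real.exp_one_lt_d9])
        have h3 : 0 ≤ G := by positivity
        linarith
      · have h1 : 1 * Real.exp (|s| * v) ≤ v ^ 2 * Real.exp (|s| * v) := by
          gcongr; nlinarith
        linarith
    have e6 : (v + 1) ^ 2 * Real.exp (|s| * v) ≤ 2 * G + 2 * (3 + G) := by
      have : (v + 1) ^ 2 ≤ 2 * v ^ 2 + 2 := by nlinarith [sq_nonneg (v - 1)]
      calc (v + 1) ^ 2 * Real.exp (|s| * v) ≤ (2 * v ^ 2 + 2) * Real.exp (|s| * v) := by gcongr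
        _ = 2 * (v ^ 2 * Real.exp (|s| * v)) + 2 * Real.exp (|s| * v) := by ring
        _ ≤ _ := by gcongr
    have e7 : (s * W ω) ^ 2 * Real.exp |s * W ω| ≤ s ^ 2 * (3 * (2 * G + 2 * (3 + G))) := by
      calc (s * W ω) ^ 2 * Real.exp |s * W ω|
          ≤ s ^ 2 * (v + 1) ^ 2 * (3 * Real.exp (|s| * v)) := by gcongr
        _ = s ^ 2 * (3 * ((v + 1) ^ 2 * Real.exp (|s| * v))) := by ring
        _ ≤ _ := by gcongr
    linarith
  have iG : Integrable (fun ω => 3 * L * V ω +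
      L * (r⁻¹ ^ 2 * Real.exp (r⁻¹ ^ 4 / 32 * V ω))) ν :=
    (iV.const_mul _).add ((iθ.const_mul _).const_mul _)
  have hGi : ∫ ω, (3 * L * V ω + L * (r⁻¹ ^ 2 * Real.exp (r⁻¹ ^ 4 / 32 * V ω))) ∂ν ≤ 5 * L := by
    rw [integral_add (iV.const_mul _) ((iθ.const_mul _).const_mul _), integral_const_mul,
      integral_const_mul, integral_const_mul]
    have h1 : r⁻¹ ^ 2 * ∫ ω, Real.exp (r⁻¹ ^ 4 / 32 * V ω) ∂ν ≤ 2 := by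
      calc _ ≤ r⁻¹ ^ 2 * (2 * r ^ 2) := by gcongr
        _ = 2 := by field_simp
    have h2 : 3 * L * ∫ ω, V ω ∂ν ≤ 3 * L * 1 := by gcongr
    have h3 : L * (r⁻¹ ^ 2 * ∫ ω, Real.exp (r⁻¹ ^ 4 / 32 * V ω) ∂ν) ≤ L * 2 := by gcongr
    linarith
  set G : Ω → ℝ := fun ω => 3 * L * V ω + L * (r⁻¹ ^ 2 * Real.exp (r⁻¹ ^ 4 / 32 * V ω)) with hG
  have iG' : Integrable (fun ω => 3 + G ω) ν := (integrable_const 3).add iG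
  have iR : Integrable (fun ω => s ^ 2 * (3 * (2 * G ω + 2 * (3 + G ω)))) ν :=
    (((iG.const_mul 2).add (iG'.const_mul 2)).const_mul 3).const_mul _
  have iA : Integrable (fun ω => 1 + s * W ω) ν := (integrable_const 1).add (iW.const_mul s)
  calc ∫ ω, Real.exp (s * W ω) ∂ν
      ≤ ∫ ω, ((1 + s * W ω) + s ^ 2 * (3 * (2 * G ω + 2 * (3 + G ω)))) ∂ν :=
        integral_mono iW' (iA.add iR) hpt
    _ = 1 + s ^ 2 * (3 * (2 * (∫ ω, G ω ∂ν) + 2 * (3 + ∫ ω, G ω ∂ν))) := by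
        rw [integral_add iA iR, integral_add (integrable_const 1) (iW.const_mul s),
          integral_const_mul, hW, integral_const_mul, integral_const_mul,
          integral_add (iG.const_mul 2) (iG'.const_mul 2),
          integral_const_mul, integral_const_mul, integral_add (integrable_const 3) iG]
        simp
    _ ≤ 1 + s ^ 2 * (3 * (2 * (5 * L) + 2 * (3 + 5 * L))) := by gcongr
    _ ≤ 1 + 2 ^ 16 * r ^ 5 * s ^ 2 := by
        have e1 : 2 ^ 16 * r ^ 5 * s ^ 2 = s ^ 2 * (64 * L) := by rw [hL]; ring
        have e2 : 3 * (2 * (5 * L) + 2 * (3 + 5 * L)) ≤ 64 * L := by linarith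
        have := mul_le_mul_of_nonneg_left e2 (sq_nonneg s)
        linarith
    _ ≤ _ := by linarith [Real.add_one_le_exp (2 ^ 16 * r ^ 5 * s ^ 2)]

end Scalar

/-! ### Moments of the whitened points -/

section WhitenedMoments

variable {K n : ℕ} {S : Mat K} {Δ : ℝ}

lemma integral_truncLaw_le (hΔ : 0 < Δ) (h0 : 0 < cubeProb S Δ) {f g : Vec K → ℝ}
    (hf : Continuous f)
    (hg : Integrable g (multivariateGaussian 0 S)) (hg0 : ∀ x, 0 ≤ g x) (hfg : ∀ x, f x ≤ g x) :
    ∫ x, f x ∂(truncLaw S Δ) ≤ (cubeProb S Δ)⁻¹ * ∫ x, g x ∂(multivariateGaussian 0 S) := by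
  rw [integral_truncLaw]
  gcongr
  exact (setIntegral_mono (integrableOn_cube hΔ hf) hg.integrableOn hfg).trans
    (setIntegral_le_integral hg (ae_of_all _ hg0))

/-- The coordinates of the whitened points. -/
def whitenCoord (S : Mat K) (Δ : ℝ) (k : Fin K) (x : Vec K) : ℝ :=
  inner ℝ (whiten S Δ x) (EuclideanSpace.single k 1)

lemma whitenCoord_eq (k : Fin K) (x : Vec K) : whitenCoord S Δ k x = whiten S Δ x k := by
  rw [whitenCoord, EuclideanSpace.inner_single_right]; simp

lemma continuous_whitenCoord (k : Fin K) : Continuous (whitenCoord S Δ k) := by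
  unfold whitenCoord; fun_prop

lemma sum_whitenCoord_sq (x : Vec K) : ∑ k, whitenCoord S Δ k x ^ 2 = ‖whiten S Δ x‖ ^ 2 := by
  simp only [whitenCoord_eq, EuclideanSpace.real_norm_sq_eq]

lemma integral_whitenCoord_mul (hΔ : 0 < Δ) (h : (truncCov S Δ).PosDef) (i j : Fin K) :
    ∫ x, whitenCoord S Δ i x * whitenCoord S Δ j x ∂(truncLaw S Δ) = (1 : Mat K) i j := by
  simp only [whitenCoord]
  rw [integral_inner_whiten hΔ h, EuclideanSpace.inner_single_right, Matrix.one_apply]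
  simp [eq_comm]

lemma norm_root_whiten_sq_le (hΔ : 0 < Δ) (h : (truncCov S Δ).PosDef) (h0 : 0 < cubeProb S Δ)
    (u : Vec K) : cubeProb S Δ ^ 2 / 8 * ‖root S (whiten S Δ u)‖ ^ 2 ≤ ‖u‖ ^ 2 := by
  rw [← integral_inner_sq_whiten hΔ h u]
  exact cubeProb_sq_mul_le hΔ h0 _

/-- A whitened coordinate is a linear functional whose variance under the untruncated Gaussian law
is at most `8 / p₀²`, where `p₀` is the probability of the cube. The factor `p₀⁻¹` comes from
the conditioning. -/
lemma integral_exp_whitenCoord_sq_le (hΔ : 0 < Δ) (h : (truncCov S Δ).PosDef)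
    (h0 : 0 < cubeProb S Δ) (k : Fin K) :
    ∫ x, Real.exp (cubeProb S Δ ^ 2 / 32 * whitenCoord S Δ k x ^ 2) ∂(truncLaw S Δ) ≤
      2 * (cubeProb S Δ)⁻¹ := by
  set p₀ := cubeProb S Δ
  set v := whiten S Δ (EuclideanSpace.single k 1) with hv
  set σ := ‖root S v‖ with hσ
  have hσ1 : p₀ ^ 2 / 32 * σ ^ 2 ≤ 1 / 4 := by
    have := norm_root_whiten_sq_le hΔ h h0 (EuclideanSpace.single k (1:ℝ))
    rw [← hv, ← hσ] at this
    simp at this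
    linarith
  set l := p₀ ^ 2 / 32 * σ ^ 2 with hl
  have hcoord : ∀ x, whitenCoord S Δ k x = inner ℝ x v := fun x => by
    rw [whitenCoord, inner_whiten_left]
  simp only [hcoord]
  have hmap := map_inner_multivariateGaussian (S := S) v
  have hexp : ∀ y : ℝ, Real.exp (p₀ ^ 2 / 32 * (σ * y) ^ 2) = Real.exp (l * y ^ 2) := fun y => by
    rw [hl]; ring_nf
  have hint : Integrable (fun x : Vec K => Real.exp (p₀ ^ 2 / 32 * inner ℝ x v ^ 2))
      (multivariateGaussian 0 S) := by
    have : Integrable (fun y : ℝ => Real.exp (p₀ ^ 2 / 32 * y ^ 2))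
        ((multivariateGaussian 0 S).map fun x => inner ℝ x v) := by
      rw [hmap, integrable_map_measure (by fun_prop) (by fun_prop)]
      refine (integrable_exp_mul_sq_gaussianReal (l := l) (by linarith)).congr
        (ae_of_all _ fun y => ?_)
      exact (hexp y).symm
    exact this.comp_measurable (by fun_prop)
  have hval : ∫ x : Vec K, Real.exp (p₀ ^ 2 / 32 * inner ℝ x v ^ 2) ∂(multivariateGaussian 0 S) ≤
      2 := by
    have e := integral_map (μ := multivariateGaussian 0 S) (φ := fun x => inner ℝ x v)
      (by fun_prop) (f := fun y : ℝ => Real.exp (p₀ ^ 2 / 32 * y ^ 2)) (by fun_prop)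
    rw [← e, hmap, integral_map (by fun_prop) (by fun_prop)]
    simp only [← hσ, hexp]
    rw [integral_exp_mul_sq_gaussianReal (by linarith)]
    rw [inv_le_comm₀ (Real.sqrt_pos.mpr (by linarith)) (by norm_num)]
    exact Real.le_sqrt_of_sq_le (by norm_num; linarith)
  refine (integral_truncLaw_le hΔ h0 (by fun_prop) hint (fun x => (Real.exp_pos _).le)
    fun x => le_rfl).trans ?_
  rw [mul_comm (2:ℝ)]
  gcongr

/-- Convex combinations of the squared coordinates. -/
def whitenMix (S : Mat K) (Δ : ℝ) (w : Fin K → ℝ) (x : Vec K) : ℝ :=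
  ∑ k, w k * whitenCoord S Δ k x ^ 2

lemma continuous_whitenMix (w : Fin K → ℝ) : Continuous (whitenMix S Δ w) := by
  unfold whitenMix
  have := fun k => continuous_whitenCoord (S := S) (Δ := Δ) k
  fun_prop

lemma integral_whitenMix (hΔ : 0 < Δ) (h : (truncCov S Δ).PosDef) {w : Fin K → ℝ}
    (hw : ∑ k, w k = 1) : ∫ x, whitenMix S Δ w x ∂(truncLaw S Δ) = 1 := by
  unfold whitenMix
  have hc := fun k => continuous_whitenCoord (S := S) (Δ := Δ) k
  rw [integral_finsetSum _ fun k _ => integrable_truncLaw hΔ (by fun_prop)]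
  simp only [integral_const_mul, sq, integral_whitenCoord_mul hΔ h]
  simpa using hw

/-- Jensen's inequality extends the exponential moment from the squared coordinates to their convex
combinations. -/
lemma integral_exp_whitenMix_le (hΔ : 0 < Δ) (h : (truncCov S Δ).PosDef)
    (h0 : 0 < cubeProb S Δ) {w : Fin K → ℝ} (hw0 : ∀ k, 0 ≤ w k) (hw : ∑ k, w k = 1) :
    ∫ x, Real.exp (cubeProb S Δ ^ 2 / 32 * whitenMix S Δ w x) ∂(truncLaw S Δ) ≤
      2 * (cubeProb S Δ)⁻¹ := by
  have hc := fun k => continuous_whitenCoord (S := S) (Δ := Δ) k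
  have hm := continuous_whitenMix (S := S) (Δ := Δ) w
  set p₀ := cubeProb S Δ
  calc ∫ x, Real.exp (p₀ ^ 2 / 32 * whitenMix S Δ w x) ∂(truncLaw S Δ)
      ≤ ∫ x, ∑ k, w k * Real.exp (p₀ ^ 2 / 32 * whitenCoord S Δ k x ^ 2) ∂(truncLaw S Δ) := by
        refine integral_mono (integrable_truncLaw hΔ (by fun_prop))
          (integrable_truncLaw hΔ (by fun_prop)) fun x => ?_
        have := convexOn_exp.map_sum_le (t := Finset.univ) (w := w)
          (p := fun k => p₀ ^ 2 / 32 * whitenCoord S Δ k x ^ 2) (fun k _ => hw0 k) hw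
          (fun k _ => Set.mem_univ _)
        simp only [smul_eq_mul] at this
        refine le_trans (le_of_eq ?_) this
        rw [whitenMix, Finset.mul_sum]
        congr 1
        exact Finset.sum_congr rfl fun k _ => by ring
    _ = ∑ k, w k * ∫ x, Real.exp (p₀ ^ 2 / 32 * whitenCoord S Δ k x ^ 2) ∂(truncLaw S Δ) := by
        rw [integral_finsetSum _ fun k _ => integrable_truncLaw hΔ (by fun_prop)]
        simp only [integral_const_mul]
    _ ≤ ∑ k, w k * (2 * p₀⁻¹) := by
        refine Finset.sum_le_sum fun k _ => ?_
        have := hw0 k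
        gcongr
        exact integral_exp_whitenCoord_sq_le hΔ h h0 k
    _ = 2 * p₀⁻¹ := by rw [← Finset.sum_mul, hw, one_mul]

/-- The scale `2¹⁰ p₀^{-5/2}` of the exponential moments of the squared whitened coordinates, where
`p₀` is the probability of the cube. Variables dominated by these squares have a moment
generating function of sub-Gaussian type up to the reciprocal of this scale. The exponential
moments alone would suggest a larger power of `p₀⁻¹` for the variance factor; the bound `1` on
the mean of the squares keeps it at `5/2`. -/
def momentScale (S : Mat K) (Δ : ℝ) : ℝ := 2 ^ 10 * (Real.sqrt (cubeProb S Δ))⁻¹ ^ 5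

lemma momentScale_pos (h0 : 0 < cubeProb S Δ) : 0 < momentScale S Δ := by
  have := Real.sqrt_pos.mpr h0
  unfold momentScale; positivity

lemma momentScale_sq (h0 : 0 < cubeProb S Δ) :
    momentScale S Δ ^ 2 * cubeProb S Δ ^ 5 = 2 ^ 20 := by
  have h := Real.sqrt_pos.mpr h0
  have h' : cubeProb S Δ ^ 5 = (Real.sqrt (cubeProb S Δ)) ^ 10 := by
    nth_rewrite 1 [← Real.sq_sqrt h0.le]; ring
  rw [h', momentScale]
  field_simp

lemma momentScale_mul_le (h0 : 0 < cubeProb S Δ) :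
    momentScale S Δ * cubeProb S Δ ^ 3 ≤ 2 ^ 10 := by
  have h := Real.sqrt_pos.mpr h0
  have h1 : Real.sqrt (cubeProb S Δ) ≤ 1 := Real.sqrt_le_one.mpr cubeProb_le_one
  have h' : cubeProb S Δ ^ 3 = (Real.sqrt (cubeProb S Δ)) ^ 6 := by
    nth_rewrite 1 [← Real.sq_sqrt h0.le]; ring
  rw [h', momentScale]
  field_simp
  exact h1

/-- The bound of `integral_exp_mul_le` for functions dominated by a convex combination of the
squared whitened coordinates. -/
lemma integral_exp_mul_le_of_whitenMix (hΔ : 0 < Δ) (h : (truncCov S Δ).PosDef)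
    (h0 : 0 < cubeProb S Δ) {w : Fin K → ℝ} (hw0 : ∀ k, 0 ≤ w k) (hw : ∑ k, w k = 1)
    {W : Vec K → ℝ} (hWc : Continuous W) (hW : ∫ x, W x ∂(truncLaw S Δ) = 0)
    (hWV : ∀ x, |W x| ≤ whitenMix S Δ w x + 1) {s : ℝ} (hs : |s| * momentScale S Δ ≤ 1) :
    ∫ x, Real.exp (s * W x) ∂(truncLaw S Δ) ≤ Real.exp (2 ^ 6 * momentScale S Δ * s ^ 2) := by
  have hprob := isProbabilityMeasure_truncLaw h0
  have hm := continuous_whitenMix (S := S) (Δ := Δ) w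
  have hsq := Real.sqrt_pos.mpr h0
  have hr4 : (Real.sqrt (cubeProb S Δ))⁻¹⁻¹ ^ 4 = cubeProb S Δ ^ 2 := by
    rw [inv_inv]; nth_rewrite 2 [← Real.sq_sqrt h0.le]; ring
  have hr2 : (Real.sqrt (cubeProb S Δ))⁻¹ ^ 2 = (cubeProb S Δ)⁻¹ := by
    rw [inv_pow, Real.sq_sqrt h0.le]
  refine (integral_exp_mul_le (V := whitenMix S Δ w) (r := (Real.sqrt (cubeProb S Δ))⁻¹)
    ((one_le_inv₀ hsq).mpr (Real.sqrt_le_one.mpr cubeProb_le_one)) hs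
    (fun x => Finset.sum_nonneg fun k _ => mul_nonneg (hw0 k) (sq_nonneg _)) hWV hW
    (integral_whitenMix hΔ h hw).le ?_ (integrable_truncLaw hΔ hWc) (integrable_truncLaw hΔ hm)
    (integrable_truncLaw hΔ (by fun_prop)) (integrable_truncLaw hΔ (by fun_prop))).trans
    (le_of_eq ?_)
  · rw [hr4, hr2]
    exact integral_exp_whitenMix_le hΔ h h0 hw0 hw
  · congr 1; rw [momentScale]; ring

/-- The entries of the whitened second-moment matrix are dominated by half the sum of two squared
coordinates. -/
lemma integral_exp_entry_le (hΔ : 0 < Δ) (h : (truncCov S Δ).PosDef) (h0 : 0 < cubeProb S Δ)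
    (i j : Fin K) {s : ℝ} (hs : |s| * momentScale S Δ ≤ 1) :
    ∫ x, Real.exp (s * (whitenCoord S Δ i x * whitenCoord S Δ j x - (1 : Mat K) i j))
      ∂(truncLaw S Δ) ≤ Real.exp (2 ^ 6 * momentScale S Δ * s ^ 2) := by
  have hprob := isProbabilityMeasure_truncLaw h0
  have hc := fun k => continuous_whitenCoord (S := S) (Δ := Δ) k
  set w : Fin K → ℝ := fun k => 1 / 2 * Pi.single (M := fun _ => ℝ) i 1 k +
    1 / 2 * Pi.single (M := fun _ => ℝ) j 1 k with hw
  have hmix : ∀ x, whitenMix S Δ w x =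
      1 / 2 * whitenCoord S Δ i x ^ 2 + 1 / 2 * whitenCoord S Δ j x ^ 2 := by
    intro x
    simp [whitenMix, hw, add_mul, Finset.sum_add_distrib, Pi.single_apply]
  refine integral_exp_mul_le_of_whitenMix hΔ h h0 (w := w) (fun k => ?_) ?_ (by fun_prop) ?_
    (fun x => ?_) hs
  · simp only [hw, Pi.single_apply]; positivity
  · simp only [hw, Finset.sum_add_distrib, ← Finset.mul_sum, Finset.sum_pi_single']
    simp; norm_num
  · rw [integral_sub (integrable_truncLaw hΔ (by fun_prop)) (integrable_const _),
      integral_whitenCoord_mul hΔ h]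
    simp
  · rw [hmix]
    have h1 : |whitenCoord S Δ i x * whitenCoord S Δ j x| ≤
        1 / 2 * whitenCoord S Δ i x ^ 2 + 1 / 2 * whitenCoord S Δ j x ^ 2 := by
      rw [abs_le]
      constructor <;> nlinarith [sq_nonneg (whitenCoord S Δ i x - whitenCoord S Δ j x),
        sq_nonneg (whitenCoord S Δ i x + whitenCoord S Δ j x)]
    have h2 : |(1 : Mat K) i j| ≤ 1 := by
      rw [Matrix.one_apply]; split_ifs <;> simp
    calc _ ≤ |whitenCoord S Δ i x * whitenCoord S Δ j x| + |(1 : Mat K) i j| := abs_sub _ _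
      _ ≤ _ := add_le_add h1 h2

/-- The squared norm, divided by the dimension, is the mean of the squared coordinates. -/
lemma integral_exp_norm_le (hK : 0 < K) (hΔ : 0 < Δ) (h : (truncCov S Δ).PosDef)
    (h0 : 0 < cubeProb S Δ) {s : ℝ} (hs0 : 0 ≤ s) (hs : s * momentScale S Δ ≤ 1) :
    ∫ x, Real.exp (s * (‖whiten S Δ x‖ ^ 2 / K)) ∂(truncLaw S Δ) ≤ Real.exp (65 * s) := by
  have hprob := isProbabilityMeasure_truncLaw h0
  have hK' : (0:ℝ) < K := by exact_mod_cast hK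
  set w : Fin K → ℝ := fun _ => 1 / K with hw
  have hw1 : ∑ k, w k = 1 := by simp [hw]; field_simp
  have hmix : ∀ x, ‖whiten S Δ x‖ ^ 2 / K = whitenMix S Δ w x := by
    intro x
    rw [whitenMix, ← sum_whitenCoord_sq, ← Finset.mul_sum]; ring
  have hm := continuous_whitenMix (S := S) (Δ := Δ) w
  have hnn : ∀ x, 0 ≤ whitenMix S Δ w x := fun x => by rw [← hmix]; positivity
  have e := integral_exp_mul_le_of_whitenMix hΔ h h0 (w := w) (fun k => by positivity) hw1
    (W := fun x => whitenMix S Δ w x - 1) (by fun_prop)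
    (by
      rw [integral_sub (integrable_truncLaw hΔ (by fun_prop)) (integrable_const _),
        integral_whitenMix hΔ h hw1]
      simp)
    (fun x => by
      rw [abs_le]; constructor <;> linarith [hnn x]) (s := s) (by rwa [abs_of_nonneg hs0])
  have e2 : ∀ x, Real.exp (s * (‖whiten S Δ x‖ ^ 2 / K)) =
      Real.exp s * Real.exp (s * (whitenMix S Δ w x - 1)) := fun x => by
    rw [hmix, ← Real.exp_add]; ring_nf
  simp only [e2]
  rw [integral_const_mul]
  calc _ ≤ Real.exp s * Real.exp (2 ^ 6 * momentScale S Δ * s ^ 2) := by gcongr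
    _ ≤ _ := by
        rw [← Real.exp_add, Real.exp_le_exp]
        nlinarith

/-- The squared norm of a whitened point has an exponential moment of the order `2^{K/2}`. -/
lemma integral_exp_norm_sq_le (hΔ : 0 < Δ) (hS : S.PosDef) (h0 : 0 < cubeProb S Δ) {θ : ℝ}
    (hθ : θ ≤ cubeProb S Δ ^ 2 / 32) :
    ∫ x, Real.exp (θ * ‖whiten S Δ x‖ ^ 2) ∂(truncLaw S Δ) ≤
      (cubeProb S Δ)⁻¹ * Real.sqrt 2 ^ K := by
  have hmeas : (multivariateGaussian 0 S).map (rootInv S) = stdGaussian (Vec K) := by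
    rw [multivariateGaussian_eq_map, Measure.map_map (by fun_prop) (by fun_prop)]
    have : (rootInv S : Vec K → Vec K) ∘ root S = id := by
      ext x; simp [rootInv_root hS]
    rw [this, Measure.map_id]
  have hint : Integrable (fun x => Real.exp (1 / 4 * ‖rootInv S x‖ ^ 2))
      (multivariateGaussian 0 S) := by
    have := integrable_exp_mul_norm_sq (K := K) (l := 1 / 4) (by norm_num)
    rw [← hmeas] at this
    exact this.comp_measurable (by fun_prop)
  refine (integral_truncLaw_le hΔ h0 (by fun_prop) hint (fun x => (Real.exp_pos _).le)
    fun x => ?_).trans (le_of_eq ?_)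
  · refine Real.exp_le_exp.mpr ?_
    have e := norm_whiten_sq_le_norm_rootInv_sq hΔ hS h0 x
    have : θ * ‖whiten S Δ x‖ ^ 2 ≤ cubeProb S Δ ^ 2 / 32 * ‖whiten S Δ x‖ ^ 2 := by gcongr
    linarith
  · congr 1
    have e := integral_map (μ := multivariateGaussian 0 S) (φ := rootInv S)
      (by fun_prop) (f := fun z : Vec K => Real.exp (1 / 4 * ‖z‖ ^ 2)) (by fun_prop)
    rw [← e, hmeas, integral_exp_mul_norm_sq (by norm_num), inv_pow, ← inv_pow]
    congr 1
    rw [← Real.sqrt_inv]; norm_num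

end WhitenedMoments

/-! ### From the operator norm to scalar sums -/

section Deviations

variable {K n : ℕ} {S : Mat K} {Δ β : ℝ}

/-- A bound on the entries costs a factor `K` in operator norm. -/
lemma norm_toEuclideanCLM_le {B : Mat K} {b : ℝ} (hb : 0 ≤ b) (h : ∀ i j, |B i j| ≤ b) :
    ‖Matrix.toEuclideanCLM (n := Fin K) (𝕜 := ℝ) B‖ ≤ K * b := by
  refine ContinuousLinearMap.opNorm_le_bound _ (by positivity) fun u => ?_
  have h1 : ∀ i, |Matrix.toEuclideanCLM (n := Fin K) (𝕜 := ℝ) B u i| ≤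
      b * (Real.sqrt K * ‖u‖) := by
    intro i
    rw [Matrix.ofLp_toEuclideanCLM, Matrix.mulVec, dotProduct]
    have h2 : ∑ j, |u j| ≤ Real.sqrt K * ‖u‖ := by
      refine abs_le_of_sq_le_sq' ?_ (by positivity) |>.2
      have := sq_sum_le_card_mul_sum_sq (s := (Finset.univ : Finset (Fin K))) (f := fun j => |u j|)
      rw [mul_pow, Real.sq_sqrt (Nat.cast_nonneg K), EuclideanSpace.real_norm_sq_eq]
      simpa using this
    calc |∑ j, B i j * u j| ≤ ∑ j, |B i j * u j| := Finset.abs_sum_le_sum_abs _ _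
      _ ≤ ∑ j, b * |u j| := Finset.sum_le_sum fun j _ => by rw [abs_mul]; gcongr; exact h i j
      _ ≤ b * (Real.sqrt K * ‖u‖) := by rw [← Finset.mul_sum]; gcongr
  refine (norm_le_of_forall_abs_le (by positivity) h1).trans_eq ?_
  have := Real.mul_self_sqrt (Nat.cast_nonneg (α := ℝ) K)
  calc Real.sqrt K * (b * (Real.sqrt K * ‖u‖)) = (Real.sqrt K * Real.sqrt K) * b * ‖u‖ := by ring
    _ = K * b * ‖u‖ := by rw [this]

lemma whitenedCov_sub_one_apply (x : Fin n → Vec K) (i j : Fin K) :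
    (whitenedCov S Δ x - 1) i j = ((unwrapped Δ x).card : ℝ)⁻¹ *
      ∑ m ∈ unwrapped Δ x, whitenCoord S Δ i (x m) * whitenCoord S Δ j (x m) - (1 : Mat K) i j := by
  simp only [whitenedCov, Matrix.sub_apply, Matrix.smul_apply, Matrix.sum_apply, smul_eq_mul,
    Matrix.vecMulVec_apply, whitenCoord_eq]
  rfl

/-- A large deviation in operator norm shows in one of the entries. -/
lemma exists_entry_of_lt_norm {b : ℝ} (hb : 0 ≤ b) {x : Fin n → Vec K}
    (hN : 0 < (unwrapped Δ x).card)
    (h : K * b < ‖Matrix.toEuclideanCLM (n := Fin K) (𝕜 := ℝ) (whitenedCov S Δ x - 1)‖) :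
    ∃ i j : Fin K, b * (unwrapped Δ x).card < |∑ m ∈ unwrapped Δ x,
      (whitenCoord S Δ i (x m) * whitenCoord S Δ j (x m) - (1 : Mat K) i j)| := by
  by_contra! hcon
  refine absurd (norm_toEuclideanCLM_le hb fun i j => ?_) (not_le.mpr h)
  have hN' : (0:ℝ) < (unwrapped Δ x).card := by exact_mod_cast hN
  have h1 := hcon i j
  rw [Finset.sum_sub_distrib, Finset.sum_const, nsmul_eq_mul] at h1
  rw [whitenedCov_sub_one_apply]
  set A := ∑ m ∈ unwrapped Δ x, whitenCoord S Δ i (x m) * whitenCoord S Δ j (x m)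
  set N : ℝ := ((unwrapped Δ x).card : ℝ)
  have : N⁻¹ * A - (1 : Mat K) i j = (A - N * (1 : Mat K) i j) / N := by field_simp
  rw [this, abs_div, abs_of_pos hN', div_le_iff₀ hN']
  exact h1

lemma norm_toEuclideanCLM_vecMulVec_le (y : Vec K) :
    ‖Matrix.toEuclideanCLM (n := Fin K) (𝕜 := ℝ) (Matrix.vecMulVec y y)‖ ≤ ‖y‖ ^ 2 := by
  refine ContinuousLinearMap.opNorm_le_bound _ (by positivity) fun u => ?_
  have : Matrix.toEuclideanCLM (n := Fin K) (𝕜 := ℝ) (Matrix.vecMulVec y y) u =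
      (inner ℝ y u : ℝ) • y := by
    ext i
    rw [Matrix.ofLp_toEuclideanCLM, Matrix.vecMulVec_mulVec]
    simp only [PiLp.inner_apply, RCLike.inner_apply, conj_trivial, dotProduct, Pi.smul_apply,
      MulOpposite.smul_eq_mul_unop, MulOpposite.unop_op, PiLp.smul_apply, smul_eq_mul]
    rw [mul_comm]
    congr 1
    exact Finset.sum_congr rfl fun j _ => mul_comm _ _
  rw [this, norm_smul, Real.norm_eq_abs]
  calc _ ≤ ‖y‖ * ‖u‖ * ‖y‖ := by gcongr; exact abs_real_inner_le_norm _ _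
    _ = ‖y‖ ^ 2 * ‖u‖ := by ring

lemma norm_whitenedCov_sub_one_le (x : Fin n → Vec K) :
    ‖Matrix.toEuclideanCLM (n := Fin K) (𝕜 := ℝ) (whitenedCov S Δ x - 1)‖ ≤
      ((unwrapped Δ x).card : ℝ)⁻¹ * ∑ m ∈ unwrapped Δ x, ‖whiten S Δ (x m)‖ ^ 2 + 1 := by
  rw [map_sub, map_one]
  refine (norm_sub_le _ _).trans (add_le_add ?_ ?_)
  · rw [whitenedCov, map_smul, norm_smul, map_sum, Real.norm_of_nonneg (by positivity)]
    gcongr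
    refine norm_sum_le_of_le _ fun m _ => ?_
    exact norm_toEuclideanCLM_vecMulVec_le (whiten S Δ (x m))
  · exact ContinuousLinearMap.norm_id_le

/-- A deviation larger than `2` in operator norm shows in the average squared norm. -/
lemma le_sum_of_lt_norm (hβ : 2 ≤ β) {x : Fin n → Vec K} (hN : 0 < (unwrapped Δ x).card)
    (h : β < ‖Matrix.toEuclideanCLM (n := Fin K) (𝕜 := ℝ) (whitenedCov S Δ x - 1)‖) :
    β / 2 * (unwrapped Δ x).card < ∑ m ∈ unwrapped Δ x, ‖whiten S Δ (x m)‖ ^ 2 := by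
  have hN' : (0:ℝ) < (unwrapped Δ x).card := by exact_mod_cast hN
  have h1 := h.trans_le (norm_whitenedCov_sub_one_le x)
  rw [inv_mul_eq_div, ← sub_lt_iff_lt_add, lt_div_iff₀ hN'] at h1
  nlinarith

end Deviations

/-! ### Lower bounds on the probability of the cube and on the norm bound -/

section NormBound

variable {K : ℕ} {S : Mat K} {Δ ε τ P : ℝ}

/-- The packing bound limits the dimension in terms of `Δ / τ`. -/
lemma four_mul_le_sq_div (hτ : 0 < τ) (hκ : 1 < kappa K ε)
    (hpack : 2 * (Real.sqrt K * kappa K ε) * τ ≤ Δ) : 4 * K ≤ (Δ / τ) ^ 2 := by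
  have hK' : (0:ℝ) ≤ K := Nat.cast_nonneg K
  have h : 2 * Real.sqrt K ≤ Δ / τ := by
    rw [le_div_iff₀ hτ]
    refine le_trans ?_ hpack
    have : Real.sqrt K * 1 ≤ Real.sqrt K * kappa K ε := by gcongr
    gcongr
    linarith
  calc (4:ℝ) * K = (2 * Real.sqrt K) ^ 2 := by rw [mul_pow, Real.sq_sqrt hK']; norm_num
    _ ≤ _ := by gcongr

/-- Upper bounds on `α` are lower bounds on the norm bound. -/
lemma sq_mul_le_normBound (hΔ : 4 * K ≤ (Δ / τ) ^ 2) (h0 : 0 < P) (h1 : P < 1) {a : ℝ}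
    (ha : alpha P K ≤ a) : (K:ℝ) ^ 2 * (1 - P) ≤ a * normBound K Δ τ P := by
  have hα := alpha_pos h0 h1 K
  have hp : 0 < 1 - P := by linarith
  have h : (K:ℝ) ^ 2 * (1 - P) ≤ alpha P K * normBound K Δ τ P := by
    rw [normBound]
    have e : alpha P K * (K * (Δ / τ) ^ 2 * (1 - P) / (4 * alpha P K)) =
        K * (1 - P) / 4 * (Δ / τ) ^ 2 := by field_simp
    rw [e]
    calc (K:ℝ) ^ 2 * (1 - P) = K * (1 - P) / 4 * (4 * K) := by ring
      _ ≤ _ := by gcongr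
  refine h.trans ?_
  have : 0 ≤ normBound K Δ τ P := by rw [normBound]; positivity
  gcongr

lemma one_le_normBound (hK : 0 < K) (hΔ : 4 * K ≤ (Δ / τ) ^ 2) (h0 : 0 < P) (h1 : P < 1) :
    1 ≤ normBound K Δ τ P := by
  have h := sq_mul_le_normBound hΔ h0 h1 (alpha_le h0 h1 K)
  have hp : 0 < 1 - P := by linarith
  have hK1 : (1:ℝ) ≤ (K:ℝ) ^ 2 := one_le_pow₀ (by exact_mod_cast hK)
  rw [mul_comm] at h
  exact hK1.trans (le_of_mul_le_mul_left h hp)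

/-- The norm bound grows at least like a power of `(1 - P)⁻¹`; the exponent increases with the
dimension, up to four. -/
lemma sq_le_pow_mul_normBound (hΔ : 4 * K ≤ (Δ / τ) ^ 2) (h0 : 0 < P) (h1 : P < 1) {j : ℕ}
    (hj : j ≤ K + 1) (hj4 : j ≤ 4) : (K:ℝ) ^ 2 ≤ 8 * (1 - P) ^ j * normBound K Δ τ P := by
  have h := sq_mul_le_normBound hΔ h0 h1 (alpha_le_pow h0 h1 (K := K) (j := j + 1) (by omega)
    (by omega))
  have hp : 0 < 1 - P := by linarith
  refine le_of_mul_le_mul_right (h.trans_eq ?_) hp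
  ring

/-- In dimension two a determinant bound improves the bound on `Δ / τ` when the probability of
the cube is small. -/
lemma one_le_cubeProb_mul_sq_div {S : Mat 2} (hΔ : 0 < Δ) (hε : 0 < ε) (hε1 : ε < 1)
    (hS : S.PosDef) (h1 : A1 S Δ ε) (hτ : 0 < τ) (h2 : A2 S τ) (hκ : 1 < kappa 2 ε) :
    1 ≤ 2 * cubeProb S Δ * (Δ / τ) ^ 2 := by
  obtain ⟨A, hdet, hA⟩ := exists_unimodular_rows two_pos hΔ hε hε1 h1
  have hs2 : Real.sqrt (2:ℕ) ^ 2 = 2 := by rw [Real.sq_sqrt (by positivity)]; norm_num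
  have hs2' : 0 ≤ Real.sqrt (2:ℕ) := Real.sqrt_nonneg _
  set B : Mat 2 := A.map (fun a : ℤ => (a : ℝ)) with hB
  have hBdet : B.det ^ 2 = 1 := by
    have : B.det = (A.det : ℝ) := ((Int.castRingHom ℝ).map_det A).symm
    rw [this]
    rcases hdet with h | h <;> rw [h] <;> norm_num
  have hrow : ∀ i, (B * S * B.transpose) i i ≤ Δ ^ 2 / 8 := by
    intro i
    have e : (B * S * B.transpose) i i =
        ‖root S (WithLp.toLp 2 fun k => (A i k : ℝ))‖ ^ 2 := by
      rw [norm_root_sq hS.posSemidef, Matrix.mul_assoc, Matrix.mul_apply, dotProduct]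
      refine Finset.sum_congr rfl fun k _ => ?_
      rw [Matrix.mul_apply, Matrix.mulVec, dotProduct]
      rfl
    rw [e]
    have h3 := hA i
    set σ := ‖root S (WithLp.toLp 2 fun k => (A i k : ℝ))‖
    have hσ : 0 ≤ σ := norm_nonneg _
    have h4 : 2 * σ * (Real.sqrt (2:ℕ) * 1) ≤ Δ := le_trans (by gcongr) h3
    have h5 : (2 * σ * (Real.sqrt (2:ℕ) * 1)) ^ 2 ≤ Δ ^ 2 := by gcongr
    nlinarith
  have hpsd : (B * S * B.transpose).PosSemidef := by
    have := hS.posSemidef.mul_mul_conjTranspose_same B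
    rwa [Matrix.conjTranspose_eq_transpose_of_trivial] at this
  have hdetS : S.det ≤ (Δ ^ 2 / 8) ^ 2 := by
    have e : S.det = (B * S * B.transpose).det := by
      rw [Matrix.det_mul, Matrix.det_mul, Matrix.det_transpose]
      linear_combination (-S.det) * hBdet
    rw [e, Matrix.det_fin_two]
    have hsym : (B * S * B.transpose) 1 0 = (B * S * B.transpose) 0 1 := by
      have := hpsd.isHermitian.apply 0 1
      simpa using this
    rw [hsym]
    have d0 : 0 ≤ (B * S * B.transpose) 0 0 := hpsd.diag_nonneg
    have d1 : 0 ≤ (B * S * B.transpose) 1 1 := hpsd.diag_nonneg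
    have := mul_le_mul (hrow 0) (hrow 1) d1 (by positivity)
    nlinarith [mul_self_nonneg ((B * S * B.transpose) 0 1)]
  have hpack := two_mul_sqrt_mul_kappa_mul_le two_pos hΔ hε hε1 hS h1 hτ h2 (by linarith)
  have hτΔ : τ < Δ := by
    have h3 := four_mul_le_sq_div hτ hκ hpack
    rw [div_pow, le_div_iff₀ (by positivity)] at h3
    push_cast at h3
    refine lt_of_pow_lt_pow_left₀ 2 hΔ.le ?_
    have : 0 < τ ^ 2 := by positivity
    linarith
  have hbox : box (0 : Vec 2) (τ / 2) ⊆ cube 2 Δ := by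
    intro x hx k
    have := abs_le.mp (hx k)
    simp only [PiLp.zero_apply, sub_zero] at this
    constructor <;> linarith
  have h := le_measureReal_box hS (0 : Vec 2) (w := τ / 2) (R := 1 / 2) (by positivity)
    fun x hx => by
    have e1 := norm_rootInv_le h2 hS x
    have e2 : ‖x‖ ≤ Real.sqrt (2:ℕ) * (τ / 2) := norm_le_of_forall_abs_le (by positivity)
      fun k => by simpa using hx k
    have e3 : (τ * ‖rootInv S x‖) ^ 2 ≤ (Real.sqrt (2:ℕ) * (τ / 2)) ^ 2 := by
      have := e1.trans e2
      gcongr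
    rw [mul_pow, mul_pow, hs2] at e3
    have : 0 < τ ^ 2 := by positivity
    nlinarith
  have h' := h.trans (measureReal_mono hbox)
  have hsq : Real.sqrt S.det ≤ Δ ^ 2 / 8 := Real.sqrt_le_iff.mpr ⟨by positivity, hdetS⟩
  have hsq0 : 0 < Real.sqrt S.det := Real.sqrt_pos.mpr hS.det_pos
  have hinv : 8 / Δ ^ 2 ≤ (Real.sqrt S.det)⁻¹ := by
    rw [div_le_iff₀ (by positivity), inv_mul_eq_div, le_div_iff₀ hsq0]; linarith
  have hc : 1 / 7 ≤ (Real.sqrt (2 * Real.pi))⁻¹ ^ 2 := by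
    rw [inv_pow, Real.sq_sqrt (by positivity), one_div]
    have := Real.pi_lt_d2
    gcongr
    linarith
  have he : 3 / 4 ≤ Real.exp (-(1 / 2) / 2) := by
    have := Real.add_one_le_exp (-(1 / 2) / 2 : ℝ); linarith
  have hfin : 6 / 7 * (τ / Δ) ^ 2 ≤ cubeProb S Δ := by
    refine le_trans ?_ h'
    calc 6 / 7 * (τ / Δ) ^ 2 = 1 / 7 * (3 / 4) * (8 / Δ ^ 2 * (2 * (τ / 2)) ^ 2) := by
          field_simp; norm_num
      _ ≤ _ := by gcongr
  have h9 : 6 / 7 * (τ / Δ) ^ 2 * (Δ / τ) ^ 2 ≤ cubeProb S Δ * (Δ / τ) ^ 2 := by gcongr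
  have h10 : 6 / 7 * (τ / Δ) ^ 2 * (Δ / τ) ^ 2 = 6 / 7 := by field_simp
  linarith

lemma one_fourth_le_gaussianReal : 1 / 4 ≤ (gaussianReal 0 1).real {y | |y| ≤ 1} := by
  have hset : {y : ℝ | |y| ≤ 1} = Set.Icc (-1) 1 := by ext y; simp [abs_le]
  rw [hset, measureReal_def, gaussianReal_apply_eq_integral _ one_ne_zero, ENNReal.toReal_ofReal
    (integral_nonneg fun y => gaussianPDFReal_nonneg _ _ _)]
  have hc : 1 / 4 ≤ (Real.sqrt (2 * Real.pi))⁻¹ := by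
    rw [one_div]
    refine inv_anti₀ (by positivity) (Real.sqrt_le_iff.mpr ⟨by norm_num, ?_⟩)
    have := Real.pi_lt_four
    linarith
  calc (1 / 4 : ℝ) = ∫ _y in Set.Icc (-1:ℝ) 1, (1 / 8 : ℝ) := by
        rw [setIntegral_const, measureReal_def, Real.volume_Icc]; norm_num
    _ ≤ ∫ y in Set.Icc (-1:ℝ) 1, gaussianPDFReal 0 1 y := by
        refine setIntegral_mono_on (by simp) (integrable_gaussianPDFReal 0 1).integrableOn
          measurableSet_Icc fun y hy => ?_
        simp only [gaussianPDFReal, NNReal.coe_one, mul_one, sub_zero]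
        have : 1 / 2 ≤ Real.exp (-y ^ 2 / 2) := by
          have h1 := Real.add_one_le_exp (-y ^ 2 / 2)
          have h2 : y ^ 2 ≤ 1 := by nlinarith [hy.1, hy.2]
          linarith
        calc (1 / 8 : ℝ) = 1 / 4 * (1 / 2) := by norm_num
          _ ≤ _ := by gcongr

/-- In dimension one the assumption on `κ` makes the cube likely. -/
lemma one_fourth_le_cubeProb {S : Mat 1} (hΔ : 0 < Δ) (hε : 0 < ε) (hε1 : ε < 1)
    (hS : S.PosDef) (h1 : A1 S Δ ε) (hκ : 1 < kappa 1 ε) : 1 / 4 ≤ cubeProb S Δ := by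
  obtain ⟨A, hdet, hA⟩ := exists_unimodular_rows one_pos hΔ hε hε1 h1
  have h3 := hA 0
  set v : Vec 1 := WithLp.toLp 2 fun k => (A 0 k : ℝ) with hv
  have hA0 : (A 0 0 : ℝ) ^ 2 = 1 := by
    rw [Matrix.det_fin_one] at hdet
    rcases hdet with h | h <;> rw [h] <;> norm_num
  have habs : |(A 0 0 : ℝ)| = 1 := by rw [← Real.sqrt_sq_eq_abs, hA0, Real.sqrt_one]
  have hin : ∀ x : Vec 1, |inner ℝ x v| = |x 0| := fun x => by
    have : inner ℝ x v = A 0 0 * x 0 := by simp [hv, PiLp.inner_apply]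
    rw [this, abs_mul, habs, one_mul]
  have hv0 : v ≠ 0 := by
    intro h
    have := congrArg (fun z : Vec 1 => z 0) h
    simp only [hv, PiLp.zero_apply] at this
    rw [this] at hA0; norm_num at hA0
  have hσ := norm_root_pos hS hv0
  refine one_fourth_le_gaussianReal.trans ?_
  have h4 := measureReal_inner_le (S := S) v hσ hσ.le
  rw [div_self hσ.ne'] at h4
  rw [← h4]
  refine measureReal_mono (fun x hx k => ?_) (measure_ne_top _ _)
  have hx' : |inner ℝ x v| ≤ ‖root S v‖ := hx
  rw [hin] at hx'
  have hlt : ‖root S v‖ < Δ / 2 := by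
    simp only [Nat.cast_one, Real.sqrt_one, one_mul] at h3
    have : 2 * ‖root S v‖ * 1 < 2 * ‖root S v‖ * kappa 1 ε := by gcongr
    linarith
  have hk : k = 0 := Subsingleton.elim _ _
  rw [hk]
  have := abs_le.mp hx'
  constructor <;> linarith

/-- The moment scale is controlled by the norm bound in dimension at least two, where `α` decays at
least like `(1 - P)⁴`. -/
lemma momentScale_le_normBound (hK : 2 ≤ K) (hΔ : 4 * K ≤ (Δ / τ) ^ 2) (h0 : 0 < P) (h1 : P < 1)
    (h3 : A3 S Δ P) : (K:ℝ) ^ 2 * momentScale S Δ ≤ 2 ^ 13 * normBound K Δ τ P := by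
  have hp := one_sub_le_cubeProb h3
  have hp0 : 0 < 1 - P := by linarith
  have hc0 : 0 < cubeProb S Δ := by linarith
  have hM : 0 ≤ normBound K Δ τ P :=
    zero_le_one.trans (one_le_normBound (by omega) hΔ h0 h1)
  have e1 := sq_le_pow_mul_normBound hΔ h0 h1 (j := 3) (by omega) (by norm_num)
  have e2 := momentScale_mul_le hc0
  have hL := momentScale_pos hc0
  calc (K:ℝ) ^ 2 * momentScale S Δ ≤ 8 * (1 - P) ^ 3 * normBound K Δ τ P * momentScale S Δ := by
        gcongr
    _ ≤ 8 * cubeProb S Δ ^ 3 * normBound K Δ τ P * momentScale S Δ := by gcongr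
    _ = 8 * normBound K Δ τ P * (momentScale S Δ * cubeProb S Δ ^ 3) := by ring
    _ ≤ 8 * normBound K Δ τ P * 2 ^ 10 := by gcongr
    _ = _ := by ring

/-- For the square of the moment scale, the lower bounds on the norm bound by powers of `(1 - P)⁻¹`
suffice in dimension at least three. In dimension two one more power is needed, and
`one_le_cubeProb_mul_sq_div` provides it. -/
lemma momentScale_sq_le_normBound (hK : 2 ≤ K) (hΔ : 0 < Δ) (hε : 0 < ε) (hε1 : ε < 1)
    (hS : S.PosDef) (hA1 : A1 S Δ ε) (hτ : 0 < τ) (h2 : A2 S τ) (hκ : 1 < kappa K ε)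
    (h0 : 0 < P) (h1 : P < 1) (h3 : A3 S Δ P) :
    (K:ℝ) ^ 2 * momentScale S Δ ^ 2 * (1 - P) ≤ 2 ^ 27 * normBound K Δ τ P := by
  have hpack := two_mul_sqrt_mul_kappa_mul_le (by omega) hΔ hε hε1 hS hA1 hτ h2 (by linarith)
  have hΔ4 := four_mul_le_sq_div hτ hκ hpack
  have hp := one_sub_le_cubeProb h3
  have hp0 : 0 < 1 - P := by linarith
  have hc0 : 0 < cubeProb S Δ := by linarith
  have hL := momentScale_pos hc0
  have hL2 := momentScale_sq hc0
  have hM : 0 ≤ normBound K Δ τ P :=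
    zero_le_one.trans (one_le_normBound (by omega) hΔ4 h0 h1)
  have key : (K:ℝ) ^ 2 * (1 - P) ≤ 2 ^ 7 * normBound K Δ τ P * cubeProb S Δ ^ 5 := by
    rcases hK.eq_or_lt with h | h
    · subst h
      have e := one_le_cubeProb_mul_sq_div hΔ hε hε1 hS hA1 hτ h2 hκ
      have hα := alpha_le_pow h0 h1 (K := 2) (j := 4) (by norm_num) (by norm_num)
      have hα0 := alpha_pos h0 h1 2
      have e3 : (1 - P) * (Δ / τ) ^ 2 = 2 * alpha P 2 * normBound 2 Δ τ P := by
        rw [normBound]; push_cast; field_simp; norm_num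
      have e4 : (1 - P) ≤ 32 * (1 - P) ^ 4 * cubeProb S Δ * normBound 2 Δ τ P := by
        calc (1 - P) = 1 * (1 - P) := by ring
          _ ≤ 2 * cubeProb S Δ * (Δ / τ) ^ 2 * (1 - P) := by gcongr
          _ = 2 * cubeProb S Δ * ((1 - P) * (Δ / τ) ^ 2) := by ring
          _ = 2 * cubeProb S Δ * (2 * alpha P 2 * normBound 2 Δ τ P) := by rw [e3]
          _ ≤ 2 * cubeProb S Δ * (2 * (8 * (1 - P) ^ 4) * normBound 2 Δ τ P) := by gcongr
          _ = _ := by ring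
      push_cast
      calc (2:ℝ) ^ 2 * (1 - P) ≤ 2 ^ 2 * (32 * (1 - P) ^ 4 * cubeProb S Δ * normBound 2 Δ τ P) := by
            gcongr
        _ ≤ 2 ^ 2 * (32 * cubeProb S Δ ^ 4 * cubeProb S Δ * normBound 2 Δ τ P) := by gcongr
        _ = _ := by ring
    · have e1 := sq_le_pow_mul_normBound hΔ4 h0 h1 (j := 4) (by omega) le_rfl
      calc (K:ℝ) ^ 2 * (1 - P) ≤ 8 * (1 - P) ^ 4 * normBound K Δ τ P * (1 - P) := by gcongr
        _ = 8 * normBound K Δ τ P * (1 - P) ^ 5 := by ring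
        _ ≤ 2 ^ 7 * normBound K Δ τ P * cubeProb S Δ ^ 5 := by gcongr; norm_num
  refine le_of_mul_le_mul_right ?_ (show 0 < cubeProb S Δ ^ 5 by positivity)
  calc (K:ℝ) ^ 2 * momentScale S Δ ^ 2 * (1 - P) * cubeProb S Δ ^ 5
      = (K:ℝ) ^ 2 * (1 - P) * (momentScale S Δ ^ 2 * cubeProb S Δ ^ 5) := by ring
    _ = (K:ℝ) ^ 2 * (1 - P) * 2 ^ 20 := by rw [hL2]
    _ ≤ 2 ^ 7 * normBound K Δ τ P * cubeProb S Δ ^ 5 * 2 ^ 20 := by gcongr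
    _ = _ := by ring

end NormBound

/-! ### The sample estimation event -/

section SampleEst

variable {K n : ℕ} {S : Mat K} {Δ ε τ P β : ℝ}

/-- At least `k` sample points lie in the cube, and their whitened empirical second-moment matrix
is farther than `β` from the identity. -/
def deviation (S : Mat K) (Δ k β : ℝ) : Set (Fin n → Vec K) :=
  {x | k ≤ (unwrapped Δ x).card ∧
    β < ‖Matrix.toEuclideanCLM (n := Fin K) (𝕜 := ℝ) (whitenedCov S Δ x - 1)‖}

/-- Small deviations: a union bound over the entries. -/
lemma measureReal_deviation_le_of_le (hΔ : 0 < Δ) (h : (truncCov S Δ).PosDef)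
    (h0 : 0 < cubeProb S Δ) {b k : ℝ} (hb : 0 < b) (hb1 : b ≤ 2 ^ 17) (hk : 0 < k) :
    (sampleLaw n S).real (deviation S Δ k (K * b)) ≤
      2 * (K:ℝ) ^ 2 * Real.exp (-(b ^ 2 / (2 ^ 18 * momentScale S Δ) * k)) := by
  have hL := momentScale_pos h0
  set L := momentScale S Δ with hLdef
  have hprob := isProbabilityMeasure_truncLaw h0
  have hc := fun k => continuous_whitenCoord (S := S) (Δ := Δ) k
  set s : ℝ := b / (2 ^ 17 * L) with hs
  have hs0 : 0 < s := by positivity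
  set g : Fin K → Fin K → ℝ → Vec K → ℝ := fun i j σ x =>
    σ * s * (whitenCoord S Δ i x * whitenCoord S Δ j x - (1 : Mat K) i j) + -(s * b) with hg
  have hone : ∀ i j, ∀ σ : ℝ, |σ| = 1 → (sampleLaw n S).real
      {x | k ≤ (unwrapped Δ x).card ∧ 0 ≤ ∑ m ∈ unwrapped Δ x, g i j σ (x m)} ≤
        Real.exp (-(b ^ 2 / (2 ^ 18 * L) * k)) := by
    intro i j σ hσ
    have hσ2 : σ ^ 2 = 1 := by rw [← sq_abs, hσ, one_pow]
    refine measureReal_sum_nonneg_le hΔ h0 (by fun_prop) (by positivity) ?_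
    have hsL : |σ * s| * L ≤ 1 := by
      rw [abs_mul, hσ, one_mul, abs_of_pos hs0, hs]
      rw [div_mul_eq_mul_div, div_le_one (by positivity)]
      gcongr
    have e := integral_exp_entry_le hΔ h h0 i j hsL
    simp only [hg, Real.exp_add]
    rw [integral_mul_const]
    calc _ ≤ Real.exp (2 ^ 6 * L * (σ * s) ^ 2) * Real.exp (-(s * b)) := by gcongr
      _ ≤ _ := by
          rw [← Real.exp_add, Real.exp_le_exp, mul_pow, hσ2]
          have e1 : s * b = 2 ^ 17 * L * s ^ 2 := by rw [hs]; field_simp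
          have e2 : b ^ 2 / (2 ^ 18 * L) = 2 ^ 16 * L * s ^ 2 := by rw [hs]; field_simp
          rw [e1, e2]
          have : 0 ≤ L * s ^ 2 := by positivity
          linarith
  have hsub : (deviation S Δ k (K * b) : Set (Fin n → Vec K)) ⊆
      ⋃ q ∈ (Finset.univ : Finset (Fin K × Fin K)),
        ({x | k ≤ (unwrapped Δ x).card ∧ 0 ≤ ∑ m ∈ unwrapped Δ x, g q.1 q.2 1 (x m)} ∪
        {x | k ≤ (unwrapped Δ x).card ∧ 0 ≤ ∑ m ∈ unwrapped Δ x, g q.1 q.2 (-1) (x m)}) := by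
    intro x hx
    have hN : 0 < (unwrapped Δ x).card := by exact_mod_cast hk.trans_le hx.1
    obtain ⟨i, j, hij⟩ := exists_entry_of_lt_norm hb.le hN hx.2
    refine Set.mem_biUnion (Finset.mem_coe.mpr (Finset.mem_univ (i, j))) ?_
    set A := ∑ m ∈ unwrapped Δ x,
      (whitenCoord S Δ i (x m) * whitenCoord S Δ j (x m) - (1 : Mat K) i j) with hA
    have hgsum : ∀ σ : ℝ, ∑ m ∈ unwrapped Δ x, g i j σ (x m) =
        s * (σ * A - b * (unwrapped Δ x).card) := by
      intro σ
      simp only [hg]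
      rw [Finset.sum_add_distrib, ← Finset.mul_sum, Finset.sum_const, nsmul_eq_mul, ← hA]
      ring
    rcases lt_abs.mp hij with h' | h'
    · refine Or.inl ⟨hx.1, ?_⟩
      rw [hgsum]
      exact mul_nonneg hs0.le (by linarith)
    · refine Or.inr ⟨hx.1, ?_⟩
      rw [hgsum]
      exact mul_nonneg hs0.le (by linarith)
  refine (measureReal_mono hsub (measure_ne_top _ _)).trans
    ((measureReal_biUnion_finset_le _ _).trans ?_)
  calc _ ≤ ∑ _q : Fin K × Fin K, 2 * Real.exp (-(b ^ 2 / (2 ^ 18 * L) * k)) := by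
        refine Finset.sum_le_sum fun q _ => (measureReal_union_le _ _).trans ?_
        rw [two_mul]
        exact add_le_add (hone _ _ 1 (by simp)) (hone _ _ (-1) (by simp))
    _ = _ := by
        rw [Finset.sum_const, Finset.card_univ, Fintype.card_prod, Fintype.card_fin, nsmul_eq_mul]
        push_cast
        ring

/-- Large deviations: the average squared norm is large. -/
lemma measureReal_deviation_le_of_norm (hΔ : 0 < Δ) (h0 : 0 < cubeProb S Δ) (hβ : 2 ≤ β)
    {s θ k : ℝ} (hs : 0 ≤ s) (hθ : 0 ≤ θ) (hk : 0 < k)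
    (hexp : ∫ x, Real.exp (s * ‖whiten S Δ x‖ ^ 2) ∂(truncLaw S Δ) ≤
      Real.exp (s * (β / 2) - θ)) :
    (sampleLaw n S).real (deviation S Δ k β) ≤ Real.exp (-(θ * k)) := by
  refine (measureReal_mono (fun x hx => ?_) (measure_ne_top _ _)).trans
    (measureReal_sum_nonneg_le hΔ h0
      (g := fun x => s * ‖whiten S Δ x‖ ^ 2 + -(s * (β / 2))) (by fun_prop) hθ ?_)
  · have hN : 0 < (unwrapped Δ x).card := by exact_mod_cast hk.trans_le hx.1
    refine ⟨hx.1, ?_⟩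
    have := le_sum_of_lt_norm hβ hN hx.2
    rw [Finset.sum_add_distrib, ← Finset.mul_sum, Finset.sum_const, nsmul_eq_mul]
    nlinarith
  · simp only [Real.exp_add]
    rw [integral_mul_const]
    calc _ ≤ Real.exp (s * (β / 2) - θ) * Real.exp (-(s * (β / 2))) := by gcongr
      _ = Real.exp (-θ) := by rw [← Real.exp_add]; ring_nf

/-- The exponent in the bound on the sample estimation event. -/
def estExponent (C : ℝ) (K n : ℕ) (Δ τ P β : ℝ) : ℝ :=
  β ^ 2 * ((1 - P) * n) / (2 * C * normBound K Δ τ P)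

/-- In terms of the norm bound, the exponent contains `(1 - P) n`, twice the number of points in the
cube below which the sample estimation event holds anyway. -/
lemma boundSampleEst_eq {C : ℝ} (hC : 0 < C) (hK : 0 < K) (hΔ : 0 < Δ) (hτ : 0 < τ) (h0 : 0 < P)
    (h1 : P < 1) : boundSampleEst C K n Δ τ P β = Real.exp (-estExponent C K n Δ τ P β) +
      Real.exp (-(1 / 2) * (1 - P) ^ 2 * n) := by
  have hα := alpha_pos h0 h1 K
  have hp : 0 < 1 - P := by linarith
  rw [boundSampleEst, estExponent, normBound]
  congr 3
  field_simp
  ring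

/-- The condition on the number of samples says that the exponent is at least `log K`. Thus a factor
polynomial in `K` is absorbed by a larger constant, but for `K = 1` nothing is absorbed. -/
lemma log_le_estExponent {C : ℝ} (hC : 0 < C) (hK : 0 < K) (hΔ : 0 < Δ) (hτ : 0 < τ) (hβ : 0 < β)
    (h0 : 0 < P) (h1 : P < 1)
    (hn : C * (K * Real.log K / (2 * alpha P K)) * (Δ / τ) ^ 2 * (1 / β ^ 2) ≤ n) :
    Real.log K ≤ estExponent C K n Δ τ P β := by
  have hα := alpha_pos h0 h1 K
  have hp : 0 < 1 - P := by linarith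
  rw [estExponent, normBound]
  calc Real.log K = β ^ 2 * ((1 - P) *
        (C * (K * Real.log K / (2 * alpha P K)) * (Δ / τ) ^ 2 * (1 / β ^ 2))) /
          (2 * C * (K * (Δ / τ) ^ 2 * (1 - P) / (4 * alpha P K))) := by field_simp; norm_num
    _ ≤ _ := by gcongr

lemma sampleEst_subset : (sampleEst S Δ P β : Set (Fin n → Vec K)) ⊆
    {x | ((unwrapped Δ x).card : ℝ) < (1 - P) * n / 2} ∪ deviation S Δ ((1 - P) * n / 2) β := by
  intro x hx
  by_cases h : ((unwrapped Δ x).card : ℝ) < (1 - P) * n / 2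
  · exact Or.inl h
  · exact Or.inr ⟨not_lt.mp h, hx.resolve_left h⟩

/-- Small deviations in dimension at least two: the prefactor `2 K²` of the union bound is at most
`K³`, and the sample size condition absorbs it. -/
lemma measureReal_deviation_le_of_two_le {C : ℝ} (hC : 2 ^ 33 ≤ C) (hK : 2 ≤ K) (hn : 0 < n)
    (hΔ : 0 < Δ) (hS : S.PosDef) (h4 : 4 * K ≤ (Δ / τ) ^ 2) (h0 : 0 < P)
    (h1 : P < 1) (h3 : A3 S Δ P) (hβ : 0 < β) (hβ1 : β ≤ 2 ^ 17 * K)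
    (hlog : Real.log K ≤ estExponent C K n Δ τ P β) :
    (sampleLaw n S).real (deviation S Δ ((1 - P) * n / 2) β) ≤
      Real.exp (-estExponent C K n Δ τ P β) := by
  have hp := one_sub_le_cubeProb h3
  have hp0 : 0 < 1 - P := by linarith
  have hc0 : 0 < cubeProb S Δ := by linarith
  have hn' : (0:ℝ) < n := by exact_mod_cast hn
  have hK' : (2:ℝ) ≤ K := by exact_mod_cast hK
  have hK0 : (0:ℝ) < K := by linarith
  have hM := one_le_normBound (by omega) h4 h0 h1
  have hL := momentScale_pos hc0
  have hb := measureReal_deviation_le_of_le (n := n) hΔ (truncCov_posDef hΔ hS hc0) hc0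
    (b := β / K) (k := (1 - P) * n / 2) (by positivity) (by rw [div_le_iff₀ hK0]; exact hβ1)
    (by positivity)
  rw [mul_div_cancel₀ _ hK0.ne'] at hb
  have hML := momentScale_le_normBound hK h4 h0 h1 h3
  set x := estExponent C K n Δ τ P β with hx
  have e1 : 4 * x ≤ (β / K) ^ 2 / (2 ^ 18 * momentScale S Δ) * ((1 - P) * n / 2) := by
    have e2 : (β / K) ^ 2 / (2 ^ 18 * momentScale S Δ) * ((1 - P) * n / 2) =
        β ^ 2 * ((1 - P) * n) / (2 ^ 19 * (K ^ 2 * momentScale S Δ)) := by field_simp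
    have e3 : 4 * x = β ^ 2 * ((1 - P) * n) / (C / 2 * normBound K Δ τ P) := by
      rw [hx, estExponent]; field_simp; norm_num
    rw [e2, e3]
    refine div_le_div_of_nonneg_left (by positivity) (by positivity) ?_
    calc 2 ^ 19 * ((K:ℝ) ^ 2 * momentScale S Δ) ≤ 2 ^ 19 * (2 ^ 13 * normBound K Δ τ P) := by gcongr
      _ = 2 ^ 33 / 2 * normBound K Δ τ P := by ring
      _ ≤ _ := by gcongr
  have e4 : 2 * (K:ℝ) ^ 2 ≤ Real.exp (3 * x) := by
    calc 2 * (K:ℝ) ^ 2 ≤ (K:ℝ) ^ 3 := by nlinarith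
      _ = Real.exp (Real.log K) ^ 3 := by rw [Real.exp_log hK0]
      _ ≤ Real.exp x ^ 3 := by gcongr
      _ = Real.exp (3 * x) := by rw [← Real.exp_nat_mul]; norm_num
  calc _ ≤ 2 * (K:ℝ) ^ 2 * Real.exp (-(4 * x)) := by
        refine hb.trans ?_
        gcongr
    _ ≤ Real.exp (3 * x) * Real.exp (-(4 * x)) := by gcongr
    _ = Real.exp (-x) := by rw [← Real.exp_add]; ring_nf

/-- Large deviations when the cube is not too unlikely. For `β > 2 M` the deviation is impossible,
because the whitened points of the cube have squared norm at most `M`; otherwise `β² / M` is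
at most `2 β`, and the exponential moment of the squared norm suffices. -/
lemma measureReal_deviation_le_of_le_cubeProb {C : ℝ} (hC : 2 ^ 16 ≤ C) (hK : 0 < K) (hn : 0 < n)
    (hΔ : 0 < Δ) (hS : S.PosDef) (hτ : 0 < τ) (h2 : A2 S τ) (h4 : 4 * K ≤ (Δ / τ) ^ 2) (h0 : 0 < P)
    (h1 : P < 1) (h3 : A3 S Δ P) (hβ1 : 2 ^ 17 * K ≤ β) (hc : 1 / 16 ≤ cubeProb S Δ) :
    (sampleLaw n S).real (deviation S Δ ((1 - P) * n / 2) β) ≤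
      Real.exp (-estExponent C K n Δ τ P β) := by
  have hp := one_sub_le_cubeProb h3
  have hp0 : 0 < 1 - P := by linarith
  have hc0 : 0 < cubeProb S Δ := by linarith
  have hn' : (0:ℝ) < n := by exact_mod_cast hn
  have hK1 : (1:ℝ) ≤ K := by exact_mod_cast hK
  have hβ0 : 2 ^ 17 ≤ β := by linarith
  have hM := one_le_normBound (by omega) h4 h0 h1
  set M := normBound K Δ τ P with hMdef
  have hk : 0 < (1 - P) * n / 2 := by positivity
  rcases le_or_gt β (2 * M) with hβM | hβM
  · refine (measureReal_deviation_le_of_norm hΔ hc0 (by linarith) (s := 1 / 2 ^ 13)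
      (θ := β / 2 ^ 15) (by norm_num) (by positivity) hk ?_).trans ?_
    · refine (integral_exp_norm_sq_le hΔ hS hc0 (θ := 1 / 2 ^ 13) ?_).trans ?_
      · have : (1 / 16) ^ 2 ≤ cubeProb S Δ ^ 2 := by gcongr
        linarith
      · have e1 : (cubeProb S Δ)⁻¹ ≤ Real.exp 3 := by
          have : (cubeProb S Δ)⁻¹ ≤ 16 := by
            rw [inv_le_comm₀ hc0 (by norm_num)]; linarith
          have h3 : (2.7:ℝ) ^ 3 ≤ Real.exp 3 := by
            rw [show (3:ℝ) = (3:ℕ) * 1 by norm_num, Real.exp_nat_mul]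
            gcongr
            linarith [Real.exp_one_gt_d9]
          norm_num at h3
          linarith
        have e2 : Real.sqrt 2 ^ K ≤ Real.exp K := by
          rw [show (K:ℝ) = (K:ℕ) * 1 by norm_num, Real.exp_nat_mul]
          gcongr
          have : Real.sqrt 2 ≤ 2 := Real.sqrt_le_iff.mpr ⟨by norm_num, by norm_num⟩
          linarith [Real.exp_one_gt_d9]
        calc _ ≤ Real.exp 3 * Real.exp K := by gcongr
          _ ≤ _ := by
              rw [← Real.exp_add, Real.exp_le_exp]
              linarith
    · refine Real.exp_le_exp.mpr (neg_le_neg ?_)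
      rw [estExponent, ← hMdef, div_le_iff₀ (by positivity)]
      have e : β * ((1 - P) * n) * β ≤ β * ((1 - P) * n) * (2 * M) := by gcongr
      have e2 : β / 2 ^ 15 * ((1 - P) * n / 2) * (2 * 2 ^ 16 * M) ≤
          β / 2 ^ 15 * ((1 - P) * n / 2) * (2 * C * M) := by gcongr
      nlinarith
  · have hempty : (deviation S Δ ((1 - P) * n / 2) β : Set (Fin n → Vec K)) = ∅ := by
      rw [Set.eq_empty_iff_forall_notMem]
      intro x hx
      have hN : 0 < (unwrapped Δ x).card := by exact_mod_cast hk.trans_le hx.1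
      have hN' : (0:ℝ) < (unwrapped Δ x).card := by exact_mod_cast hN
      have h5 := le_sum_of_lt_norm (by linarith) hN hx.2
      have h6 : ∑ m ∈ unwrapped Δ x, ‖whiten S Δ (x m)‖ ^ 2 ≤ (unwrapped Δ x).card * M := by
        rw [← nsmul_eq_mul]
        exact Finset.sum_le_card_nsmul _ _ _ fun m hm =>
          norm_whiten_sq_le hK hΔ hS hτ h2 h0 h1 h3 (mem_unwrapped.mp hm)
      nlinarith
    rw [hempty, measureReal_empty]
    exact (Real.exp_pos _).le

/-- Large deviations when the cube is unlikely. If `β` is very large, the bound comes from the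
slack in Hoeffding's inequality for the number of points in the cube. -/
lemma measureReal_sampleEst_le_of_cubeProb_lt {C : ℝ} (hC : 2 ^ 31 ≤ C) (hK : 2 ≤ K) (hn : 0 < n)
    (hΔ : 0 < Δ) (hε : 0 < ε) (hε1 : ε < 1) (hS : S.PosDef) (hA1 : A1 S Δ ε) (hτ : 0 < τ)
    (h2 : A2 S τ) (hκ : 1 < kappa K ε) (h4 : 4 * K ≤ (Δ / τ) ^ 2) (h0 : 0 < P)
    (h1 : P < 1) (h3 : A3 S Δ P) (hβ1 : 2 ^ 17 * K ≤ β) (hc : cubeProb S Δ < 1 / 16) :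
    (sampleLaw n S).real (sampleEst S Δ P β) ≤ Real.exp (-estExponent C K n Δ τ P β) +
      Real.exp (-(1 / 2) * (1 - P) ^ 2 * n) := by
  have hp := one_sub_le_cubeProb h3
  have hp0 : 0 < 1 - P := by linarith
  have hc0 : 0 < cubeProb S Δ := by linarith
  have hn' : (0:ℝ) < n := by exact_mod_cast hn
  have hK1 : (1:ℝ) ≤ K := by exact_mod_cast (by omega : 1 ≤ K)
  have hβ0 : 2 ^ 17 ≤ β := by linarith
  have hM := one_le_normBound (by omega) h4 h0 h1
  have hpd := truncCov_posDef hΔ hS hc0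
  have hML := momentScale_sq_le_normBound hK hΔ hε hε1 hS hA1 hτ h2 hκ h0 h1 h3
  have hL := momentScale_pos hc0
  set M := normBound K Δ τ P with hMdef
  set L := momentScale S Δ with hLdef
  have hk : 0 < (1 - P) * n / 2 := by positivity
  have hcont : Continuous fun x => ‖whiten S Δ x‖ ^ 2 := by fun_prop
  rcases le_or_gt (4 * K * (1 - P) * L) β with hβL | hβL
  · -- the tilt `s` is chosen so that a deviation raises the sum by `2 (1 - P)` for each point
    set s : ℝ := 4 * K * (1 - P) / β with hs
    have hsβ : s * (β / (2 * K)) = 2 * (1 - P) := by rw [hs]; field_simp; norm_num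
    refine le_trans ?_ (le_add_of_nonneg_left (Real.exp_pos _).le)
    refine (measureReal_mono (fun x hx => ?_) (measure_ne_top _ _)).trans
      (measureReal_card_lt_or_sum_nonneg_le hΔ h1 h3 (by linarith)
        (g := fun x => s * (‖whiten S Δ x‖ ^ 2 / K) + -(2 * (1 - P))) (by fun_prop)
        (fun y => ?_) ?_)
    · rcases sampleEst_subset hx with h | h
      · exact Or.inl h
      · refine Or.inr ?_
        have hN : 0 < (unwrapped Δ x).card := by exact_mod_cast hk.trans_le h.1
        have h5 := le_sum_of_lt_norm (by linarith) hN h.2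
        rw [Finset.sum_add_distrib, ← Finset.mul_sum, Finset.sum_const, nsmul_eq_mul,
          ← Finset.sum_div, ← hsβ]
        have h6 : β / (2 * K) * (unwrapped Δ x).card ≤
            (∑ m ∈ unwrapped Δ x, ‖whiten S Δ (x m)‖ ^ 2) / K := by
          rw [le_div_iff₀ (by positivity)]
          refine le_trans (le_of_eq ?_) h5.le
          field_simp
        have hs0 : 0 ≤ s := by positivity
        nlinarith
    · have : 0 ≤ s * (‖whiten S Δ y‖ ^ 2 / K) := by positivity
      linarith
    · have hsL : s * L ≤ 1 := by
        rw [hs, div_mul_eq_mul_div, div_le_one (by positivity)]; exact hβL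
      have e := integral_exp_norm_le (by omega) hΔ hpd hc0 (s := s) (by positivity) hsL
      simp only [Real.exp_add]
      rw [integral_mul_const]
      calc _ ≤ Real.exp (65 * s) * Real.exp (-(2 * (1 - P))) := by gcongr
        _ ≤ _ := by
            rw [← Real.exp_add, Real.exp_le_exp]
            have : 65 * s ≤ 1 / 10 * (2 * (1 - P)) := by
              rw [hs, ← mul_div_assoc, div_le_iff₀ (by positivity)]
              nlinarith
            linarith
  · refine (measureReal_mono sampleEst_subset (measure_ne_top _ _)).trans
      ((measureReal_union_le _ _).trans ?_)
    rw [add_comm]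
    refine add_le_add ?_ (measureReal_card_unwrapped_lt hΔ h1 h3)
    refine (measureReal_deviation_le_of_norm hΔ hc0 (by linarith) (s := 1 / (K * L))
      (θ := β / (4 * K * L)) (by positivity) (by positivity) hk ?_).trans ?_
    · have e := integral_exp_norm_le (by omega) hΔ hpd hc0 (s := 1 / L) (by positivity)
        (by rw [one_div, inv_mul_cancel₀ hL.ne'])
      have e1 : ∀ x, 1 / (K * L) * ‖whiten S Δ x‖ ^ 2 = 1 / L * (‖whiten S Δ x‖ ^ 2 / K) :=
        fun x => by field_simp
      simp only [e1]
      refine e.trans (Real.exp_le_exp.mpr ?_)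
      have e2 : 1 / (K * L) * (β / 2) - β / (4 * K * L) = β / (4 * K) * (1 / L) := by
        field_simp; norm_num
      rw [e2]
      gcongr
      rw [le_div_iff₀ (by positivity)]
      linarith
    · refine Real.exp_le_exp.mpr (neg_le_neg ?_)
      rw [estExponent, ← hMdef, div_le_iff₀ (by positivity)]
      have e1 : 4 * K * L * β ≤ C * M := by
        calc 4 * K * L * β ≤ 4 * K * L * (4 * K * (1 - P) * L) := by gcongr
          _ = 16 * ((K:ℝ) ^ 2 * L ^ 2 * (1 - P)) := by ring
          _ ≤ 16 * (2 ^ 27 * M) := by gcongr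
          _ = 2 ^ 31 * M := by ring
          _ ≤ C * M := by gcongr
      calc β ^ 2 * ((1 - P) * n) = β / (4 * K * L) * ((1 - P) * n / 2) * (2 * (4 * K * L * β)) := by
            field_simp
        _ ≤ β / (4 * K * L) * ((1 - P) * n / 2) * (2 * (C * M)) := by gcongr
        _ = _ := by ring

end SampleEst

/-! ### Small deviations in dimension one -/

/-- The continuous function supported on `[-h, h]` that is linear on either side of its
maximum `1` at `0`. -/
def tent (h s : ℝ) : ℝ := max 0 (1 - |s| / h)

/-- The odd primitive of `tent h`, a smooth version of the truncation of `s` to `[-h, h]`. -/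
def softClamp (h s : ℝ) : ℝ := ∫ t in (0:ℝ)..s, tent h t

lemma continuous_tent (h : ℝ) : Continuous (tent h) := by unfold tent; fun_prop

lemma tent_nonneg (h s : ℝ) : 0 ≤ tent h s := le_max_left _ _

lemma tent_le_one {h : ℝ} (hh : 0 < h) (s : ℝ) : tent h s ≤ 1 :=
  max_le zero_le_one (by have : 0 ≤ |s| / h := by positivity
                         linarith)

lemma tent_eq_zero {h : ℝ} (hh : 0 < h) {s : ℝ} (hs : h < |s|) : tent h s = 0 := by
  refine max_eq_left ?_
  have : 1 ≤ |s| / h := by rw [le_div_iff₀ hh]; linarith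
  linarith

lemma hasDerivAt_softClamp (h s : ℝ) : HasDerivAt (softClamp h) (tent h s) s :=
  intervalIntegral.integral_hasDerivAt_right ((continuous_tent h).intervalIntegrable _ _)
    ((continuous_tent h).stronglyMeasurableAtFilter _ _) (continuous_tent h).continuousAt

lemma monotone_softClamp (h : ℝ) : Monotone (softClamp h) :=
  monotone_of_hasDerivAt_nonneg (fun s => hasDerivAt_softClamp h s) fun s => tent_nonneg h s

lemma continuous_softClamp (h : ℝ) : Continuous (softClamp h) :=
  continuous_iff_continuousAt.mpr fun s => (hasDerivAt_softClamp h s).continuousAt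

lemma softClamp_neg (h s : ℝ) : softClamp h (-s) = -softClamp h s := by
  unfold softClamp
  have e := intervalIntegral.integral_comp_neg (a := 0) (b := s) (fun t => tent h t)
  simp only [tent, abs_neg, neg_zero] at e ⊢
  rw [intervalIntegral.integral_symm, ← e]

lemma softClamp_zero (h : ℝ) : softClamp h 0 = 0 := by simp [softClamp]

/-- Beyond `h` the soft clamp has reached its final value. -/
lemma le_softClamp {h s : ℝ} (hh : 0 < h) (hs : h ≤ s) : h / 2 ≤ softClamp h s := by
  refine le_trans (le_of_eq ?_) (monotone_softClamp h hs)
  have : softClamp h h = ∫ t in (0:ℝ)..h, (1 - t / h) := by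
    refine intervalIntegral.integral_congr fun t ht => ?_
    rw [Set.uIcc_of_le hh.le] at ht
    have : t / h ≤ 1 := by rw [div_le_one hh]; exact ht.2
    simp only [tent, abs_of_nonneg ht.1]
    exact max_eq_right (by linarith)
  rw [this, intervalIntegral.integral_sub (by simp)
    (Continuous.intervalIntegrable (by fun_prop) _ _),
    intervalIntegral.integral_div]
  simp
  field_simp
  norm_num

lemma mul_softClamp_nonneg (h s : ℝ) : 0 ≤ s * softClamp h s := by
  have h0 := softClamp_zero h
  rcases le_total 0 s with hs | hs
  · have := monotone_softClamp h hs
    exact mul_nonneg hs (by linarith)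
  · have := monotone_softClamp h hs
    exact mul_nonneg_of_nonpos_of_nonpos hs (by linarith)

lemma le_mul_softClamp {h s : ℝ} (hh : 0 < h) (hs : h < |s|) : h ^ 2 / 2 ≤ s * softClamp h s := by
  have key : ∀ r, h < r → h ^ 2 / 2 ≤ r * softClamp h r := fun r hr => by
    have := le_softClamp hh hr.le
    nlinarith
  rcases lt_abs.mp hs with h' | h'
  · exact key s h'
  · have := key _ h'
    rw [softClamp_neg] at this
    linarith

lemma abs_softClamp_le {h : ℝ} (hh : 0 < h) (s : ℝ) : |softClamp h s| ≤ |s| := by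
  have := intervalIntegral.norm_integral_le_of_norm_le_const (a := 0) (b := s) (C := 1)
    (f := tent h) fun t _ => by
      rw [Real.norm_of_nonneg (tent_nonneg h t)]; exact tent_le_one hh t
  simpa [softClamp] using this

/-- Integration by parts against the Gaussian density on a symmetric interval. If `q z² - 1` has
mean zero there, then the boundary term has the favorable sign for increasing functions of `z²`. -/
lemma integral_mul_comp_le {φ ψ : ℝ → ℝ} (hφ : ∀ s, HasDerivAt φ (ψ s) s) (hψ : Continuous ψ)
    (hψ0 : ∀ s, 0 ≤ ψ s) {q ρ : ℝ} (hq : 0 ≤ q) (hρ : 0 ≤ ρ)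
    (h0 : ∫ z in (-ρ)..ρ, (q * z ^ 2 - 1) * Real.exp (-z ^ 2 / 2) = 0) (u : ℝ) :
    ∫ z in (-ρ)..ρ, (q * z ^ 2 - 1) * φ (q * z ^ 2 - 1 + u) * Real.exp (-z ^ 2 / 2) ≤
      2 * q * ∫ z in (-ρ)..ρ, q * z ^ 2 * ψ (q * z ^ 2 - 1 + u) * Real.exp (-z ^ 2 / 2) := by
  have hφc : Continuous φ := continuous_iff_continuousAt.mpr fun s => (hφ s).continuousAt
  have hmono : Monotone φ := monotone_of_hasDerivAt_nonneg hφ hψ0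
  have hg : ∀ z : ℝ, HasDerivAt (fun z : ℝ => Real.exp (-z ^ 2 / 2))
      (-z * Real.exp (-z ^ 2 / 2)) z := fun z => by
    have h1 : HasDerivAt (fun z : ℝ => -z ^ 2 / 2) (-z) z := by
      exact (((hasDerivAt_pow 2 z).fun_neg).div_const 2).congr_deriv (by push_cast; ring)
    convert h1.exp using 1
    ring
  have hF : ∀ z : ℝ, HasDerivAt (fun z => φ (q * z ^ 2 - 1 + u))
      (ψ (q * z ^ 2 - 1 + u) * (2 * q * z)) z := fun z => by
    have h1 : HasDerivAt (fun z : ℝ => q * z ^ 2 - 1 + u) (2 * q * z) z := by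
      exact ((((hasDerivAt_pow 2 z).const_mul q).sub_const 1).add_const u).congr_deriv
        (by push_cast; ring)
    exact (hφ _).comp z h1
  -- the derivative of `z e^{-z²/2}` and of `z φ(q z² - 1 + u) e^{-z²/2}`
  have i1 : ∫ z in (-ρ)..ρ, (1 - z ^ 2) * Real.exp (-z ^ 2 / 2) =
      2 * ρ * Real.exp (-ρ ^ 2 / 2) := by
    rw [intervalIntegral.integral_eq_sub_of_hasDerivAt
      (f := fun z => z * Real.exp (-z ^ 2 / 2))
      (fun z _ => ((hasDerivAt_id z).mul (hg z)).congr_deriv (by simp; ring))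
      (Continuous.intervalIntegrable (by fun_prop) _ _)]
    rw [neg_sq]; ring
  have i2 : ∫ z in (-ρ)..ρ, ((1 - z ^ 2) * φ (q * z ^ 2 - 1 + u) * Real.exp (-z ^ 2 / 2) +
      2 * (q * z ^ 2 * ψ (q * z ^ 2 - 1 + u) * Real.exp (-z ^ 2 / 2))) =
      2 * ρ * φ (q * ρ ^ 2 - 1 + u) * Real.exp (-ρ ^ 2 / 2) := by
    rw [intervalIntegral.integral_eq_sub_of_hasDerivAt
      (f := fun z => z * (φ (q * z ^ 2 - 1 + u) * Real.exp (-z ^ 2 / 2)))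
      (fun z _ => ((hasDerivAt_id z).mul ((hF z).mul (hg z))).congr_deriv (by simp; ring))
      (Continuous.intervalIntegrable (by fun_prop) _ _)]
    rw [neg_sq]; ring
  have c1 : IntervalIntegrable (fun z => (1 - z ^ 2) * φ (q * z ^ 2 - 1 + u) *
    Real.exp (-z ^ 2 / 2)) volume (-ρ) ρ := Continuous.intervalIntegrable (by fun_prop) _ _
  have c2 : IntervalIntegrable (fun z => q * z ^ 2 * ψ (q * z ^ 2 - 1 + u) *
    Real.exp (-z ^ 2 / 2)) volume (-ρ) ρ := Continuous.intervalIntegrable (by fun_prop) _ _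
  have c3 : IntervalIntegrable (fun z => φ (q * z ^ 2 - 1 + u) *
    Real.exp (-z ^ 2 / 2)) volume (-ρ) ρ := Continuous.intervalIntegrable (by fun_prop) _ _
  have c4 : IntervalIntegrable (fun z : ℝ => Real.exp (-z ^ 2 / 2)) volume (-ρ) ρ :=
    Continuous.intervalIntegrable (by fun_prop) _ _
  have c5 : IntervalIntegrable (fun z : ℝ => (1 - z ^ 2) * Real.exp (-z ^ 2 / 2)) volume (-ρ) ρ :=
    Continuous.intervalIntegrable (by fun_prop) _ _
  rw [intervalIntegral.integral_add c1 (c2.const_mul 2), intervalIntegral.integral_const_mul] at i2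
  set A := ∫ z in (-ρ)..ρ, (1 - z ^ 2) * φ (q * z ^ 2 - 1 + u) * Real.exp (-z ^ 2 / 2)
  set B := ∫ z in (-ρ)..ρ, q * z ^ 2 * ψ (q * z ^ 2 - 1 + u) * Real.exp (-z ^ 2 / 2)
  set D := ∫ z in (-ρ)..ρ, φ (q * z ^ 2 - 1 + u) * Real.exp (-z ^ 2 / 2) with hD
  set G := ∫ z in (-ρ)..ρ, Real.exp (-z ^ 2 / 2) with hG
  have e0 : (q - 1) * G - q * (2 * ρ * Real.exp (-ρ ^ 2 / 2)) = 0 := by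
    rw [← h0, ← i1, hG, ← intervalIntegral.integral_const_mul,
      ← intervalIntegral.integral_const_mul,
      ← intervalIntegral.integral_sub (c4.const_mul _) (c5.const_mul _)]
    exact intervalIntegral.integral_congr fun z _ => by ring
  have e1 : ∫ z in (-ρ)..ρ, (q * z ^ 2 - 1) * φ (q * z ^ 2 - 1 + u) * Real.exp (-z ^ 2 / 2) =
      (q - 1) * D - q * A := by
    rw [hD, ← intervalIntegral.integral_const_mul,
      ← intervalIntegral.integral_const_mul,
      ← intervalIntegral.integral_sub (c3.const_mul _) (c1.const_mul _)]
    exact intervalIntegral.integral_congr fun z _ => by ring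
  have hG0 : 0 ≤ G := intervalIntegral.integral_nonneg (by linarith) fun z _ => (Real.exp_pos _).le
  have hDG : D ≤ φ (q * ρ ^ 2 - 1 + u) * G := by
    rw [hD, hG, ← intervalIntegral.integral_const_mul]
    refine intervalIntegral.integral_mono_on (by linarith) c3 (c4.const_mul _) fun z hz => ?_
    have : z ^ 2 ≤ ρ ^ 2 := sq_le_sq' hz.1 hz.2
    have : φ (q * z ^ 2 - 1 + u) ≤ φ (q * ρ ^ 2 - 1 + u) := hmono (by gcongr)
    gcongr
  have hqG : 0 ≤ (q - 1) * G := by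
    have : 0 ≤ q * (2 * ρ * Real.exp (-ρ ^ 2 / 2)) := by positivity
    linarith
  rw [e1]
  have e2 : q * A = φ (q * ρ ^ 2 - 1 + u) * ((q - 1) * G) - 2 * q * B := by
    linear_combination q * i2 - φ (q * ρ ^ 2 - 1 + u) * e0
  rw [e2]
  rcases hG0.eq_or_lt with h | h
  · -- a degenerate interval
    have hρ0 : ρ = 0 := by
      by_contra hne
      have : 0 < G := intervalIntegral.intervalIntegral_pos_of_pos c4 (fun z => Real.exp_pos _)
        (by have := lt_of_le_of_ne hρ (Ne.symm hne); linarith)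
      linarith
    have : D = 0 := by rw [hD, hρ0]; simp
    rw [this, ← h]
    simp
  · have hq1 : 0 ≤ q - 1 := nonneg_of_mul_nonneg_left hqG h
    nlinarith [mul_le_mul_of_nonneg_left hDG hq1]

/-- The one-variable inequality is inherited by sums of independent copies. -/
lemma integral_sum_mul_le {E : Type*} [MeasurableSpace E] {μ : Measure E} [IsProbabilityMeasure μ]
    {a t : E → ℝ} (ham : Measurable a) (htm : Measurable t) {b : ℝ} (hb : ∀ x, |a x| ≤ b)
    (ht : ∀ x, |t x| ≤ b) {φ ψ : ℝ → ℝ} (hφ : Measurable φ) (hψ : Measurable ψ)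
    (hφb : ∀ s, |φ s| ≤ |s|) (hψb : ∀ s, |ψ s| ≤ 1) {B : ℝ}
    (h : ∀ u, ∫ x, a x * φ (a x + u) ∂μ ≤ B * ∫ x, t x * ψ (a x + u) ∂μ) (n : ℕ) :
    ∫ x : Fin n → E, (∑ i, a (x i)) * φ (∑ i, a (x i)) ∂(Measure.pi fun _ => μ) ≤
      B * ∫ x : Fin n → E, (∑ i, t (x i)) * ψ (∑ i, a (x i)) ∂(Measure.pi fun _ => μ) := by
  have hsum : ∀ x : Fin n → E, |∑ i, a (x i)| ≤ n * b := fun x => by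
    refine (Finset.abs_sum_le_sum_abs _ _).trans ?_
    calc _ ≤ ∑ _i : Fin n, b := Finset.sum_le_sum fun i _ => hb _
      _ = n * b := by simp
  have i1 : ∀ i : Fin n, Integrable (fun x : Fin n → E => a (x i) * φ (∑ j, a (x j)))
      (Measure.pi fun _ => μ) := fun i => by
    refine Integrable.of_bound (by fun_prop) (b * (n * b)) (ae_of_all _ fun x => ?_)
    rw [norm_mul]
    exact mul_le_mul (hb _) ((hφb _).trans (hsum x)) (norm_nonneg _)
      ((abs_nonneg _).trans (hb (x i)))
  have i2 : ∀ i : Fin n, Integrable (fun x : Fin n → E => t (x i) * ψ (∑ j, a (x j)))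
      (Measure.pi fun _ => μ) := fun i => by
    refine Integrable.of_bound (by fun_prop) (b * 1) (ae_of_all _ fun x => ?_)
    rw [norm_mul]
    exact mul_le_mul (ht _) (hψb _) (norm_nonneg _) ((abs_nonneg _).trans (ht (x i)))
  simp only [Finset.sum_mul]
  rw [integral_finsetSum _ fun i _ => i1 i, integral_finsetSum _ fun i _ => i2 i, Finset.mul_sum]
  refine Finset.sum_le_sum fun i _ => ?_
  obtain ⟨m, rfl⟩ : ∃ m, n = m + 1 := ⟨n - 1, by have := i.pos; omega⟩
  have hmp := measurePreserving_piFinSuccAbove (fun _ : Fin (m + 1) => μ) i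
  have key : ∀ (f : E → ℝ) (χ : ℝ → ℝ),
      Integrable (fun x : Fin (m + 1) → E => f (x i) * χ (∑ j, a (x j))) (Measure.pi fun _ => μ) →
      Integrable (fun z : E × (Fin m → E) => f z.1 * χ (a z.1 + ∑ j, a (z.2 j)))
        (μ.prod (Measure.pi fun _ => μ)) ∧
      ∫ x : Fin (m + 1) → E, f (x i) * χ (∑ j, a (x j)) ∂(Measure.pi fun _ => μ) =
      ∫ y : Fin m → E, (∫ x, f x * χ (a x + ∑ j, a (y j)) ∂μ) ∂(Measure.pi fun _ => μ) := by
    intro f χ hint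
    have e : (fun x : Fin (m + 1) → E => f (x i) * χ (∑ j, a (x j))) =
        (fun z : E × (Fin m → E) => f z.1 * χ (a z.1 + ∑ j, a (z.2 j))) ∘
          MeasurableEquiv.piFinSuccAbove (fun _ => E) i := by
      funext x
      simp only [Function.comp, Fin.sum_univ_succAbove _ i]
      rfl
    rw [e] at hint ⊢
    have hint' := (hmp.integrable_comp_emb (MeasurableEquiv.measurableEmbedding _)).mp hint
    refine ⟨hint', ?_⟩
    rw [← integral_prod_symm _ hint', ← hmp.integral_comp (MeasurableEquiv.measurableEmbedding _)]
    rfl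
  obtain ⟨j1, e1⟩ := key a φ (i1 i)
  obtain ⟨j2, e2⟩ := key t ψ (i2 i)
  rw [e1, e2, ← integral_const_mul]
  exact integral_mono j1.integral_prod_right (j2.integral_prod_right.const_mul B) fun y => h _

section DimensionOne

variable {n : ℕ} {S : Mat 1} {Δ ε τ P β : ℝ}

/-- In dimension one, integrals over the cube are integrals over an interval. -/
lemma setIntegral_cube_one (hΔ : 0 < Δ) (hS : S.PosDef) {f : ℝ → ℝ} (hf : Continuous f) :
    ∫ x in cube 1 Δ, f (x 0) ∂(multivariateGaussian 0 S) =
      (Real.sqrt (2 * Real.pi))⁻¹ *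
        ∫ z in (-(Δ / 2 / ‖root S (EuclideanSpace.single 0 1)‖))..
          (Δ / 2 / ‖root S (EuclideanSpace.single 0 1)‖),
          f (‖root S (EuclideanSpace.single 0 1)‖ * z) * Real.exp (-z ^ 2 / 2) := by
  have hs : 0 < ‖root S (EuclideanSpace.single (0 : Fin 1) (1:ℝ))‖ :=
    norm_root_pos hS fun h => by simpa using congrArg (fun z : Vec 1 => z 0) h
  set s := ‖root S (EuclideanSpace.single (0 : Fin 1) (1:ℝ))‖ with hsdef
  set ρ := Δ / 2 / s with hρ
  have hρ0 : 0 < ρ := by positivity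
  set I : Set ℝ := Set.Ico (-(Δ / 2)) (Δ / 2) with hI
  have hin : ∀ x : Vec 1, inner ℝ x (EuclideanSpace.single (0 : Fin 1) (1:ℝ)) = x 0 := fun x => by
    rw [EuclideanSpace.inner_single_right]; simp
  have hg : Measurable (I.indicator f) := hf.measurable.indicator measurableSet_Ico
  have e1 : ∫ x in cube 1 Δ, f (x 0) ∂(multivariateGaussian 0 S) =
      ∫ x, I.indicator f (inner ℝ x (EuclideanSpace.single (0 : Fin 1) (1:ℝ)))
        ∂(multivariateGaussian 0 S) := by
    rw [← integral_indicator measurableSet_cube]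
    congr 1; ext x
    rw [hin]
    by_cases hx : x 0 ∈ I
    · rw [Set.indicator_of_mem hx, Set.indicator_of_mem]
      intro k
      rw [Subsingleton.elim k 0]; exact hx
    · rw [Set.indicator_of_notMem hx, Set.indicator_of_notMem]
      exact fun h => hx (h 0)
  have e2 := integral_map (μ := multivariateGaussian 0 S)
    (φ := fun x => inner ℝ x (EuclideanSpace.single (0 : Fin 1) (1:ℝ))) (by fun_prop)
    (f := I.indicator f) hg.aestronglyMeasurable
  have hset : ∀ z, s * z ∈ I ↔ z ∈ Set.Ico (-ρ) ρ := fun z => by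
    rw [hI, hρ, Set.mem_Ico, Set.mem_Ico, neg_le, neg_le (b := z), le_div_iff₀' hs,
      lt_div_iff₀' hs, mul_neg]
  rw [e1, ← e2, map_inner_multivariateGaussian, integral_map (by fun_prop)
    hg.aestronglyMeasurable, integral_gaussianReal_eq_integral_smul one_ne_zero, ← hsdef,
    intervalIntegral.integral_of_le (by linarith), ← integral_Ico_eq_integral_Ioc,
    ← integral_const_mul, ← integral_indicator measurableSet_Ico]
  congr 1; ext z
  by_cases hz : z ∈ Set.Ico (-ρ) ρ
  · rw [Set.indicator_of_mem hz, Set.indicator_of_mem ((hset z).mpr hz)]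
    simp only [gaussianPDFReal, NNReal.coe_one, mul_one, sub_zero, smul_eq_mul]
    ring
  · rw [Set.indicator_of_notMem hz, Set.indicator_of_notMem (fun h => hz ((hset z).mp h)),
      smul_zero]

/-- The whitened coordinate in dimension one, recentered and set to zero outside of the cube. -/
def centeredSq (S : Mat 1) (Δ : ℝ) : Vec 1 → ℝ :=
  (cube 1 Δ).indicator fun x => whitenCoord S Δ 0 x ^ 2 - 1

/-- The square of the whitened coordinate in dimension one, set to zero outside of the cube. -/
def truncSq (S : Mat 1) (Δ : ℝ) : Vec 1 → ℝ :=
  (cube 1 Δ).indicator fun x => whitenCoord S Δ 0 x ^ 2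

/-- For a single sample, `integral_mul_comp_le` bounds the correlation of the recentered square with
an increasing function of it by the integral of the derivative. -/
lemma integral_centeredSq_mul_le (hΔ : 0 < Δ) (hS : S.PosDef) (h0 : 0 < cubeProb S Δ)
    {φ ψ : ℝ → ℝ} (hφ : ∀ s, HasDerivAt φ (ψ s) s) (hψ : Continuous ψ) (hψ0 : ∀ s, 0 ≤ ψ s)
    (u : ℝ) :
    ∫ x, centeredSq S Δ x * φ (centeredSq S Δ x + u) ∂(multivariateGaussian 0 S) ≤
      16 / cubeProb S Δ ^ 2 *
        ∫ x, truncSq S Δ x * ψ (centeredSq S Δ x + u) ∂(multivariateGaussian 0 S) := by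
  have hφc : Continuous φ := continuous_iff_continuousAt.mpr fun s => (hφ s).continuousAt
  have hpd := truncCov_posDef hΔ hS h0
  set e₀ : Vec 1 := EuclideanSpace.single 0 1 with he₀
  set s := ‖root S e₀‖ with hs
  set c := whiten S Δ e₀ 0 with hc
  have hY : ∀ x : Vec 1, whitenCoord S Δ 0 x = c * x 0 := fun x => by
    rw [whitenCoord, inner_whiten_left]
    simp [PiLp.inner_apply, hc, he₀]
  have hwc : whiten S Δ e₀ = c • e₀ := by
    ext k
    rw [Subsingleton.elim k 0]
    simp [hc, he₀]
  set q := (c * s) ^ 2 with hq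
  have hq0 : 0 ≤ q := sq_nonneg _
  have hq8 : q ≤ 8 / cubeProb S Δ ^ 2 := by
    have h := norm_root_whiten_sq_le hΔ hpd h0 e₀
    rw [hwc, map_smul, norm_smul, ← hs, he₀, PiLp.norm_single, norm_one,
      mul_pow, Real.norm_eq_abs, sq_abs, ← mul_pow, ← hq] at h
    rw [le_div_iff₀ (by positivity)]
    linarith
  have hYz : ∀ z, (c * (s * z)) ^ 2 = q * z ^ 2 := fun z => by rw [hq]; ring
  have t1 : ∫ x, centeredSq S Δ x * φ (centeredSq S Δ x + u) ∂(multivariateGaussian 0 S) =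
      ∫ x in cube 1 Δ, (fun y => ((c * y) ^ 2 - 1) * φ ((c * y) ^ 2 - 1 + u)) (x 0)
        ∂(multivariateGaussian 0 S) := by
    rw [← integral_indicator measurableSet_cube]
    congr 1; ext x
    by_cases hx : x ∈ cube 1 Δ <;> simp [centeredSq, hx, hY]
  have t2 : ∫ x, truncSq S Δ x * ψ (centeredSq S Δ x + u) ∂(multivariateGaussian 0 S) =
      ∫ x in cube 1 Δ, (fun y => (c * y) ^ 2 * ψ ((c * y) ^ 2 - 1 + u)) (x 0)
        ∂(multivariateGaussian 0 S) := by
    rw [← integral_indicator measurableSet_cube]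
    congr 1; ext x
    by_cases hx : x ∈ cube 1 Δ <;> simp [centeredSq, truncSq, hx, hY]
  have hπ : 0 < (Real.sqrt (2 * Real.pi))⁻¹ := by positivity
  have t3 := setIntegral_cube_one hΔ hS (f := fun y => (c * y) ^ 2 - 1) (by fun_prop)
  have t4 : ∫ x in cube 1 Δ, (fun y => (c * y) ^ 2 - 1) (x 0) ∂(multivariateGaussian 0 S) = 0 := by
    have h1 := integral_whitenCoord_mul hΔ hpd 0 0
    have hprob := isProbabilityMeasure_truncLaw h0
    have h2 : ∫ x, (whitenCoord S Δ 0 x * whitenCoord S Δ 0 x - 1) ∂(truncLaw S Δ) = 0 := by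
      have := continuous_whitenCoord (S := S) (Δ := Δ) 0
      rw [integral_sub (integrable_truncLaw hΔ (by fun_prop)) (integrable_const _), h1]
      simp
    rw [integral_truncLaw] at h2
    have h3 := (mul_eq_zero.mp h2).resolve_left (inv_ne_zero h0.ne')
    rw [← h3]
    simp only [hY, sq]
  rw [t4] at t3
  have t5 := (mul_eq_zero.mp t3.symm).resolve_left hπ.ne'
  simp only [← he₀, ← hs, hYz] at t5
  have key := integral_mul_comp_le hφ hψ hψ0 hq0 (ρ := Δ / 2 / s) (by positivity) t5 u
  rw [t1, t2, setIntegral_cube_one hΔ hS (f := fun y => ((c * y) ^ 2 - 1) * φ ((c * y) ^ 2 - 1 + u))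
      (by fun_prop), setIntegral_cube_one hΔ hS
      (f := fun y => (c * y) ^ 2 * ψ ((c * y) ^ 2 - 1 + u)) (by fun_prop)]
  simp only [← he₀, ← hs, hYz]
  set J := ∫ z in (-(Δ / 2 / s))..(Δ / 2 / s),
    q * z ^ 2 * ψ (q * z ^ 2 - 1 + u) * Real.exp (-z ^ 2 / 2) with hJ
  have hJ0 : 0 ≤ J := by
    have : 0 ≤ Δ / 2 / s := by positivity
    refine intervalIntegral.integral_nonneg (by linarith) fun z _ => ?_
    have := hψ0 (q * z ^ 2 - 1 + u)
    positivity
  calc _ ≤ (Real.sqrt (2 * Real.pi))⁻¹ * (2 * q * J) := by gcongr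
    _ ≤ (Real.sqrt (2 * Real.pi))⁻¹ * (2 * (8 / cubeProb S Δ ^ 2) * J) := by gcongr
    _ = _ := by ring

/-- The sum of the recentered squares is not too unlikely to be small. -/
lemma le_measureReal_abs_sum_le (hΔ : 0 < Δ) (hS : S.PosDef) (hc : 1 / 4 ≤ cubeProb S Δ) {h : ℝ}
    (hh : 0 < h) : h ^ 2 / (1024 * (n + h)) *
      (1 - (sampleLaw n S).real {x | |∑ m, centeredSq S Δ (x m)| ≤ h}) ≤
        (sampleLaw n S).real {x | |∑ m, centeredSq S Δ (x m)| ≤ h} := by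
  have h0 : 0 < cubeProb S Δ := by linarith
  have hcont := continuous_whitenCoord (S := S) (Δ := Δ) 0
  have ham : Measurable (centeredSq S Δ) :=
    Measurable.indicator (by fun_prop) measurableSet_cube
  have htm : Measurable (truncSq S Δ) :=
    Measurable.indicator (by fun_prop) measurableSet_cube
  obtain ⟨b, hb⟩ := (isCompact_closedBall (0 : Vec 1)
    (Real.sqrt (1:ℕ) * (Δ / 2))).exists_bound_of_continuousOn
    (f := fun x => whitenCoord S Δ 0 x ^ 2) (by fun_prop)
  have htb : ∀ x, 0 ≤ truncSq S Δ x ∧ truncSq S Δ x ≤ |b| := fun x => by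
    by_cases hx : x ∈ cube 1 Δ
    · simp only [truncSq, Set.indicator_of_mem hx]
      have h1 := hb x (by simpa using norm_le_of_mem_cube hΔ hx)
      rw [Real.norm_of_nonneg (sq_nonneg _)] at h1
      exact ⟨sq_nonneg _, h1.trans (le_abs_self b)⟩
    · simp only [truncSq, Set.indicator_of_notMem hx]
      exact ⟨le_rfl, abs_nonneg b⟩
  have hta : ∀ x, truncSq S Δ x ≤ centeredSq S Δ x + 1 ∧ centeredSq S Δ x ≤ truncSq S Δ x :=
      fun x => by
    by_cases hx : x ∈ cube 1 Δ <;> simp [centeredSq, truncSq, hx]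
  set U : (Fin n → Vec 1) → ℝ := fun x => ∑ m, centeredSq S Δ (x m) with hU
  have hUm : Measurable U := by fun_prop
  have hAm : MeasurableSet {x | |U x| ≤ h} := measurableSet_le (by fun_prop) (by fun_prop)
  have hub : ∀ x : Fin n → Vec 1, |U x| ≤ n * (|b| + 1) := fun x => by
    refine (Finset.abs_sum_le_sum_abs _ _).trans ?_
    calc _ ≤ ∑ _i : Fin n, (|b| + 1) := Finset.sum_le_sum fun i _ => by
          have h1 := htb (x i)
          have h2 := hta (x i)
          exact abs_le.mpr ⟨by linarith, by linarith⟩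
      _ = _ := by rw [Finset.sum_const, Finset.card_univ, Fintype.card_fin, nsmul_eq_mul]
  have hfin : ∀ x, |truncSq S Δ x| ≤ |b| + 1 := fun x => by
    rw [abs_of_nonneg (htb x).1]; linarith [(htb x).2]
  have main := integral_sum_mul_le (μ := multivariateGaussian 0 S) ham htm (b := |b| + 1)
    (fun x => abs_le.mpr ⟨by linarith [(htb x).1, (hta x).1, abs_nonneg b],
      by linarith [(htb x).2, (hta x).2]⟩) hfin
    (continuous_softClamp h).measurable (continuous_tent h).measurable
    (abs_softClamp_le hh) (fun s => by rw [abs_of_nonneg (tent_nonneg h s)]; exact tent_le_one hh s)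
    (integral_centeredSq_mul_le hΔ hS h0 (hasDerivAt_softClamp h) (continuous_tent h)
      (tent_nonneg h)) n
  set p := (sampleLaw n S).real {x | |U x| ≤ h} with hp
  have hsc := (continuous_softClamp h).measurable
  have htent := (continuous_tent h).measurable
  have i1 : Integrable (fun x => U x * softClamp h (U x)) (sampleLaw n S) := by
    refine Integrable.of_bound (by fun_prop) (n * (|b| + 1) * (n * (|b| + 1)))
      (ae_of_all _ fun x => ?_)
    rw [norm_mul]
    exact mul_le_mul (hub x) ((abs_softClamp_le hh _).trans (hub x)) (norm_nonneg _)
      ((abs_nonneg _).trans (hub x))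
  -- the left side is at least `h² / 2` where the sum is large
  have low : h ^ 2 / 2 * (1 - p) ≤ ∫ x, U x * softClamp h (U x) ∂(sampleLaw n S) := by
    have e : 1 - p = (sampleLaw n S).real {x | |U x| ≤ h}ᶜ := by
      rw [probReal_compl_eq_one_sub hAm]
    rw [e, mul_comm, ← smul_eq_mul, ← integral_indicator_const _ hAm.compl]
    refine integral_mono ((integrable_const _).indicator hAm.compl) i1 fun x => ?_
    by_cases hx : x ∈ {x | |U x| ≤ h}ᶜ
    · rw [Set.indicator_of_mem hx]
      exact le_mul_softClamp hh (not_le.mp hx)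
    · rw [Set.indicator_of_notMem hx]
      exact mul_softClamp_nonneg h _
  -- the right side lives on the event that the sum is small
  have up : ∫ x : Fin n → Vec 1, (∑ i, truncSq S Δ (x i)) * tent h (U x) ∂(sampleLaw n S) ≤
      (n + h) * p := by
    rw [mul_comm, ← smul_eq_mul, hp, ← integral_indicator_const _ hAm]
    refine integral_mono_of_nonneg (ae_of_all _ fun x => ?_)
      ((integrable_const _).indicator hAm) (ae_of_all _ fun x => ?_)
    · exact mul_nonneg (Finset.sum_nonneg fun i _ => (htb _).1) (tent_nonneg h _)
    · have hT : ∑ i, truncSq S Δ (x i) ≤ U x + n := by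
        calc _ ≤ ∑ i, (centeredSq S Δ (x i) + 1) := Finset.sum_le_sum fun i _ => (hta _).1
          _ = _ := by simp [Finset.sum_add_distrib, hU]
      by_cases hx : x ∈ {x | |U x| ≤ h}
      · simp only
        rw [Set.indicator_of_mem hx]
        have h1 : U x ≤ h := (le_abs_self _).trans hx
        calc _ ≤ (∑ i, truncSq S Δ (x i)) * 1 := by
              gcongr
              · exact Finset.sum_nonneg fun i _ => (htb _).1
              · exact tent_le_one hh _
          _ ≤ _ := by linarith
      · simp only
        rw [Set.indicator_of_notMem hx, tent_eq_zero hh (not_le.mp hx), mul_zero]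
  have hc' : 16 / cubeProb S Δ ^ 2 ≤ 256 := by
    rw [div_le_iff₀ (by positivity)]
    nlinarith
  have hp0 : 0 ≤ p := measureReal_nonneg
  have hup0 : 0 ≤ ∫ x : Fin n → Vec 1, (∑ i, truncSq S Δ (x i)) * tent h (U x) ∂(sampleLaw n S) :=
    integral_nonneg fun x =>
      mul_nonneg (Finset.sum_nonneg fun i _ => (htb _).1) (tent_nonneg h _)
  have fin : h ^ 2 / 2 * (1 - p) ≤ 256 * ((n + h) * p) :=
    (low.trans main).trans (mul_le_mul hc' up hup0 (by norm_num))
  have hnh : 0 < n + h := by positivity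
  have : p = 1024 * (n + h) * p / (1024 * (n + h)) := by field_simp
  rw [this, div_mul_eq_mul_div]
  gcongr ?_ / _
  nlinarith

/-- Small deviations in dimension one. If the expected number of points in the cube is too small
for a concentration inequality to beat its prefactor `2`, then anticoncentration replaces it. -/
lemma measureReal_deviation_le_of_dim_one {C : ℝ} (hC : 2 ^ 42 ≤ C) (hn : 0 < n) (hΔ : 0 < Δ)
    (hε : 0 < ε) (hε1 : ε < 1) (hS : S.PosDef) (hA1 : A1 S Δ ε) (hκ : 1 < kappa 1 ε)
    (h4 : 4 * (1:ℕ) ≤ (Δ / τ) ^ 2) (h0 : 0 < P) (h1 : P < 1) (h3 : A3 S Δ P) (hβ : 0 < β)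
    (hβ1 : β ≤ 2 ^ 17) :
    (sampleLaw n S).real (deviation S Δ ((1 - P) * n / 2) β) ≤
      Real.exp (-estExponent C 1 n Δ τ P β) := by
  have hp := one_sub_le_cubeProb h3
  have hp0 : 0 < 1 - P := by linarith
  have hp1 : 1 - P ≤ 1 := by linarith
  have hc := one_fourth_le_cubeProb hΔ hε hε1 hS hA1 hκ
  have hc0 : 0 < cubeProb S Δ := by linarith
  have hn' : (0:ℝ) < n := by exact_mod_cast hn
  have hM := one_le_normBound one_pos h4 h0 h1
  have hM2 := sq_le_pow_mul_normBound h4 h0 h1 (j := 2) (by norm_num) (by norm_num)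
  set M := normBound 1 Δ τ P with hMdef
  set x := estExponent C 1 n Δ τ P β with hx
  set k := (1 - P) * n / 2 with hk
  have hk0 : 0 < k := by positivity
  have hL : momentScale S Δ ≤ 2 ^ 15 := by
    have h1 : (1 / 2 : ℝ) ≤ Real.sqrt (cubeProb S Δ) := by
      refine Real.le_sqrt_of_sq_le ?_; linarith
    have h2 : (Real.sqrt (cubeProb S Δ))⁻¹ ≤ 2 := by
      rw [inv_le_comm₀ (by linarith) (by norm_num)]; linarith
    have h3 : 0 ≤ (Real.sqrt (cubeProb S Δ))⁻¹ := by positivity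
    calc momentScale S Δ ≤ 2 ^ 10 * 2 ^ 5 := by unfold momentScale; gcongr
      _ = 2 ^ 15 := by norm_num
  have hL0 := momentScale_pos hc0
  rcases le_or_gt (2 ^ 34) ((1 - P) * n * β ^ 2) with hbig | hsmall
  · -- the concentration inequality has an exponent `w ≥ 1`, at least four times the required one
    have hb := measureReal_deviation_le_of_le (n := n) hΔ (truncCov_posDef hΔ hS hc0) hc0 hβ hβ1 hk0
    simp only [Nat.cast_one, one_mul, one_pow, mul_one] at hb
    set w := (1 - P) * n * β ^ 2 / 2 ^ 34 with hw
    have hw1 : 1 ≤ w := by rw [hw, le_div_iff₀ (by norm_num)]; linarith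
    have e1 : w ≤ β ^ 2 / (2 ^ 18 * momentScale S Δ) * k := by
      calc w = β ^ 2 / (2 ^ 18 * 2 ^ 15) * k := by rw [hw, hk]; ring
        _ ≤ _ := by gcongr
    have e2 : x ≤ w / 4 := by
      rw [hx, estExponent, ← hMdef, div_le_iff₀ (by positivity), hw]
      have : 2 ^ 42 * 1 ≤ C * M := by gcongr
      have h5 : 0 ≤ (1 - P) * n * β ^ 2 := by positivity
      nlinarith
    have e3 : (2:ℝ) ≤ Real.exp (3 / 4 * w) := by
      have h1 := Real.quadratic_le_exp_of_nonneg (x := 3 / 4 * w) (by positivity)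
      nlinarith
    calc _ ≤ 2 * Real.exp (-w) := by
          refine hb.trans ?_
          gcongr
      _ ≤ Real.exp (3 / 4 * w) * Real.exp (-w) := by gcongr
      _ ≤ _ := by
          rw [← Real.exp_add, Real.exp_le_exp]
          linarith
  · -- the required exponent `x` is at most the probability `q` that there is no deviation, and
    -- `1 - x ≤ exp (-x)`
    have hh : 0 < β * k := by positivity
    have hq := le_measureReal_abs_sum_le (n := n) hΔ hS hc hh
    set A : Set (Fin n → Vec 1) := {x | |∑ m, centeredSq S Δ (x m)| ≤ β * k} with hA
    have hAm : MeasurableSet A := by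
      have hcont := continuous_whitenCoord (S := S) (Δ := Δ) 0
      have ham : Measurable (centeredSq S Δ) :=
        Measurable.indicator (by fun_prop) measurableSet_cube
      exact measurableSet_le (by fun_prop) (by fun_prop)
    have hsub : deviation S Δ k β ⊆ Aᶜ := by
      intro y hy
      have hN : 0 < (unwrapped Δ y).card := by exact_mod_cast hk0.trans_le hy.1
      obtain ⟨i, j, hij⟩ := exists_entry_of_lt_norm hβ.le hN
        (by rw [Nat.cast_one, one_mul]; exact hy.2)
      rw [Subsingleton.elim i 0, Subsingleton.elim j 0] at hij
      refine not_le.mpr (lt_of_le_of_lt (mul_le_mul_of_nonneg_left hy.1 hβ.le)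
        (hij.trans_eq ?_))
      congr 1
      rw [unwrapped, Finset.sum_filter]
      refine Finset.sum_congr rfl fun m _ => ?_
      rw [centeredSq, Matrix.one_apply_eq, ← sq]
      by_cases hm : y m ∈ cube 1 Δ <;> simp [hm]
    set q := (sampleLaw n S).real A with hqdef
    have hq1 : q ≤ 1 := measureReal_le_one
    have hr : β ^ 2 * (1 - P) ^ 2 * n / 2 ^ 36 ≤ (β * k) ^ 2 / (1024 * (n + β * k)) := by
      rw [div_le_div_iff₀ (by positivity) (by positivity)]
      have e1 : β * k ≤ 2 ^ 16 * n := by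
        calc β * k ≤ 2 ^ 17 * (1 * n / 2) := by rw [hk]; gcongr
          _ = _ := by ring
      have e2 : (β * k) ^ 2 * 2 ^ 36 = β ^ 2 * (1 - P) ^ 2 * n * (2 ^ 34 * n) := by rw [hk]; ring
      rw [e2]
      exact mul_le_mul_of_nonneg_left (by linarith) (by positivity)
    have hr1 : β ^ 2 * (1 - P) ^ 2 * n / 2 ^ 36 ≤ 1 := by
      rw [div_le_one (by norm_num)]
      have : (1 - P) * n * β ^ 2 * (1 - P) ≤ 2 ^ 34 * 1 := by gcongr
      linarith
    set r := β ^ 2 * (1 - P) ^ 2 * n / 2 ^ 36 with hrdef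
    have hr0 : 0 ≤ r := by positivity
    have hqr : r / 2 ≤ q := by
      have : r * (1 - q) ≤ q := le_trans (by gcongr) hq
      nlinarith
    have hxr : x ≤ r / 2 := by
      rw [hx, estExponent, ← hMdef, div_le_iff₀ (by positivity), hrdef]
      have h5 : (1:ℝ) ≤ 8 * (1 - P) * M := by
        simp only [Nat.cast_one, one_pow] at hM2
        have h5 : (1 - P) ^ 2 ≤ 1 - P := by nlinarith
        exact hM2.trans (by gcongr)
      have h6 : 2 ^ 42 * ((1 - P) * M) ≤ C * ((1 - P) * M) := by gcongr
      have h7 : 2 ^ 36 ≤ C * ((1 - P) * M) := by linarith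
      calc β ^ 2 * ((1 - P) * n) = β ^ 2 * ((1 - P) * n) / 2 ^ 36 * 2 ^ 36 := by ring
        _ ≤ β ^ 2 * ((1 - P) * n) / 2 ^ 36 * (C * ((1 - P) * M)) := by gcongr
        _ = _ := by ring
    calc _ ≤ (sampleLaw n S).real Aᶜ := measureReal_mono hsub (measure_ne_top _ _)
      _ = 1 - q := probReal_compl_eq_one_sub hAm
      _ ≤ 1 - x := by linarith
      _ ≤ _ := by linarith [Real.add_one_le_exp (-x)]

end DimensionOne

/-! ### The bound on the sample estimation event -/

section SampleEstBound

variable {K n : ℕ} {S : Mat K} {Δ ε τ P β : ℝ}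

/-- Hoeffding's inequality takes care of the case of few points in the cube. -/
lemma sampleEst_le_of_deviation_le {C : ℝ} (hΔ : 0 < Δ) (h1 : P < 1) (h3 : A3 S Δ P)
    (h : (sampleLaw n S).real (deviation S Δ ((1 - P) * n / 2) β) ≤
      Real.exp (-estExponent C K n Δ τ P β)) :
    (sampleLaw n S).real (sampleEst S Δ P β) ≤ Real.exp (-estExponent C K n Δ τ P β) +
      Real.exp (-(1 / 2) * (1 - P) ^ 2 * n) := by
  rw [add_comm]
  exact (measureReal_mono sampleEst_subset (measure_ne_top _ _)).trans
    ((measureReal_union_le _ _).trans (add_le_add (measureReal_card_unwrapped_lt hΔ h1 h3) h))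

/-- The cases are small `β` in dimension one, small `β` in higher dimension, large `β` with a likely
cube, and large `β` with an unlikely cube. In the last case the dimension is at least two, by
`one_fourth_le_cubeProb`. -/
lemma sampleEst_le {C : ℝ} (hC : 2 ^ 42 ≤ C) (hK : 0 < K) (hn : 0 < n) (hΔ : 0 < Δ) (hε : 0 < ε)
    (hε1 : ε < 1) (hS : S.PosDef) (hA1 : A1 S Δ ε) (hτ : 0 < τ) (h2 : A2 S τ)
    (hκ : 1 < kappa K ε) (h0 : 0 < P) (h1 : P < 1) (h3 : A3 S Δ P) (hβ : 0 < β)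
    (hsize : C * (K * Real.log K / (2 * alpha P K)) * (Δ / τ) ^ 2 * (1 / β ^ 2) ≤ n) :
    (sampleLaw n S).real (sampleEst S Δ P β) ≤ boundSampleEst C K n Δ τ P β := by
  have hC0 : 0 < C := by linarith
  have hpack := two_mul_sqrt_mul_kappa_mul_le hK hΔ hε hε1 hS hA1 hτ h2 (by linarith)
  have h4 := four_mul_le_sq_div hτ hκ hpack
  have hlog := log_le_estExponent hC0 hK hΔ hτ hβ h0 h1 hsize
  rw [boundSampleEst_eq hC0 hK hΔ hτ h0 h1]
  rcases le_or_gt β (2 ^ 17 * K) with hβ1 | hβ1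
  · refine sampleEst_le_of_deviation_le hΔ h1 h3 ?_
    rcases (Nat.succ_le_of_lt hK).eq_or_lt with h | h
    · obtain rfl : K = 1 := h.symm
      exact measureReal_deviation_le_of_dim_one hC hn hΔ hε hε1 hS hA1 hκ h4 h0 h1 h3 hβ
        (by simpa using hβ1)
    · exact measureReal_deviation_le_of_two_le (by linarith) h hn hΔ hS h4 h0 h1 h3 hβ hβ1 hlog
  · rcases le_or_gt (1 / 16) (cubeProb S Δ) with hc | hc
    · exact sampleEst_le_of_deviation_le hΔ h1 h3 (measureReal_deviation_le_of_le_cubeProb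
        (by linarith) hK hn hΔ hS hτ h2 h4 h0 h1 h3 hβ1.le hc)
    · have hK2 : 2 ≤ K := by
        by_contra! hlt
        obtain rfl : K = 1 := by omega
        have := one_fourth_le_cubeProb hΔ hε hε1 hS hA1 hκ
        linarith
      exact measureReal_sampleEst_le_of_cubeProb_lt (by linarith) hK2 hn hΔ hε hε1 hS hA1 hτ h2
        hκ h4 h0 h1 h3 hβ1.le hc

/-- For small `β` the sample size condition gives at least as many points as `K²`. -/
lemma sq_le_of_sample_size {C : ℝ} (hC : 1 ≤ C) (hK : 0 < K) (hn : 0 < n)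
    (h4 : 4 * K ≤ (Δ / τ) ^ 2) (h0 : 0 < P) (h1 : P < 1) (hβ : 0 < β) (hβ1 : β < 1)
    (hsize : C * (K * Real.log K / (2 * alpha P K)) * (Δ / τ) ^ 2 * (1 / β ^ 2) ≤ n) :
    K ^ 2 ≤ n := by
  rcases (Nat.succ_le_of_lt hK).eq_or_lt with h | h
  · obtain rfl : K = 1 := h.symm
    rwa [one_pow]
  · have hα := alpha_pos h0 h1 K
    have hα1 : alpha P K ≤ 1 := (alpha_le h0 h1 K).trans (by linarith)
    have hK2 : (2:ℝ) ≤ K := by exact_mod_cast h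
    have hlog : 1 / 2 ≤ Real.log K := by
      have := Real.log_le_log (by norm_num) hK2
      linarith [Real.log_two_gt_d9]
    have e1 : (1:ℝ) ≤ 1 / β ^ 2 := by
      rw [le_div_iff₀ (by positivity), one_mul]
      exact pow_le_one₀ hβ.le hβ1.le
    have e2 : (K:ℝ) * (1 / 2) / (2 * 1) ≤ K * Real.log K / (2 * alpha P K) := by gcongr
    have : (K:ℝ) ^ 2 ≤ n := by
      calc (K:ℝ) ^ 2 = 1 * (K * (1 / 2) / (2 * 1)) * (4 * K) * 1 := by ring
        _ ≤ C * (K * Real.log K / (2 * alpha P K)) * (Δ / τ) ^ 2 * (1 / β ^ 2) := by gcongr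
        _ ≤ n := hsize
    exact_mod_cast this

end SampleEstBound

/-! ### The guarantee -/

section Guarantee

variable {K n : ℕ} {S : Mat K} {Δ ε τ P η β d βbar : ℝ}

/-- The estimate is accurate outside of the four bad events. -/
lemma one_sub_le_accurate (hK : 0 < K) (hnK : K ^ 2 ≤ n) (hΔ : 0 < Δ) (hd : 0 < d) (hS : S.PosDef)
    (hτ : 0 < τ) (h2 : A2 S τ) (h0 : 0 < P) (h1 : P < 1) (h3 : A3 S Δ P) (hβ : 0 < β)
    (hM : 1 ≤ normBound K Δ τ P)
    (hb : βbar = β + 2 * K * (Δ / τ) ^ 2 / (alpha P K * Real.sqrt n)) {N : Finset (Vec K)}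
    (hN : IsCover (d / 4) (ellipsoid S n ∩ cube K Δ) N) {Ω : Type*} [MeasurableSpace Ω]
    (μ : Measure Ω) [IsProbabilityMeasure μ] (X : Fin n → Ω → Vec K) :
    1 - (μ.real {ω | (fun i => X i ω) ∈ falsePositive Δ d} +
          μ.real {ω | (fun i => X i ω) ∈ sampleEst S Δ P β} +
          μ.real {ω | (fun i => X i ω) ∈ manyEscapees S} +
          μ.real {ω | (fun i => X i ω) ∈ missCover Δ d N}) ≤
      μ.real {ω | (fun i => X i ω) ∈ accurate S Δ d βbar} := by
  have hcover : (Set.univ : Set Ω) ⊆ (((({ω | (fun i => X i ω) ∈ falsePositive Δ d} ∪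
      {ω | (fun i => X i ω) ∈ sampleEst S Δ P β}) ∪ {ω | (fun i => X i ω) ∈ manyEscapees S}) ∪
      {ω | (fun i => X i ω) ∈ missCover Δ d N}) ∪
          {ω | (fun i => X i ω) ∈ accurate S Δ d βbar}) := by
    intro ω _
    by_contra hcon
    simp only [Set.mem_union, not_or] at hcon
    obtain ⟨⟨⟨⟨ha, hb'⟩, hc⟩, hd'⟩, he⟩ := hcon
    exact he (mem_accurate hK hnK hΔ hd hS hτ h2 h0 h1 h3 hβ hM hb hN ha hb' hc hd')
  have h := measureReal_mono (μ := μ) hcover (measure_ne_top _ _)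
  rw [probReal_univ] at h
  have u1 := measureReal_union_le (μ := μ) {ω | (fun i => X i ω) ∈ falsePositive Δ d}
    {ω | (fun i => X i ω) ∈ sampleEst S Δ P β}
  have u2 := measureReal_union_le (μ := μ) ({ω | (fun i => X i ω) ∈ falsePositive Δ d} ∪
    {ω | (fun i => X i ω) ∈ sampleEst S Δ P β}) {ω | (fun i => X i ω) ∈ manyEscapees S}
  have u3 := measureReal_union_le (μ := μ) (({ω | (fun i => X i ω) ∈ falsePositive Δ d} ∪
    {ω | (fun i => X i ω) ∈ sampleEst S Δ P β}) ∪ {ω | (fun i => X i ω) ∈ manyEscapees S})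
    {ω | (fun i => X i ω) ∈ missCover Δ d N}
  have u4 := h.trans (measureReal_union_le (μ := μ) _ _)
  linarith

end Guarantee

end BlindUnwrap

end

theorem theorem2 :
    ∃ C : ℝ, 0 < C ∧
      ∀ (K n : ℕ) (S : BlindUnwrap.Mat K) (Δ ε τ P η β d βbar : ℝ),
        0 < K → 0 < n → 0 < Δ → 0 < ε → ε < 1 → 0 < τ → 0 < P → P < 1 → 0 < β →
        S.PosDef →
        BlindUnwrap.A1 S Δ ε → BlindUnwrap.A2 S τ → BlindUnwrap.A3 S Δ P →
        1 < BlindUnwrap.kappa K ε →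
        0 < η → η < 1 - 1 / BlindUnwrap.kappa K ε →
        d = 2 * η * Real.sqrt K * τ * BlindUnwrap.kappa K ε →
        βbar = β + 2 * K * (Δ / τ) ^ 2 / (BlindUnwrap.alpha P K * Real.sqrt n) →
        C * (K * Real.log K / (2 * BlindUnwrap.alpha P K)) * (Δ / τ) ^ 2 * (1 / β ^ 2) ≤ n →
        ∀ (Ω : Type*) [MeasurableSpace Ω] (μ : MeasureTheory.Measure Ω)
          [MeasureTheory.IsProbabilityMeasure μ] (X : Fin n → Ω → BlindUnwrap.Vec K),
          ProbabilityTheory.iIndepFun X μ →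
          (∀ i, ProbabilityTheory.HasLaw (X i) (ProbabilityTheory.multivariateGaussian 0 S) μ) →
          -- the explicit guarantee
          1 - (BlindUnwrap.boundFalsePositive K n ε η +
                BlindUnwrap.boundSampleEst C K n Δ τ P β +
                BlindUnwrap.boundManyEscapees n +
                BlindUnwrap.boundMissCover S n Δ τ ε η) ≤
            μ.real {ω | (fun i => X i ω) ∈ BlindUnwrap.accurate S Δ d βbar} ∧
          -- the bounds on the four bad events
          μ.real {ω | (fun i => X i ω) ∈ BlindUnwrap.falsePositive Δ d} ≤
            BlindUnwrap.boundFalsePositive K n ε η ∧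
          μ.real {ω | (fun i => X i ω) ∈ BlindUnwrap.manyEscapees S} ≤
            BlindUnwrap.boundManyEscapees n ∧
          μ.real {ω | (fun i => X i ω) ∈ BlindUnwrap.sampleEst S Δ P β} ≤
            BlindUnwrap.boundSampleEst C K n Δ τ P β ∧
          ∀ N : Finset (BlindUnwrap.Vec K),
            BlindUnwrap.IsMinCover (d / 4)
              (BlindUnwrap.ellipsoid S n ∩ BlindUnwrap.cube K Δ) N →
            μ.real {ω | (fun i => X i ω) ∈ BlindUnwrap.missCover Δ d N} ≤
              BlindUnwrap.boundMissCover S n Δ τ ε η ∧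
            -- the guarantee in terms of the probabilities of the bad events
            (β < 1 →
              1 - (μ.real {ω | (fun i => X i ω) ∈ BlindUnwrap.falsePositive Δ d} +
                    μ.real {ω | (fun i => X i ω) ∈ BlindUnwrap.sampleEst S Δ P β} +
                    μ.real {ω | (fun i => X i ω) ∈ BlindUnwrap.manyEscapees S} +
                    μ.real {ω | (fun i => X i ω) ∈ BlindUnwrap.missCover Δ d N}) ≤
                μ.real {ω | (fun i => X i ω) ∈ BlindUnwrap.accurate S Δ d βbar}) := by
  refine ⟨2 ^ 42, by norm_num, ?_⟩
  intro K n S Δ ε τ P η β d βbar hK hn hΔ hε hε1 hτ hP0 hP1 hβ hS h1 h2 h3 hκ hη hηκ hd hb hsize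
    Ω _ μ _ X hX hlaw
  have hκ0 : 0 < BlindUnwrap.kappa K ε := by linarith
  have hη1 : η < 1 := by
    have : 0 < 1 / BlindUnwrap.kappa K ε := by positivity
    linarith
  have hd0 : 0 < d := by
    have : (0:ℝ) < K := by exact_mod_cast hK
    rw [hd]; positivity
  have hpack := BlindUnwrap.two_mul_sqrt_mul_kappa_mul_le hK hΔ hε hε1 hS h1 hτ h2 hκ0.le
  have h4 := BlindUnwrap.four_mul_le_sq_div hτ hκ hpack
  have hM := BlindUnwrap.one_le_normBound hK h4 hP0 hP1
  have bfp := (BlindUnwrap.measureReal_le_sampleLaw hX hlaw _).trans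
    (BlindUnwrap.falsePositive_le hK hΔ hε hε1 hS h1 hτ h2 hκ hηκ hd)
  have bme := (BlindUnwrap.measureReal_le_sampleLaw hX hlaw _).trans
    (BlindUnwrap.manyEscapees_le hK hn hS)
  have bse := (BlindUnwrap.measureReal_le_sampleLaw hX hlaw _).trans
    (BlindUnwrap.sampleEst_le le_rfl hK hn hΔ hε hε1 hS h1 hτ h2 hκ hP0 hP1 h3 hβ hsize)
  have bmc : ∀ N : Finset (BlindUnwrap.Vec K), BlindUnwrap.IsMinCover (d / 4)
      (BlindUnwrap.ellipsoid S n ∩ BlindUnwrap.cube K Δ) N →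
      μ.real {ω | (fun i => X i ω) ∈ BlindUnwrap.missCover Δ d N} ≤
        BlindUnwrap.boundMissCover S n Δ τ ε η := fun N hN =>
    (BlindUnwrap.measureReal_le_sampleLaw hX hlaw _).trans
      (BlindUnwrap.missCover_le hK hn hΔ hS hτ h2 hη hη1 hκ hpack hd hN)
  refine ⟨?_, bfp, bme, bse, fun N hN => ⟨bmc N hN, fun hβ1 => ?_⟩⟩
  · rcases lt_or_ge n (K ^ 2) with hnK | hnK
    · -- for few points the bound on the missed cover exceeds `1`
      have hmc := BlindUnwrap.one_le_boundMissCover hK hn hΔ hS hτ h2 hη hη1 hκ hpack hnK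
      have hfp0 := MeasureTheory.measureReal_nonneg.trans bfp
      have hme0 := MeasureTheory.measureReal_nonneg.trans bme
      have hse0 := MeasureTheory.measureReal_nonneg.trans bse
      exact le_trans (by linarith) MeasureTheory.measureReal_nonneg
    · obtain ⟨C, hC, -⟩ := BlindUnwrap.exists_isCover (K := K)
        (U := BlindUnwrap.ellipsoid S n ∩ BlindUnwrap.cube K Δ) hΔ
        (l := η * τ * BlindUnwrap.kappa K ε / 2) (r := d / 4) (by positivity)
        (by rw [hd]; exact le_of_eq (by ring)) Set.inter_subset_right
      obtain ⟨N, hN⟩ := BlindUnwrap.exists_isMinCover hC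
      refine le_trans ?_ (BlindUnwrap.one_sub_le_accurate hK hnK hΔ hd0 hS hτ h2 hP0 hP1 h3 hβ hM hb
        hN.1 μ X)
      have := bmc N hN
      linarith
  · have hnK := BlindUnwrap.sq_le_of_sample_size (by norm_num) hK hn h4 hP0 hP1 hβ hβ1 hsize
    exact BlindUnwrap.one_sub_le_accurate hK hnK hΔ hd0 hS hτ h2 hP0 hP1 h3 hβ hM hb hN.1 μ X
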